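/- Theorem 6.1. Let $M$ be a smooth manifold with boundary, let $\partial M = E \cup R$ with $E, R$ disjoint, let $\varepsilon>0$, and let $g_s$, $s\in(-\varepsilon,\varepsilon)$, be smooth Riemannian metrics on $M$ depending $C^1$-smoothly on $s$ (in local coordinates, up to the boundary, the components of $g_s$ and their coordinate derivatives of order at most two are differentiable in $s$, and they and their $s$-derivatives are continuous in $(s,x)$). Let $x_0\in E$ and let $v_0\in T_{x_0}M$ be inward pointing with $|v_0|_{g_0}=1$. A broken ray of $g$ from $(x,v)$, $|v|_g=1$, is a continuous unit speed curve $\gamma:[0,\tau]\to M$ with $\gamma(0)=x$, $\dot\gamma(0)=v$, $\gamma(\tau)\in E$, with finitely many reflection times $0<t_1<\dots<t_N<\tau$ at which $\gamma(t_i)\in R$ and $\dot\gamma(t_i+)=\dot\gamma(t_i-)-2\langle\dot\gamma(t_i-),\nu\rangle_g\,\nu$ ($\nu$ the outer $g$-unit normal), and such that between consecutive times of $0,t_1,\dots,t_N,\tau$ it is a $g$-geodesic in $\operatorname{int}M$, $C^1$ up to the end times. Let $\gamma_s:[0,\tau_s]\to M$ denote the broken ray of $g_s$ from $(x_0, v_0/|v_0|_{g_s})$,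 of length $\tau_s$, and put $f=\frac{d}{ds}g_s|_{s=0}$, a symmetric 2-tensor. Suppose $\gamma_0$ exists, that its reflection points and its exit point are not in $\bar R\cap\bar E$, and that it meets $\partial M$ non-tangentially at these points. Then the following hold. 1. For all $s$ close to $0$ the broken ray $\gamma_s$ exists, is unique, has as many reflections as $\gamma_0$, and its reflection and exit points satisfy the same conditions. 2. The travel time $\tau_s$, the exit point $\gamma_s(\tau_s)$ and the exit state $(\gamma_s(\tau_s),\dot\gamma_s(\tau_s))$ (the scattering relation) are differentiable in $s$ at $s=0$, and $$\frac12\int_0^{\tau_0}\frac{d}{ds}\Big|_{s=0}|\dot\gamma_0(t)|^2_{g_s}\,dt=\frac{d}{ds}\Big|_{s=0}\tau_s-\Big\langle\dot\gamma_0(\tau_0),\frac{d}{ds}\Big|_{s=0}\gamma_s(\tau_s)\Big\rangle_{g_0},$$ where the integrand is integrable. 3. In particular, the derivatives at $s=0$ of the travel time and of the scattering relation (indeed of the exit point alone) determine the broken ray transform $\int_0^{\tau_0} f(\dot\gamma_0,\dot\gamma_0)\,dt$ of $f$ on $\gamma_0$: if $h_s$ is another such family of metrics with $h_0=g_0$ and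 these derivatives agree for $g_s$ and $h_s$, then the integrals over $\gamma_0$ of $\frac{d}{ds}g_s|_{s=0}$ and $\frac{d}{ds}h_s|_{s=0}$ agree. 4. More generally, let $\gamma_0$ be any broken ray of $g_0$ from $(x_0,v_0)$ (tangential reflections and exit allowed, no condition on $\bar R\cap\bar E$), with $t_0=0$, $t_{N+1}=\tau_0$, and let $\Gamma_s:[0,\tau_0]\to M$, $|s|<\delta$, be a family of continuous curves with $\Gamma_0=\gamma_0$, $\Gamma_s(0)=x_0$ and $\Gamma_s(t_i)\in R$ for $1\le i\le N$, such that on each $[t_i,t_{i+1}]$ the curves $\Gamma_s$ are $C^1$ and depend $C^1$-smoothly on $s$ as $C^1$ curves ($\Gamma$, $\partial_t\Gamma$, $\partial_s\Gamma$, $\partial_s\partial_t\Gamma$ exist in coordinates and are continuous in $(s,t)$). Then the length $L_s$ of $\Gamma_s$ with respect to $g_s$ and the end point $\Gamma_s(\tau_0)$ are differentiable in $s$ at $s=0$, the integrand below is integrable, and $$\frac12\int_0^{\tau_0}\frac{d}{ds}\Big|_{s=0}|\dot\gamma_0(t)|^2_{g_s}\,dt=\frac{d}{ds}\Big|_{s=0}L_s-\Big\langle\dot\gamma_0(\tau_0),\frac{d}{ds}\Big|_{s=0}\Gamma_s(\tau_0)\Big\rangle_{g_0}.$$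 5. In particular, let $\gamma_0$ be as in 4, and for $|s|<\delta$ let $\gamma_s:[0,\tau_s]\to M$ be broken rays of $g_s$, with any unit initial velocities at $x_0$ (equal to $v_0$ for $s=0$), all with $\gamma_s(0)=x_0$, $\gamma_s(\tau_s)=\gamma_0(\tau_0)$ and the same number of reflections. If, after affine rescaling of each segment to the time interval of the corresponding segment of $\gamma_0$, they form a family that depends $C^1$-smoothly on $s$ as in 4, then $\tau_s$ is differentiable at $s=0$ and $\frac{d}{ds}|_{s=0}\tau_s=\frac12\int_0^{\tau_0}\frac{d}{ds}|_{s=0}|\dot\gamma_0(t)|^2_{g_s}\,dt$. -/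

import Mathlib

open scoped Manifold ContDiff Topology

noncomputable section

namespace BrokenRay

/-- The model vector space `ℝⁿ`. -/
abbrev V (n : ℕ) : Type := EuclideanSpace ℝ (Fin n)

/-- Smooth Riemannian metrics on a smooth `n`-manifold with boundary. -/
abbrev Metric (n : ℕ) [NeZero n] (M : Type*) [TopologicalSpace M]
    [ChartedSpace (EuclideanHalfSpace n) M] [IsManifold (𝓡∂ n) ∞ M] :=
  Bundle.ContMDiffRiemannianMetric (𝓡∂ n) ∞ (V n) (fun x : M => TangentSpace (𝓡∂ n) x)

section Manifold

variable {n : ℕ} [NeZero n] {M : Type*} [TopologicalSpace M]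
  [ChartedSpace (EuclideanHalfSpace n) M] [IsManifold (𝓡∂ n) ∞ M]

/-! ### Metrics in coordinates, families of metrics -/

/-- The coordinate expression `y ↦ (g_{ij}(y))`, as a bilinear form on `ℝⁿ`, of the metric `g` in
the chart at `x₀`. The tangent space at `p` is identified in Mathlib with `ℝⁿ` through the
preferred chart at `p`; `tangentCoordChange (𝓡∂ n) x₀ p p` passes from components in the chart at
`x₀` to that identification. -/
def coordMetric (g : Metric n M) (x₀ : M) (y : V n) : V n →L[ℝ] V n →L[ℝ] ℝ :=
  let p : M := (extChartAt (𝓡∂ n) x₀).symm y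
  let L : V n →L[ℝ] V n := tangentCoordChange (𝓡∂ n) x₀ p p
  let B : V n →L[ℝ] V n →L[ℝ] ℝ := g.inner p
  B.bilinearComp L L

/-- The family `g s`, `|s| < ε`, depends `C¹`-smoothly on `s`: in every chart the components
`g_{ij}` and their coordinate derivatives of order at most two are differentiable in `s`, and they
and their `s`-derivatives are jointly continuous (up to the boundary), i.e. `s ↦ g s` is a `C¹`
curve for the topology of locally uniform convergence of the metric and its first two derivatives.
A `C¹` curve in the Fréchet space of smooth tensor fields has this property. -/
def IsC1Family (ε : ℝ) (g : ℝ → Metric n M) : Prop :=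
  ∀ (x₀ : M) (k : ℕ), k ≤ 2 →
    let U : Set (V n) := (extChartAt (𝓡∂ n) x₀).target
    let D := fun (s : ℝ) (y : V n) => iteratedFDerivWithin ℝ k (coordMetric (g s) x₀) U y
    ContinuousOn (fun p : ℝ × V n => D p.1 p.2) (Set.Ioo (-ε) ε ×ˢ U) ∧
    (∀ s ∈ Set.Ioo (-ε) ε, ∀ y ∈ U, DifferentiableAt ℝ (fun s' => D s' y) s) ∧
    ContinuousOn (fun p : ℝ × V n => deriv (fun s' => D s' p.2) p.1) (Set.Ioo (-ε) ε ×ˢ U)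

/-- The symmetric 2-tensor `d/ds g_s |_{s = 0}`. -/
def metricDeriv (g : ℝ → Metric n M) (x : M) (v w : TangentSpace (𝓡∂ n) x) : ℝ :=
  deriv (fun s => (g s).inner x v w) 0

/-! ### Geodesics -/

/-- Christoffel symbols of the first kind in the chart at `x₀`:
`Γ(u, v, w) = ½ (∂_u g(v, w) + ∂_v g(u, w) - ∂_w g(u, v))`. -/
def christoffel (g : Metric n M) (x₀ : M) (y u v w : V n) : ℝ :=
  let D : V n →L[ℝ] V n →L[ℝ] V n →L[ℝ] ℝ :=
    fderivWithin ℝ (coordMetric g x₀) (extChartAt (𝓡∂ n) x₀).target y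
  (D u v w + D v u w - D w u v) / 2

/-- The curve `γ` satisfies the geodesic equation of `g` at time `t`: it is `C²` near `t`, and in
every chart around `γ t` one has `g_{kl} (c̈ˡ + Γˡ_{ij} ċⁱ ċʲ) = 0` for all `k`. -/
def IsGeodesicAt (g : Metric n M) (γ : ℝ → M) (t : ℝ) : Prop :=
  ContMDiffAt 𝓘(ℝ, ℝ) (𝓡∂ n) 2 γ t ∧
  ∀ x₀ : M, γ t ∈ (chartAt (EuclideanHalfSpace n) x₀).source →
    let c : ℝ → V n := fun r => extChartAt (𝓡∂ n) x₀ (γ r)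
    ∀ w : V n, coordMetric g x₀ (c t) (deriv (deriv c) t) w
      + christoffel g x₀ (c t) (deriv c t) (deriv c t) w = 0

/-! ### Velocities, lengths, ray transforms -/

/-- The velocity of a curve at time `t`. -/
def velocity (γ : ℝ → M) (t : ℝ) : TangentSpace (𝓡∂ n) (γ t) :=
  mfderiv 𝓘(ℝ, ℝ) (𝓡∂ n) γ t (1 : ℝ)

/-- The velocity at time `t ∈ [a, b]` of the restriction of a curve to `[a, b]` (one-sided at the
endpoints). -/
def velocityOn (γ : ℝ → M) (a b t : ℝ) : TangentSpace (𝓡∂ n) (γ t) :=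
  mfderivWithin 𝓘(ℝ, ℝ) (𝓡∂ n) γ (Set.Icc a b) t (1 : ℝ)

/-- The length of the (piecewise `C¹`) curve `γ : [0, T] → M`. -/
def curveLength (g : Metric n M) (γ : ℝ → M) (T : ℝ) : ℝ :=
  ∫ t in (0 : ℝ)..T, √(g.inner (γ t) (velocity γ t) (velocity γ t))

/-- The integral of a 2-tensor `f` over the curve `γ : [0, T] → M`, i.e. `∫ f(γ', γ') dt`; on broken
rays with both endpoints in `E` this is the broken ray transform of `f`. -/
def rayTransform (f : ∀ x : M, TangentSpace (𝓡∂ n) x → TangentSpace (𝓡∂ n) x → ℝ)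
    (γ : ℝ → M) (T : ℝ) : ℝ :=
  ∫ t in (0 : ℝ)..T, f (γ t) (velocity γ t) (velocity γ t)

/-! ### Reflections and broken rays

At a boundary point `p` the preferred chart maps a neighbourhood of `p` in `M` to the half-space
`{y | 0 ≤ y 0}`, so that in the identification of `T_p M` with `ℝⁿ` the vectors tangent to the
boundary are those with zeroth coordinate `0`, and the inward pointing ones those with positive
zeroth coordinate. -/

/-- The zeroth coordinate of a tangent vector at `p` in the preferred chart at `p`. -/
def normalCoord {p : M} (v : TangentSpace (𝓡∂ n) p) : ℝ := (show V n from v) 0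

/-- `ν` is the outer unit normal of the boundary at the boundary point `p`. -/
def IsOuterUnitNormal (g : Metric n M) (p : M) (ν : TangentSpace (𝓡∂ n) p) : Prop :=
  normalCoord ν < 0 ∧ g.inner p ν ν = 1 ∧
    ∀ w : TangentSpace (𝓡∂ n) p, normalCoord w = 0 → g.inner p ν w = 0

/-- The reflection law (angle of incidence equals angle of reflection): the outgoing velocity is
`v⁺ = v⁻ - 2 ⟨v⁻, ν⟩ ν`. -/
def IsReflection (g : Metric n M) (p : M) (vin vout : TangentSpace (𝓡∂ n) p) : Prop :=
  ∃ ν, IsOuterUnitNormal g p ν ∧ vout = vin - (2 * g.inner p vin ν) • ν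

/-- `γ : [0, T] → M`, `T = t (N + 1)`, is the unit speed broken ray of the metric `g` that starts at
the point `x` with velocity `v`, reflects on `R` exactly `N` times, at the times
`t 1 < ⋯ < t N` (with `0 = t 0` and `t N < T`), and exits at time `T`, the first positive time at
which it hits `E`. Between these times it is a geodesic in the interior of `M`. Only
`t 0, …, t (N + 1)` and the restriction of `γ` to `[0, T]` are relevant. -/
structure IsBrokenRay (g : Metric n M) (E R : Set M) (x : M) (v : TangentSpace (𝓡∂ n) x)
    (N : ℕ) (t : ℕ → ℝ) (γ : ℝ → M) : Prop where
  time_zero : t 0 = 0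
  time_lt : ∀ i ≤ N, t i < t (i + 1)
  contMDiffOn : ∀ i ≤ N, ContMDiffOn 𝓘(ℝ, ℝ) (𝓡∂ n) 1 γ (Set.Icc (t i) (t (i + 1)))
  mem_interior : ∀ i ≤ N, ∀ r ∈ Set.Ioo (t i) (t (i + 1)), γ r ∈ (𝓡∂ n).interior M
  geodesic : ∀ i ≤ N, ∀ r ∈ Set.Ioo (t i) (t (i + 1)), IsGeodesicAt g γ r
  unit_speed : ∀ i ≤ N, ∀ r ∈ Set.Icc (t i) (t (i + 1)),
    g.inner (γ r) (velocityOn γ (t i) (t (i + 1)) r) (velocityOn γ (t i) (t (i + 1)) r) = 1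
  start : (⟨γ 0, velocityOn γ (t 0) (t 1) 0⟩ : TangentBundle (𝓡∂ n) M) = ⟨x, v⟩
  reflect_mem : ∀ i < N, γ (t (i + 1)) ∈ R
  reflect_law : ∀ i < N, IsReflection g (γ (t (i + 1)))
    (velocityOn γ (t i) (t (i + 1)) (t (i + 1)))
    (velocityOn γ (t (i + 1)) (t (i + 2)) (t (i + 1)))
  exit_mem : γ (t (N + 1)) ∈ E

variable (n) in
/-- All reflection points and the exit point of a broken ray lie outside `closure R ∩ closure E`, and
the ray meets the boundary non-tangentially there. -/
def IsNontangential (E R : Set M) (N : ℕ) (t : ℕ → ℝ) (γ : ℝ → M) : Prop :=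
  ∀ i ≤ N, γ (t (i + 1)) ∉ closure R ∩ closure E ∧
    normalCoord (velocityOn (n := n) γ (t i) (t (i + 1)) (t (i + 1))) ≠ 0

/-- The positive multiple of `v` which is a unit vector for `g`. -/
def unitVector (g : Metric n M) {x : M} (v : TangentSpace (𝓡∂ n) x) : TangentSpace (𝓡∂ n) x :=
  (√(g.inner x v v))⁻¹ • v

variable (n) in
/-- The exit point and exit direction of a broken ray; as a function of the initial point and
direction this is the scattering relation. -/
def exitState (N : ℕ) (t : ℕ → ℝ) (γ : ℝ → M) : TangentBundle (𝓡∂ n) M :=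
  ⟨γ (t (N + 1)), velocityOn γ (t N) (t (N + 1)) (t (N + 1))⟩

variable (n) in
/-- The curves `Γ s : [t 0, t (N + 1)] → M`, `|s| < δ`, are continuous, `C¹` on each interval
`[t i, t (i + 1)]`, and depend `C¹`-smoothly on `s` as such: on each of the rectangles
`(-δ, δ) × [t i, t (i + 1)]` the map `Γ` is continuous and in all charts the derivatives `∂_t Γ`,
`∂_s Γ` and `∂_s ∂_t Γ` exist and are continuous. In other words, `s ↦ Γ s` is a `C¹` curve in the
space of `C¹` curves on `[t i, t (i + 1)]`. -/
def IsC1Variation (δ : ℝ) (N : ℕ) (t : ℕ → ℝ) (Γ : ℝ → ℝ → M) : Prop :=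
  ∀ i ≤ N,
    let J : Set ℝ := Set.Icc (t i) (t (i + 1))
    let Q : Set (ℝ × ℝ) := Set.Ioo (-δ) δ ×ˢ J
    ContinuousOn (fun p : ℝ × ℝ => Γ p.1 p.2) Q ∧
    ∀ x₀ : M,
      let U : Set (ℝ × ℝ) :=
        {p | p ∈ Q ∧ Γ p.1 p.2 ∈ (chartAt (EuclideanHalfSpace n) x₀).source}
      let F : ℝ → ℝ → V n := fun s r => extChartAt (𝓡∂ n) x₀ (Γ s r)
      (∀ p ∈ U, DifferentiableWithinAt ℝ (F p.1) J p.2 ∧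
        DifferentiableAt ℝ (fun s => F s p.2) p.1 ∧
        DifferentiableAt ℝ (fun s => derivWithin (F s) J p.2) p.1) ∧
      ContinuousOn (fun p : ℝ × ℝ => derivWithin (F p.1) J p.2) U ∧
      ContinuousOn (fun p : ℝ × ℝ => deriv (fun s => F s p.2) p.1) U ∧
      ContinuousOn (fun p : ℝ × ℝ => deriv (fun s => derivWithin (F s) J p.2) p.1) U

end Manifold

end BrokenRay

end

/-! Everything rests on one scalar, the momentum `⟨γ̇, J⟩` for `g 0`, where `J` is the derivative at
`s = 0` of a family of curves. Along a geodesic of `g 0` its time derivative is half the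
`s`-derivative of the energy `|γ̇_s|²` for `g s`, minus `½ f(γ̇, γ̇)` (`hasDerivWithinAt_momentum`
combined with `hasDerivAt_energy`). For unit speed geodesics of `g s` the energy is constantly `1`,
so `½ ∫ f(γ̇, γ̇)` is the momentum at the start minus the momentum at the end. A moving end time `τ
s` adds `τ' γ̇` to the derivative of the end point, and `⟨γ̇, γ̇⟩ = 1` turns this into the
derivative of the travel time (`IsGeodesicFlow.integral_metricDot`).

The identity is additive. Across chart pieces the intermediate times and momenta cancel
(`Propagates.trans`). At a reflection the base points move inside the boundary, so `J` is
tangential, while the velocity jumps by a normal vector; hence the momentum is unchanged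
(`IsUnitFamily.exists_reflection`). At `x₀` the base point is fixed and the momentum is zero. Only
the exit term of the theorem survives, and the right side depends on the family of metrics only
through the derivatives of the travel time and of the exit point.

It remains to produce the family and its derivative. The geodesic acceleration is `C¹` in parameter,
position and velocity up to the boundary, and extends across it (`exists_contDiffAt_extension`).
With the parameter as an extra state variable, the flow is differentiable in `s` and in the initial
vector at once (`exists_flow`, `IsC1Family.exists_geodesicFlow`). Near a non-tangential hit the
height above the boundary is strictly decreasing in time, so the hitting time is its only zero and
can be differentiated implicitly (`hasDerivAt_of_zero`, `IsGeodesicFlow.propagates_exit`). Finitely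
many flow boxes make up one arc (`IsArc.propagates`), and an induction over the arcs gives the ray
(`IsRayFamily.extend`). Hits remain in `R`, respectively `E`, because they avoid the closure of the
other set. Uniqueness for the differential equation identifies any given broken rays with the
constructed ones (`IsBrokenRay.unique`).

For arbitrary variations the energy is not constant, but the square root has derivative `½` at `1`,
so the same momentum identity yields the first variation of length (`IsC1Family.hasDerivAt_length`,
`hasDerivAt_curveLength`). With fixed endpoints the momenta at both ends vanish, and the length of a
rescaled broken ray is its travel time. -/

noncomputable section

namespace BrokenRay

set_option linter.unusedSectionVars false

/-! ### Calculus: joint differentiability, extension across a hyperplane, induction on intervals. -/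

section Analysis

open Set Filter Metric

variable {E F : Type*} [NormedAddCommGroup E] [NormedSpace ℝ E]
  [NormedAddCommGroup F] [NormedSpace ℝ F]

/-- Joint differentiability at a point, from a jointly continuous partial derivative in the scalar
variable and differentiability in the other variable. -/
theorem hasFDerivWithinAt_of_partial {f f₁ : ℝ → E → F} {s₀ : ℝ} {y₀ : E} {U : Set E}
    {f₂ : E →L[ℝ] F}
    (h₁ : ∀ᶠ p in 𝓝[univ ×ˢ U] (s₀, y₀), HasDerivAt (fun s => f s p.2) (f₁ p.1 p.2) p.1)
    (hc : ContinuousWithinAt (fun p : ℝ × E => f₁ p.1 p.2) (univ ×ˢ U) (s₀, y₀))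
    (h₂ : HasFDerivWithinAt (f s₀) f₂ U y₀) :
    HasFDerivWithinAt (fun p : ℝ × E => f p.1 p.2)
      ((ContinuousLinearMap.toSpanSingleton ℝ (f₁ s₀ y₀)).comp (ContinuousLinearMap.fst ℝ ℝ E) +
        f₂.comp (ContinuousLinearMap.snd ℝ ℝ E)) (univ ×ˢ U) (s₀, y₀) := by
  have hA : HasFDerivWithinAt (fun p : ℝ × E => f s₀ p.2)
      (f₂.comp (ContinuousLinearMap.snd ℝ ℝ E)) (univ ×ˢ U) (s₀, y₀) :=
    HasFDerivWithinAt.comp (s₀, y₀) (t := U) h₂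
      (hasFDerivAt_snd.hasFDerivWithinAt) (fun p hp => hp.2)
  have hB : HasFDerivWithinAt (fun p : ℝ × E => f p.1 p.2 - f s₀ p.2)
      ((ContinuousLinearMap.toSpanSingleton ℝ (f₁ s₀ y₀)).comp (ContinuousLinearMap.fst ℝ ℝ E))
      (univ ×ˢ U) (s₀, y₀) := by
    rw [hasFDerivWithinAt_iff_isLittleO, Asymptotics.isLittleO_iff]
    intro c hc0
    have h3 : ∀ᶠ p in 𝓝[univ ×ˢ U] (s₀, y₀), ‖f₁ p.1 p.2 - f₁ s₀ y₀‖ ≤ c := by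
      have := (hc.sub (continuousWithinAt_const (b := f₁ s₀ y₀))).norm
      have h4 := Filter.Tendsto.eventually_lt_const (u := c) (by simpa using hc0) this
      exact h4.mono fun p hp => le_of_lt hp
    have h5 := h₁.and h3
    rw [nhdsWithin_prod_eq, nhdsWithin_univ] at h5
    obtain ⟨r, hr, V, hV, hrV⟩ : ∃ r > 0, ∃ V ∈ 𝓝[U] y₀, ∀ s ∈ ball s₀ r, ∀ y ∈ V,
        HasDerivAt (fun s => f s y) (f₁ s y) s ∧ ‖f₁ s y - f₁ s₀ y₀‖ ≤ c := by
      obtain ⟨p₁, hp₁, p₂, hp₂, h⟩ := Filter.eventually_prod_iff.1 h5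
      obtain ⟨r, hr, hr'⟩ := Metric.eventually_nhds_iff_ball.1 hp₁
      exact ⟨r, hr, {y | p₂ y}, hp₂, fun s hs y hy => h (hr' s hs) hy⟩
    rw [nhdsWithin_prod_eq, nhdsWithin_univ]
    filter_upwards [prod_mem_prod (ball_mem_nhds s₀ hr) hV] with p hp
    -- For fixed `y` the mean value inequality in `s` is applied after subtracting the linear term;
    -- the remaining derivative is at most `c`, uniformly in `y` near `y₀`, by joint continuity of
    -- `f₁`.
    have := (convex_ball s₀ r).norm_image_sub_le_of_norm_hasDerivWithin_le
      (f := fun s => f s p.2 - s • f₁ s₀ y₀) (f' := fun s => f₁ s p.2 - f₁ s₀ y₀) (C := c)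
      (fun s hs => ((hrV s hs p.2 hp.2).1.sub (by
        simpa using (hasDerivAt_id s).smul_const (f₁ s₀ y₀))).hasDerivWithinAt)
      (fun s hs => (hrV s hs p.2 hp.2).2) (mem_ball_self hr) hp.1
    calc _ = ‖f p.1 p.2 - p.1 • f₁ s₀ y₀ - (f s₀ p.2 - s₀ • f₁ s₀ y₀)‖ := by
            congr 1; simp [sub_smul]; abel
      _ ≤ c * ‖p.1 - s₀‖ := this
      _ ≤ c * ‖p - (s₀, y₀)‖ := by
            gcongr; exact norm_fst_le (p - (s₀, y₀))
  have := hB.add hA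
  refine this.congr_of_eventuallyEq (Eventually.of_forall fun p => ?_) ?_ <;> simp

/-- A `C¹` function on one side of a hyperplane extends across it. -/
theorem exists_contDiffAt_extension (ℓ : E →L[ℝ] ℝ) (ρ : E →L[ℝ] E) {e : E} (he : 0 < ℓ e)
    (hρℓ : ∀ z, ℓ (ρ z) = -ℓ z) (hρ : ∀ z, ℓ z = 0 → ρ z = z) {O : Set E} (hO : IsOpen O)
    {f : E → F} (hf : ContDiffOn ℝ 1 f (O ∩ {z | 0 ≤ ℓ z})) {z₀ : E} (hz₀ : z₀ ∈ O)
    (h₀ : 0 ≤ ℓ z₀) :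
    ∃ f' : E → F, ContDiffAt ℝ 1 f' z₀ ∧ ∀ z, 0 ≤ ℓ z → f' z = f z := by
  set H : Set E := {z | 0 ≤ ℓ z} with hH
  set H' : Set E := {z | ℓ z ≤ 0} with hH'
  have hHc : IsClosed H := isClosed_le continuous_const ℓ.continuous
  have hHc' : IsClosed H' := isClosed_le ℓ.continuous continuous_const
  have hHconv : Convex ℝ H := by
    intro x hx y hy a b ha hb _
    simp only [hH, mem_ofPred_eq, map_add, map_smul, smul_eq_mul] at *
    positivity
  have hHint : (interior H).Nonempty := by
    refine ⟨e, mem_interior.2 ⟨{z | 0 < ℓ z}, fun z hz => show 0 ≤ ℓ z from le_of_lt hz,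
      isOpen_lt continuous_const ℓ.continuous, he⟩⟩
  have hU : UniqueDiffOn ℝ (O ∩ H) := by
    rw [inter_comm]; exact (uniqueDiffOn_convex hHconv hHint).inter hO
  -- The midpoint of `z` and `ρ z`, a point of the hyperplane. The extension works because `P` and
  -- `ρ` fix the hyperplane, so that the values match there, and `2 P - ρ` is the identity, so that
  -- the derivatives match too.
  set P : E →L[ℝ] E := (1 / 2 : ℝ) • (ContinuousLinearMap.id ℝ E + ρ) with hP
  have hℓP : ∀ z, ℓ (P z) = 0 := fun z => by simp [hP, hρℓ]
  have hPz : ∀ z, ℓ z = 0 → P z = z := fun z hz => by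
    simp only [hP, smul_apply, add_apply,
      ContinuousLinearMap.id_apply, hρ z hz, ← two_smul ℝ z, smul_smul]
    norm_num
  have hPρ : (2 : ℝ) • P - ρ = ContinuousLinearMap.id ℝ E := by
    ext z; simp [hP, smul_smul]
  rcases h₀.eq_or_lt with h0 | h0
  swap
  · refine ⟨f, (hf z₀ ⟨hz₀, h₀⟩).contDiffAt ?_, fun _ _ => rfl⟩
    exact inter_mem (hO.mem_nhds hz₀) (mem_of_superset
      ((isOpen_lt continuous_const ℓ.continuous).mem_nhds h0) fun z hz => show 0 ≤ ℓ z from le_of_lt hz)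
  set f' : E → F := fun z => if 0 ≤ ℓ z then f z else (2 : ℝ) • f (P z) - f (ρ z) with hf'
  set A : E → E →L[ℝ] F := fderivWithin ℝ f (O ∩ H) with hA
  set A' : E → E →L[ℝ] F := fun z => if 0 ≤ ℓ z then A z else
    (2 : ℝ) • (A (P z)).comp P - (A (ρ z)).comp ρ with hA'
  set O' : Set E := O ∩ P ⁻¹' O ∩ ρ ⁻¹' O with hO'
  have hO'o : IsOpen O' := (hO.inter (hO.preimage P.continuous)).inter (hO.preimage ρ.continuous)
  have hz₀' : z₀ ∈ O' := by
    refine ⟨⟨hz₀, ?_⟩, ?_⟩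
    · simpa [hPz z₀ h0.symm] using hz₀
    · simpa [hρ z₀ h0.symm] using hz₀
  have hAf : ∀ z ∈ O ∩ H, HasFDerivWithinAt f (A z) (O ∩ H) z := fun z hz =>
    ((hf z hz).differentiableWithinAt one_ne_zero).hasFDerivWithinAt
  have hAc : ContinuousOn A (O ∩ H) := hf.continuousOn_fderivWithin hU le_rfl
  -- On the far side the formula evaluates `f` only at the projected and at the reflected point;
  -- both lie in the domain of `f` once `z` is in `O'`.
  have hmP : ∀ z ∈ O' ∩ H', P z ∈ O ∩ H := fun z hz => ⟨hz.1.1.2, (hℓP z).ge⟩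
  have hmρ : ∀ z ∈ O' ∩ H', ρ z ∈ O ∩ H := fun z hz => ⟨hz.1.2, by
    simp only [hH, mem_ofPred_eq, hρℓ]; linarith [show ℓ z ≤ 0 from hz.2]⟩
  have hfH : ∀ z ∈ H', f' z = (2 : ℝ) • f (P z) - f (ρ z) := fun z hz => by
    by_cases h : 0 ≤ ℓ z
    · have hz0 : ℓ z = 0 := le_antisymm hz h
      simp only [hf', if_pos h, hPz z hz0, hρ z hz0, two_smul]; abel
    · simp only [hf', if_neg h]
  have hAH : ∀ z ∈ H', A' z = (2 : ℝ) • (A (P z)).comp P - (A (ρ z)).comp ρ := fun z hz => by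
    by_cases h : 0 ≤ ℓ z
    · have hz0 : ℓ z = 0 := le_antisymm hz h
      simp only [hA', if_pos h, hPz z hz0, hρ z hz0]
      ext w
      have := congrArg (A z) (DFunLike.congr_fun hPρ w)
      simpa using this.symm
    · simp only [hA', if_neg h]
  have hun : (O' ∩ H) ∪ (O' ∩ H') = O' := by
    rw [← inter_union_distrib_left]
    refine inter_eq_left.2 fun z _ => ?_
    exact le_total 0 (ℓ z)
  have hOH : O' ∩ H ⊆ O ∩ H := fun z hz => ⟨hz.1.1.1, hz.2⟩
  have hcl : ∀ z ∈ O', z ∉ H → z ∉ closure (O' ∩ H) := fun z _ h hz =>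
    h (hHc.closure_subset_iff.2 inter_subset_right hz)
  have hcl' : ∀ z ∈ O', z ∉ H' → z ∉ closure (O' ∩ H') := fun z _ h hz =>
    h (hHc'.closure_subset_iff.2 inter_subset_right hz)
  have hder : ∀ z ∈ O', HasFDerivAt f' (A' z) z := by
    intro z hz
    -- The derivative is found within each closed half separately and then glued; away from the
    -- closure of a half, differentiability within it is vacuous.
    have h1 : HasFDerivWithinAt f' (A' z) (O' ∩ H) z := by
      by_cases h : z ∈ H
      · have : A' z = A z := if_pos h
        rw [this]
        exact ((hAf z ⟨hz.1.1, h⟩).mono hOH).congr (fun w hw => if_pos hw.2) (if_pos h)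
      · exact HasFDerivWithinAt.of_notMem_closure (hcl z hz h)
    have h2 : HasFDerivWithinAt f' (A' z) (O' ∩ H') z := by
      by_cases h : z ∈ H'
      · rw [hAH z h]
        refine HasFDerivWithinAt.congr ?_ (fun w hw => hfH w hw.2) (hfH z h)
        refine HasFDerivWithinAt.sub (HasFDerivWithinAt.const_smul ?_ _) ?_
        · exact (hAf _ (hmP z ⟨hz, h⟩)).comp z P.hasFDerivWithinAt hmP
        · exact (hAf _ (hmρ z ⟨hz, h⟩)).comp z ρ.hasFDerivWithinAt hmρ
      · exact HasFDerivWithinAt.of_notMem_closure (hcl' z hz h)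
    have := h1.union h2
    rw [hun] at this
    exact this.hasFDerivAt (hO'o.mem_nhds hz)
  have hcont : ∀ z ∈ O', ContinuousAt A' z := by
    intro z hz
    have h1 : ContinuousWithinAt A' (O' ∩ H) z := by
      by_cases h : z ∈ H
      · exact ((hAc z ⟨hz.1.1, h⟩).mono hOH).congr (fun w hw => if_pos hw.2) (if_pos h)
      · exact continuousWithinAt_of_notMem_closure (hcl z hz h)
    have h2 : ContinuousWithinAt A' (O' ∩ H') z := by
      by_cases h : z ∈ H'
      · refine ContinuousWithinAt.congr ?_ (fun w hw => hAH w hw.2) (hAH z h)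
        refine ContinuousWithinAt.sub (ContinuousWithinAt.fun_const_smul ?_ _) ?_
        · exact ContinuousWithinAt.clm_comp ((hAc _ (hmP z ⟨hz, h⟩)).comp
            P.continuous.continuousWithinAt hmP) continuousWithinAt_const
        · exact ContinuousWithinAt.clm_comp ((hAc _ (hmρ z ⟨hz, h⟩)).comp
            ρ.continuous.continuousWithinAt hmρ) continuousWithinAt_const
      · exact continuousWithinAt_of_notMem_closure (hcl' z hz h)
    have := h1.union h2
    rw [hun] at this
    exact this.continuousAt (hO'o.mem_nhds hz)
  refine ⟨f', ?_, fun z hz => if_pos hz⟩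
  rw [contDiffAt_one_iff]
  exact ⟨A', O', hO'o.mem_nhds hz₀', fun z hz => (hcont z hz).continuousWithinAt, hder⟩

/-- If a property of intervals is additive and holds locally, it holds globally. -/
theorem interval_induction {P : ℝ → ℝ → Prop} {a b : ℝ} (hab : a ≤ b)
    (trans : ∀ x y z, a ≤ x → x ≤ y → y ≤ z → z ≤ b → P x y → P y z → P x z)
    (loc : ∀ r ∈ Icc a b, ∃ δ > 0, ∀ x y, a ≤ x → x ≤ y → y ≤ b → |x - r| < δ → |y - r| < δ →
      P x y) : P a b := by
  let S : Set ℝ := {x ∈ Icc a b | P a x}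
  have haS : a ∈ S := by
    obtain ⟨δ, hδ, h⟩ := loc a ⟨le_rfl, hab⟩
    exact ⟨⟨le_rfl, hab⟩, h a a le_rfl le_rfl hab (by simpa) (by simpa)⟩
  have hbdd : BddAbove S := ⟨b, fun x hx => hx.1.2⟩
  -- The points reachable from `a` have supremum `c`. The local property at `c` reaches from a point
  -- just below `c` to `min b (c + δ / 2)`, which would exceed the supremum unless it equals `b`.
  set c := sSup S with hc
  have hac : a ≤ c := le_csSup hbdd haS
  have hcb : c ≤ b := csSup_le ⟨a, haS⟩ fun x hx => hx.1.2
  obtain ⟨δ, hδ, h⟩ := loc c ⟨hac, hcb⟩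
  obtain ⟨x, hxS, hx⟩ := exists_lt_of_lt_csSup ⟨a, haS⟩ (show c - δ < sSup S by linarith)
  have hxc : x ≤ c := le_csSup hbdd hxS
  set d := min b (c + δ / 2) with hd
  have hdc : c ≤ d := le_min hcb (by linarith)
  have hdb : d ≤ b := min_le_left _ _
  have hPd : P a d := by
    refine trans a x d le_rfl hxS.1.1 (hxc.trans hdc) hdb hxS.2 (h x d hxS.1.1 (hxc.trans hdc) hdb
      ?_ ?_)
    · rw [abs_lt]; constructor <;> linarith
    · rw [abs_lt]; constructor <;> linarith [min_le_right b (c + δ / 2)]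
  have : d ≤ c := le_csSup hbdd ⟨⟨hac.trans hdc, hdb⟩, hPd⟩
  have hdb' : d = b := by
    rcases min_choice b (c + δ / 2) with h1 | h1
    · exact h1
    · linarith
  rwa [← hdb']

end Analysis

/-! ### Differentiable dependence of flows on initial values, and implicit differentiation. -/

section Flow

open Set Filter Metric

variable {W : Type*} [NormedAddCommGroup W] [NormedSpace ℝ W]

/-- The bound `2 * K * η ≤ 1` lets a single application of Picard–Lindelöf cover all of `[0, η]`: in
the unit ball around the identity `‖A‖ ≤ 2`, so the right side is at most `2 * K`. The solution is
the candidate for the derivative of a flow. -/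
theorem exists_linearODE [CompleteSpace W] {B : ℝ → W →L[ℝ] W} {η K : ℝ} (hη : 0 < η)
    (hB : ContinuousOn B (Icc 0 η)) (hK : ∀ t ∈ Icc 0 η, ‖B t‖ ≤ K) (hKη : 2 * K * η ≤ 1) :
    ∃ A : ℝ → W →L[ℝ] W, A 0 = ContinuousLinearMap.id ℝ W ∧
      ∀ t ∈ Icc 0 η, HasDerivWithinAt A ((B t).comp (A t)) (Icc 0 η) t := by
  have hK0 : 0 ≤ K := (norm_nonneg _).trans (hK 0 ⟨le_rfl, hη.le⟩)
  have hPL : IsPicardLindelof (fun t (A : W →L[ℝ] W) => (B t).comp A) (tmin := 0) (tmax := η)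
      ⟨0, le_rfl, hη.le⟩ (ContinuousLinearMap.id ℝ W) 1 0 ⟨2 * K, by positivity⟩ ⟨K, hK0⟩ := by
    refine ⟨fun t ht => ?_, fun A _ => hB.clm_comp continuousOn_const, fun t ht A hA => ?_, ?_⟩
    · refine LipschitzOnWith.of_dist_le_mul fun A _ A' _ => ?_
      rw [dist_eq_norm, dist_eq_norm, ← ContinuousLinearMap.comp_sub]
      exact (ContinuousLinearMap.opNorm_comp_le _ _).trans (by
        gcongr; exact hK t ht)
    · have h1 : ‖A‖ ≤ 2 := by
        have h2 : ‖A - ContinuousLinearMap.id ℝ W‖ ≤ 1 := by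
          simpa [dist_eq_norm] using hA
        calc ‖A‖ = ‖(A - ContinuousLinearMap.id ℝ W) + ContinuousLinearMap.id ℝ W‖ := by simp
          _ ≤ 1 + 1 := (norm_add_le _ _).trans (add_le_add h2 ContinuousLinearMap.norm_id_le)
          _ = 2 := by norm_num
      calc ‖(B t).comp A‖ ≤ ‖B t‖ * ‖A‖ := ContinuousLinearMap.opNorm_comp_le _ _
        _ ≤ K * 2 := by gcongr; exact hK t ht
        _ = 2 * K := by ring
    · simp only [sub_zero, sub_self, NNReal.coe_one, NNReal.coe_zero]
      rw [max_eq_left hη.le]; exact hKη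
  obtain ⟨A, hA0, hA⟩ := hPL.exists_eq_forall_mem_Icc_hasDerivWithinAt₀
  exact ⟨A, hA0, hA⟩

/-- Differentiability of solutions of an ODE in the initial value, in the direction of positive
times. -/
theorem hasFDerivAt_flow [FiniteDimensional ℝ W] {X : W → W} {z₀ : W} {R K L η r : ℝ} {Φ : W → ℝ → W}
    (hR : ∀ z ∈ closedBall z₀ R, HasFDerivAt X (fderiv ℝ X z) z)
    (hXc : ContinuousOn (fderiv ℝ X) (closedBall z₀ R))
    (hK : ∀ z ∈ closedBall z₀ R, ‖fderiv ℝ X z‖ ≤ K)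
    (hΦ0 : ∀ z ∈ ball z₀ r, Φ z 0 = z)
    (hΦ : ∀ z ∈ ball z₀ r, ∀ t ∈ Icc 0 η, HasDerivAt (Φ z) (X (Φ z t)) t ∧
      Φ z t ∈ closedBall z₀ R)
    (hL : ∀ t ∈ Icc 0 η, ∀ z ∈ ball z₀ r, ∀ z' ∈ ball z₀ r, ‖Φ z t - Φ z' t‖ ≤ L * ‖z - z'‖)
    {z : W} (hz : z ∈ ball z₀ r) {A : ℝ → W →L[ℝ] W} (hA0 : A 0 = ContinuousLinearMap.id ℝ W)
    (hA : ∀ t ∈ Icc 0 η, HasDerivWithinAt A ((fderiv ℝ X (Φ z t)).comp (A t)) (Icc 0 η) t)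
    {t : ℝ} (ht : t ∈ Icc 0 η) : HasFDerivAt (fun z => Φ z t) (A t) z := by
  have hη : 0 ≤ η := ht.1.trans ht.2
  have hK0 : 0 ≤ K := (norm_nonneg _).trans (hK _ (hΦ z hz 0 ⟨le_rfl, hη⟩).2)
  -- `K` may be zero; a positive rate is needed for the closed form of Gronwall's bound, which
  -- divides by it.
  set K' := K + 1 with hK'
  have hK'0 : 0 < K' := by positivity
  -- the Gronwall constant
  set M := max L 0 * (Real.exp (K' * η)) / K' with hM
  have hM0 : 0 ≤ M := by positivity
  rw [hasFDerivAt_iff_isLittleO, Asymptotics.isLittleO_iff]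
  intro c hc
  -- Chosen so that `c' * M ≤ c` after Gronwall's inequality.
  set c' := c / (M + 1) with hc'
  have hc'0 : 0 < c' := by positivity
  have huc := (isCompact_closedBall z₀ R).uniformContinuousOn_of_continuous hXc
  obtain ⟨d, hd, hd'⟩ := Metric.uniformContinuousOn_iff.1 huc c' hc'0
  have hev : ∀ᶠ y in 𝓝 z, y ∈ ball z₀ r ∧ max L 0 * ‖y - z‖ < d := by
    refine Filter.Eventually.and (isOpen_ball.mem_nhds hz) ?_
    have : Tendsto (fun y => max L 0 * ‖y - z‖) (𝓝 z) (𝓝 (max L 0 * ‖z - z‖)) := by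
      exact (Continuous.tendsto (by fun_prop) z)
    exact this.eventually_lt_const (by simpa using hd)
  filter_upwards [hev] with y hy
  have hLyz : ∀ t ∈ Icc 0 η, ‖Φ y t - Φ z t‖ ≤ max L 0 * ‖y - z‖ := fun t ht =>
    (hL t ht y hy.1 z hz).trans (by gcongr; exact le_max_left _ _)
  -- The error of the linear approximation. It starts at zero and satisfies `‖D'‖ ≤ K' ‖D‖ + o(‖y -
  -- z‖)`, so Gronwall makes it `o(‖y - z‖)`.
  set D : ℝ → W := fun t => Φ y t - Φ z t - A t (y - z) with hD
  have hDd : ∀ t ∈ Icc 0 η, HasDerivWithinAt D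
      (X (Φ y t) - X (Φ z t) - fderiv ℝ X (Φ z t) (A t (y - z))) (Icc 0 η) t := by
    intro t ht
    have h1 := ((hΦ y hy.1 t ht).1.sub (hΦ z hz t ht).1).hasDerivWithinAt (s := Icc 0 η)
    have h2 := (hA t ht).clm_apply (hasDerivWithinAt_const t (Icc 0 η) (y - z))
    exact (h1.sub h2).congr_deriv (by simp)
  have hbound : ∀ t ∈ Icc 0 η, ‖X (Φ y t) - X (Φ z t) - fderiv ℝ X (Φ z t) (A t (y - z))‖ ≤
      K' * ‖D t‖ + c' * (max L 0 * ‖y - z‖) := by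
    intro t ht
    have hmem := (hΦ z hz t ht).2
    have hmemy := (hΦ y hy.1 t ht).2
    have h1 : ‖X (Φ y t) - X (Φ z t) - fderiv ℝ X (Φ z t) (Φ y t - Φ z t)‖ ≤
        c' * ‖Φ y t - Φ z t‖ := by
      -- On this convex set `fderiv ℝ X` differs from its value at `Φ z t` by at most `c'`, by
      -- uniform continuity on the compact ball; the mean value inequality then bounds the
      -- second-order remainder.
      have hconv : Convex ℝ (closedBall z₀ R ∩ ball (Φ z t) d) :=
        (convex_closedBall _ _).inter (convex_ball _ _)
      refine hconv.norm_image_sub_le_of_norm_hasFDerivWithin_le'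
        (f' := fderiv ℝ X) (fun w hw => (hR w hw.1).hasFDerivWithinAt) (fun w hw => ?_)
        ⟨hmem, mem_ball_self hd⟩ ⟨hmemy, ?_⟩
      · rw [← dist_eq_norm]
        exact (hd' w hw.1 _ hmem hw.2).le
      · rw [mem_ball, dist_eq_norm]
        exact (hLyz t ht).trans_lt hy.2
    have h2 : X (Φ y t) - X (Φ z t) - fderiv ℝ X (Φ z t) (A t (y - z)) =
        fderiv ℝ X (Φ z t) (D t) +
          (X (Φ y t) - X (Φ z t) - fderiv ℝ X (Φ z t) (Φ y t - Φ z t)) := by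
      simp only [hD, map_sub]; abel
    rw [h2]
    refine (norm_add_le _ _).trans (add_le_add ?_ (h1.trans ?_))
    · exact (ContinuousLinearMap.le_opNorm _ _).trans (by
        gcongr; exact (hK _ hmem).trans (by linarith))
    · gcongr; exact hLyz t ht
  have hgr := norm_le_gronwallBound_of_norm_deriv_right_le (f := D) (δ := 0) (K := K')
    (ε := c' * (max L 0 * ‖y - z‖)) (a := 0) (b := η)
    (fun t ht => (hDd t ht).continuousWithinAt)
    (fun t ht => (hDd t ⟨ht.1, ht.2.le⟩).mono_of_mem_nhdsWithin (Icc_mem_nhdsGE_of_mem ht))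
    (by simp [hD, hΦ0 y hy.1, hΦ0 z hz, hA0]) (fun t ht => hbound t ⟨ht.1, ht.2.le⟩) t ht
  rw [gronwallBound_of_K_ne_0 hK'0.ne'] at hgr
  calc _ = ‖D t‖ := rfl
    _ ≤ c' * (max L 0 * ‖y - z‖) / K' * Real.exp (K' * η) := by
        refine hgr.trans ?_
        simp only [zero_mul, zero_add, sub_zero]
        gcongr
        refine (sub_le_self _ zero_le_one).trans (Real.exp_le_exp.2 ?_)
        gcongr; exact ht.2
    _ = c' * M * ‖y - z‖ := by rw [hM]; ring
    _ ≤ c * ‖y - z‖ := by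
        gcongr
        rw [hc', div_mul_eq_mul_div, div_le_iff₀ (by positivity)]
        nlinarith

/-- The local flow of a `C¹` vector field, with its derivative in the initial value. -/
theorem exists_flow [FiniteDimensional ℝ W] {X : W → W} {z₀ : W} (hX : ContDiffAt ℝ 1 X z₀)
    {O : Set W} (hO : O ∈ 𝓝 z₀) :
    ∃ η > 0, ∃ r > 0, ∃ Φ : W → ℝ → W, (∀ z ∈ ball z₀ r, Φ z 0 = z) ∧
      (∀ z ∈ ball z₀ r, ∀ t ∈ Icc (-η) η, HasDerivAt (Φ z) (X (Φ z t)) t ∧ Φ z t ∈ O ∧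
        ContDiffAt ℝ 1 X (Φ z t)) ∧
      ContinuousOn (fun p : W × ℝ => Φ p.1 p.2) (ball z₀ r ×ˢ Icc (-η) η) ∧
      ∀ z ∈ ball z₀ r, ∃ A : ℝ → W →L[ℝ] W, A 0 = ContinuousLinearMap.id ℝ W ∧
        (∀ t ∈ Icc 0 η, HasFDerivAt (fun z => Φ z t) (A t) z) ∧
        ∀ t ∈ Icc 0 η, HasDerivWithinAt A ((fderiv ℝ X (Φ z t)).comp (A t)) (Icc 0 η) t := by
  have : CompleteSpace W := FiniteDimensional.complete ℝ W
  -- a ball on which `X` is controlled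
  have hev := (hX.eventually (by simp)).and (hO : ∀ᶠ z in 𝓝 z₀, z ∈ O)
  have hXc0 : ContinuousAt (fderiv ℝ X) z₀ :=
    (hX.fderiv_right (m := 0) (by simp)).continuousAt
  have hev2 : ∀ᶠ z in 𝓝 z₀, ‖fderiv ℝ X z‖ < ‖fderiv ℝ X z₀‖ + 1 :=
    hXc0.norm.eventually_lt_const (by simp)
  obtain ⟨R, hR, hRs⟩ := Metric.nhds_basis_closedBall.eventually_iff.1 (hev.and hev2)
  set K := ‖fderiv ℝ X z₀‖ + 1 with hK
  have hXd : ∀ z ∈ closedBall z₀ R, HasFDerivAt X (fderiv ℝ X z) z := fun z hz =>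
    ((hRs hz).1.1.differentiableAt one_ne_zero).hasFDerivAt
  have hXc : ContinuousOn (fderiv ℝ X) (closedBall z₀ R) := fun z hz =>
    ((hRs hz).1.1.fderiv_right (m := 0) (by simp)).continuousAt.continuousWithinAt
  obtain ⟨ε, hε, a, r, L, K₀, hr, hPL⟩ := IsPicardLindelof.of_contDiffAt_one hX
  obtain ⟨Φ, hΦ, L', hL'⟩ :=
    (hPL 0).exists_forall_mem_closedBall_eq_hasDerivWithinAt_lipschitzOnWith
  simp only [zero_sub, zero_add] at hΦ hL'
  have hcont : ContinuousOn (fun p : W × ℝ => Φ p.1 p.2) (closedBall z₀ r ×ˢ Icc (-ε) ε) := by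
    refine continuousOn_prod_of_continuousOn_lipschitzOnWith _ L' (fun z hz => ?_) hL'
    exact fun t ht => ((hΦ z hz).2 t ht).continuousWithinAt
  have hr' : (0 : ℝ) < r := hr
  have hcont0 : ContinuousAt (fun p : W × ℝ => Φ p.1 p.2) (z₀, 0) :=
    hcont.continuousAt (prod_mem_nhds (closedBall_mem_nhds _ hr') (Icc_mem_nhds (by linarith) hε))
  have hΦz₀ : Φ z₀ 0 = z₀ := (hΦ z₀ (mem_closedBall_self hr'.le)).1
  have hnear : ∀ᶠ p in 𝓝 (z₀, (0 : ℝ)), Φ p.1 p.2 ∈ closedBall z₀ R :=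
    hcont0.eventually_mem (by simpa [hΦz₀] using closedBall_mem_nhds z₀ hR)
  rw [nhds_prod_eq] at hnear
  obtain ⟨p₁, hp₁, p₂, hp₂, hp⟩ := Filter.eventually_prod_iff.1 hnear
  obtain ⟨r₁, hr₁, hr₁'⟩ := Metric.eventually_nhds_iff_ball.1 hp₁
  obtain ⟨η₁, hη₁, hη₁'⟩ := Metric.eventually_nhds_iff_ball.1 hp₂
  -- The three bounds keep the flow in the controlled ball, keep the times interior to the
  -- Picard–Lindelöf interval (so derivatives are two-sided), and make `exists_linearODE`
  -- applicable.
  set η := min (min (η₁ / 2) (ε / 2)) (1 / (2 * K)) with hη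
  have hK0 : 0 < K := by positivity
  have hη0 : 0 < η := by positivity
  have hηη₁ : η < η₁ := ((min_le_left _ _).trans (min_le_left _ _)).trans_lt (by linarith)
  have hηε : η < ε := ((min_le_left _ _).trans (min_le_right _ _)).trans_lt (by linarith)
  have hηK : 2 * K * η ≤ 1 := by
    calc 2 * K * η ≤ 2 * K * (1 / (2 * K)) := by gcongr; exact min_le_right _ _
      _ = 1 := by field_simp
  set r' := min r₁ r with hrr
  have hr'0 : 0 < r' := lt_min hr₁ hr'
  have hb1 : ball z₀ r' ⊆ ball z₀ r₁ := ball_subset_ball (min_le_left _ _)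
  have hb2 : ball z₀ r' ⊆ closedBall z₀ r :=
    (ball_subset_ball (min_le_right _ _)).trans ball_subset_closedBall
  have hmem : ∀ z ∈ ball z₀ r', ∀ t ∈ Icc (-η) η, HasDerivAt (Φ z) (X (Φ z t)) t ∧
      Φ z t ∈ closedBall z₀ R := fun z hz t ht =>
    ⟨((hΦ z (hb2 hz)).2 t ⟨by linarith [ht.1], by linarith [ht.2]⟩).hasDerivAt
      (Icc_mem_nhds (by linarith [ht.1]) (by linarith [ht.2])),
     hp (hr₁' z (hb1 hz)) (hη₁' t (by
      rw [mem_ball, Real.dist_eq, sub_zero, abs_lt]; constructor <;> linarith [ht.1, ht.2]))⟩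
  have hpos : Icc 0 η ⊆ Icc (-η) η := Icc_subset_Icc_left (by linarith)
  refine ⟨η, hη0, r', hr'0, Φ, fun z hz => (hΦ z (hb2 hz)).1, fun z hz t ht =>
    ⟨(hmem z hz t ht).1, (hRs (hmem z hz t ht).2).1.2, (hRs (hmem z hz t ht).2).1.1⟩,
    hcont.mono (prod_mono hb2 (Icc_subset_Icc (by linarith) hηε.le)), fun z hz => ?_⟩
  obtain ⟨A, hA0, hA⟩ := exists_linearODE (B := fun t => fderiv ℝ X (Φ z t)) hη0
    (hXc.comp (fun t ht => (hmem z hz t (hpos ht)).1.continuousAt.continuousWithinAt)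
      fun t ht => (hmem z hz t (hpos ht)).2)
    (fun t ht => (hRs (hmem z hz t (hpos ht)).2).2.le) hηK
  refine ⟨A, hA0, fun t ht => ?_, hA⟩
  refine hasFDerivAt_flow (L := L') (K := K) hXd hXc (fun z hz => (hRs hz).2.le)
    (fun z hz => (hΦ z (hb2 hz)).1) (fun z hz t ht => hmem z hz t (hpos ht)) ?_ hz hA0 hA ht
  intro t ht z hz z' hz'
  have := (hL' t ⟨by linarith [ht.1], by linarith [ht.2]⟩).dist_le_mul z (hb2 hz) z' (hb2 hz')
  simpa [dist_eq_norm] using this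

/-- Differentiability of the solution `τ s` of `h (s, τ s) = 0` at a point. -/
theorem hasDerivAt_of_zero {h : ℝ × ℝ → ℝ} {b s₀ α β : ℝ} {h' : ℝ × ℝ →L[ℝ] ℝ}
    (hh : HasFDerivAt h h' (s₀, b)) (hα : h' (1, 0) = α) (hβ : h' (0, 1) = β) (hβ0 : β ≠ 0)
    {τ : ℝ → ℝ} (hτ₀ : τ s₀ = b) (hτ : ContinuousAt τ s₀) (h0 : ∀ᶠ s in 𝓝 s₀, h (s, τ s) = 0) :
    HasDerivAt τ (-α / β) s₀ := by
  have hh0 : h (s₀, b) = 0 := by simpa [hτ₀] using h0.self_of_nhds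
  have hlin : ∀ x y : ℝ, h' (x, y) = x * α + y * β := fun x y => by
    have : ((x, y) : ℝ × ℝ) = x • (1, 0) + y • (0, 1) := by simp
    rw [this, map_add, map_smul, map_smul, hα, hβ]; simp
  have hpair : Tendsto (fun s => (s, τ s)) (𝓝 s₀) (𝓝 (s₀, b)) := by
    have := continuousAt_id.prodMk hτ
    simpa [ContinuousAt, hτ₀] using! this
  have hlo := (hasFDerivAt_iff_isLittleO.1 hh).comp_tendsto hpair
  -- `h` is differentiable at a single point only, which rules out the implicit function theorem.
  -- Its linearization along the zero curve `(s, τ s)` must be of lower order than the increments.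
  have key : ∀ c > 0, ∀ᶠ s in 𝓝 s₀,
      |(s - s₀) * α + (τ s - b) * β| ≤ c * (|s - s₀| + |τ s - b|) := by
    intro c hc
    filter_upwards [(Asymptotics.isLittleO_iff.1 hlo) hc, h0] with s hs hs0
    simp only [Function.comp, hs0, hh0, Prod.mk_sub_mk, hlin, sub_zero, zero_sub, norm_neg] at hs
    refine hs.trans ?_
    gcongr
    rw [Prod.norm_def]
    exact max_le (by simp) (by simp)
  have hβ' : 0 < |β| := abs_pos.2 hβ0
  -- first `τ` is Lipschitz at `s₀`
  set C := (|α| + |β|) / |β| * 2 with hC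
  have hLip : ∀ᶠ s in 𝓝 s₀, |τ s - b| ≤ C * |s - s₀| := by
    filter_upwards [key (|β| / 2) (by positivity)] with s hs
    have h1 : |(τ s - b) * β| ≤ |(s - s₀) * α + (τ s - b) * β| + |(s - s₀) * α| := by
      have := abs_sub ((s - s₀) * α + (τ s - b) * β) ((s - s₀) * α)
      simpa using this
    rw [abs_mul, abs_mul] at h1
    have h2 : |τ s - b| * (|β| / 2) ≤ (|α| + |β|) * |s - s₀| := by
      nlinarith [abs_nonneg (s - s₀), abs_nonneg (τ s - b)]
    rw [hC]
    have : |τ s - b| * (|β| / 2) / (|β| / 2) ≤ (|α| + |β|) * |s - s₀| / (|β| / 2) := by gcongr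
    calc |τ s - b| = |τ s - b| * (|β| / 2) / (|β| / 2) := by field_simp
      _ ≤ _ := this
      _ = _ := by field_simp
  rw [hasDerivAt_iff_isLittleO, Asymptotics.isLittleO_iff]
  intro c hc
  have hC0 : 0 ≤ C := by positivity
  -- The Lipschitz bound replaces `|τ s - b|` by `C * |s - s₀|` in the error; the constant is set so
  -- that dividing by `β` leaves exactly `c`.
  filter_upwards [hLip, key (c * |β| / (1 + C)) (by positivity)] with s h1 h2
  have h3 : |(s - s₀) * α + (τ s - b) * β| ≤ c * |β| * |s - s₀| := by
    calc _ ≤ c * |β| / (1 + C) * (|s - s₀| + C * |s - s₀|) := by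
          refine h2.trans ?_; gcongr
      _ = _ := by field_simp
  rw [Real.norm_eq_abs, Real.norm_eq_abs, hτ₀, smul_eq_mul]
  have h4 : τ s - b - (s - s₀) * (-α / β) = ((s - s₀) * α + (τ s - b) * β) / β := by
    field_simp; ring
  rw [h4, abs_div, div_le_iff₀ hβ']
  linarith

end Flow

/-! ### The metric, velocities and the boundary in charts. -/

section Charts

open Set Filter

variable {n : ℕ} [NeZero n] {M : Type*} [TopologicalSpace M]
  [ChartedSpace (EuclideanHalfSpace n) M] [IsManifold (𝓡∂ n) ∞ M]

/-! ### Coordinates of points and tangent vectors -/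

/-- The zeroth coordinate as a continuous linear form. -/
def coord₀ (n : ℕ) [NeZero n] : V n →L[ℝ] ℝ := EuclideanSpace.proj 0

@[simp] theorem coord₀_apply (y : V n) : coord₀ n y = y 0 := rfl

/-- The components in the chart at `x₀` of tangent vectors at `p`. -/
def hat (x₀ p : M) : TangentSpace (𝓡∂ n) p →L[ℝ] V n := tangentCoordChange (𝓡∂ n) p x₀ p

/-- The tangent vector at `p` with given components in the chart at `x₀`. -/
def unhat (x₀ p : M) : V n →L[ℝ] TangentSpace (𝓡∂ n) p := tangentCoordChange (𝓡∂ n) x₀ p p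

theorem hat_unhat {x₀ p : M} (hp : p ∈ (extChartAt (𝓡∂ n) x₀).source) (v : V n) :
    hat x₀ p (unhat x₀ p v) = v := by
  rw [hat, unhat]
  exact (tangentCoordChange_comp ⟨⟨hp, mem_extChartAt_source p⟩, hp⟩).trans
    (tangentCoordChange_self hp)

theorem unhat_hat {x₀ p : M} (hp : p ∈ (extChartAt (𝓡∂ n) x₀).source)
    (v : TangentSpace (𝓡∂ n) p) : unhat x₀ p (hat x₀ p v) = v := by
  rw [hat, unhat]
  exact (tangentCoordChange_comp ⟨⟨mem_extChartAt_source p, hp⟩, mem_extChartAt_source p⟩).trans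
    (tangentCoordChange_self (mem_extChartAt_source p))

theorem hat_injective {x₀ p : M} (hp : p ∈ (extChartAt (𝓡∂ n) x₀).source) :
    Function.Injective (hat (n := n) x₀ p) :=
  Function.LeftInverse.injective (unhat_hat hp)

theorem inner_eq_coordMetric (g : Metric n M) {x₀ p : M}
    (hp : p ∈ (extChartAt (𝓡∂ n) x₀).source) (v w : TangentSpace (𝓡∂ n) p) :
    g.inner p v w = coordMetric g x₀ (extChartAt (𝓡∂ n) x₀ p) (hat x₀ p v) (hat x₀ p w) := by
  have h1 : (extChartAt (𝓡∂ n) x₀).symm (extChartAt (𝓡∂ n) x₀ p) = p :=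
    (extChartAt (𝓡∂ n) x₀).left_inv hp
  -- The base point is generalized so that the round trip through the chart can be substituted;
  -- rewriting it in place would change the type of the tangent vectors.
  have h2 : ∀ q : M, ∀ y, (extChartAt (𝓡∂ n) x₀).symm y = q →
      ∀ v w, coordMetric g x₀ y v w = g.inner q (unhat x₀ q v) (unhat x₀ q w) := by
    rintro q y rfl v w; rfl
  rw [h2 p _ h1, unhat_hat hp, unhat_hat hp]

theorem coordMetric_eq_inner (g : Metric n M) {x₀ : M} {y : V n}
    (v w : V n) :
    coordMetric g x₀ y v w = g.inner ((extChartAt (𝓡∂ n) x₀).symm y)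
      (unhat x₀ ((extChartAt (𝓡∂ n) x₀).symm y) v)
      (unhat x₀ ((extChartAt (𝓡∂ n) x₀).symm y) w) := rfl

theorem coordMetric_symm (g : Metric n M) (x₀ : M) (y v w : V n) :
    coordMetric g x₀ y v w = coordMetric g x₀ y w v := by
  rw [coordMetric_eq_inner, coordMetric_eq_inner]; exact g.symm _ _ _

theorem coordMetric_pos (g : Metric n M) {x₀ : M} {y : V n}
    (hy : y ∈ (extChartAt (𝓡∂ n) x₀).target) {v : V n} (hv : v ≠ 0) :
    0 < coordMetric g x₀ y v v := by
  rw [coordMetric_eq_inner]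
  refine g.pos _ _ fun h => hv ?_
  have := hat_unhat ((extChartAt (𝓡∂ n) x₀).map_target hy) v
  rw [h, map_zero] at this
  exact this.symm

/-- The open set whose trace on the half-space is the target of the chart at `x₀`. -/
def chartOpen (x₀ : M) : Set (V n) :=
  (𝓡∂ n).symm ⁻¹' (chartAt (EuclideanHalfSpace n) x₀).target

theorem isOpen_chartOpen (x₀ : M) : IsOpen (chartOpen (n := n) x₀) :=
  (chartAt (EuclideanHalfSpace n) x₀).open_target.preimage (𝓡∂ n).continuous_symm

theorem chart_target (x₀ : M) :
    (extChartAt (𝓡∂ n) x₀).target = chartOpen x₀ ∩ {y | 0 ≤ coord₀ n y} := by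
  rw [extChartAt_target, range_modelWithCornersEuclideanHalfSpace]; rfl

theorem mem_chart_target {x₀ : M} {y : V n} :
    y ∈ (extChartAt (𝓡∂ n) x₀).target ↔ y ∈ chartOpen x₀ ∧ 0 ≤ y 0 := by
  rw [chart_target]; rfl

theorem coord₀_pos : 0 < coord₀ n (EuclideanSpace.single (0 : Fin n) (1 : ℝ)) := by
  simp

theorem uniqueDiffOn_target (x₀ : M) : UniqueDiffOn ℝ (extChartAt (𝓡∂ n) x₀).target :=
  uniqueDiffOn_extChartAt_target x₀

theorem target_mem_nhds {x₀ : M} {y : V n} (hy : y ∈ (extChartAt (𝓡∂ n) x₀).target)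
    (h0 : 0 < y 0) : (extChartAt (𝓡∂ n) x₀).target ∈ 𝓝 y := by
  rw [chart_target] at hy ⊢
  refine inter_mem ((isOpen_chartOpen x₀).mem_nhds hy.1) ?_
  exact mem_of_superset ((isOpen_lt continuous_const (coord₀ n).continuous).mem_nhds h0)
    fun z hz => show 0 ≤ coord₀ n z from le_of_lt hz

/-- Being an interior point does not depend on the chart, so it can be tested in any chart around
`p`, not only in the preferred one. -/
theorem mem_interior_iff_coord {x₀ p : M} (hp : p ∈ (extChartAt (𝓡∂ n) x₀).source) :
    p ∈ (𝓡∂ n).interior M ↔ 0 < (extChartAt (𝓡∂ n) x₀ p) 0 := by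
  rw [extChartAt_source] at hp
  have h := (𝓡∂ n).isInteriorPoint_iff_of_mem_atlas (n := ∞) (by simp)
    (chart_mem_atlas (EuclideanHalfSpace n) x₀) hp
  refine h.trans ?_
  have hpt : extChartAt (𝓡∂ n) x₀ p ∈ (extChartAt (𝓡∂ n) x₀).target :=
    (extChartAt (𝓡∂ n) x₀).map_source (by rwa [extChartAt_source])
  constructor
  · intro h1
    have h2 := interior_mono (extChartAt_target_subset_range (I := 𝓡∂ n) x₀) h1
    rw [interior_range_modelWithCornersEuclideanHalfSpace] at h2
    exact h2
  · intro h1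
    exact mem_interior_iff_mem_nhds.2 (target_mem_nhds hpt h1)

theorem chart_coord_nonneg {x₀ p : M} (hp : p ∈ (extChartAt (𝓡∂ n) x₀).source) :
    0 ≤ (extChartAt (𝓡∂ n) x₀ p) 0 :=
  (mem_chart_target.1 ((extChartAt (𝓡∂ n) x₀).map_source hp)).2

theorem mem_boundary_iff_coord {x₀ p : M} (hp : p ∈ (extChartAt (𝓡∂ n) x₀).source) :
    p ∈ (𝓡∂ n).boundary M ↔ (extChartAt (𝓡∂ n) x₀ p) 0 = 0 := by
  rw [← (𝓡∂ n).compl_interior, mem_compl_iff, mem_interior_iff_coord hp, not_lt]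
  exact ⟨fun h => le_antisymm h (chart_coord_nonneg hp), fun h => h.le⟩

/-! ### Smoothness of the metric in coordinates -/

theorem contMDiffOn_unhat (x₀ : M) (v : V n) :
    ContMDiffOn 𝓘(ℝ, V n) (𝓡∂ n).tangent ∞
      (fun y => (⟨(extChartAt (𝓡∂ n) x₀).symm y,
        unhat x₀ ((extChartAt (𝓡∂ n) x₀).symm y) v⟩ : TangentBundle (𝓡∂ n) M))
      (extChartAt (𝓡∂ n) x₀).target := by
  intro y hy
  have hsrc := (extChartAt (𝓡∂ n) x₀).map_target hy
  rw [(trivializationAt (V n) (TangentSpace (𝓡∂ n)) x₀).contMDiffWithinAt_iff]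
  · refine ⟨contMDiffOn_extChartAt_symm x₀ y hy, ?_⟩
    refine (contMDiffWithinAt_const (c := v)).congr (fun z hz => ?_) ?_
    · exact hat_unhat ((extChartAt (𝓡∂ n) x₀).map_target hz) v
    · exact hat_unhat hsrc v
  · rw [TangentBundle.trivializationAt_source]
    rw [extChartAt_source] at hsrc
    exact hsrc

/-- In finite dimension smoothness may be tested on fixed vectors `v`, `w`; these are coordinate
vector fields, smooth sections by `contMDiffOn_unhat`, on which the metric is smooth. -/
theorem contDiffOn_coordMetric (g : Metric n M) (x₀ : M) :
    ContDiffOn ℝ ∞ (coordMetric g x₀) (extChartAt (𝓡∂ n) x₀).target := by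
  refine contDiffOn_clm_apply.2 fun v => contDiffOn_clm_apply.2 fun w => ?_
  rw [← contMDiffOn_iff_contDiffOn]
  intro y hy
  have : ContMDiffWithinAt 𝓘(ℝ, V n) ((𝓡∂ n).prod 𝓘(ℝ)) ∞
      (fun m ↦ Bundle.TotalSpace.mk' ℝ (E := Bundle.Trivial M ℝ) ((extChartAt (𝓡∂ n) x₀).symm m)
        (g.inner ((extChartAt (𝓡∂ n) x₀).symm m)
          (unhat x₀ ((extChartAt (𝓡∂ n) x₀).symm m) v)
          (unhat x₀ ((extChartAt (𝓡∂ n) x₀).symm m) w))) (extChartAt (𝓡∂ n) x₀).target y := by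
    apply ContMDiffWithinAt.clm_bundle_apply₂ (F₁ := V n) (F₂ := V n)
    · exact ContMDiffAt.comp_contMDiffWithinAt y g.contMDiff.contMDiffAt
        (contMDiffOn_extChartAt_symm x₀ y hy)
    · exact contMDiffOn_unhat x₀ v y hy
    · exact contMDiffOn_unhat x₀ w y hy
  simp only [Bundle.contMDiffWithinAt_totalSpace] at this
  exact this.2

/-! ### Velocities in coordinates -/

/-- The manifold derivative is expressed in the preferred chart at `γ t`. The chain rule with the
transition map turns it into the derivative in a fixed chart, which is what differential equations
along the curve require. -/
theorem hasDerivWithinAt_hat {γ : ℝ → M} {S : Set ℝ} {t : ℝ} {x₀ : M}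
    (hγ : MDifferentiableWithinAt 𝓘(ℝ, ℝ) (𝓡∂ n) γ S t)
    (h : γ t ∈ (extChartAt (𝓡∂ n) x₀).source) :
    HasDerivWithinAt (fun r => extChartAt (𝓡∂ n) x₀ (γ r))
      (hat x₀ (γ t) (mfderivWithin 𝓘(ℝ, ℝ) (𝓡∂ n) γ S t (1 : ℝ))) S t := by
  let L : ℝ →L[ℝ] V n := mfderivWithin 𝓘(ℝ, ℝ) (𝓡∂ n) γ S t
  let c : ℝ → V n := fun r => extChartAt (𝓡∂ n) (γ t) (γ r)
  have h1 : HasFDerivWithinAt c L S t := by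
    have := hγ.hasMFDerivWithinAt.2
    simpa only [mfld_simps, writtenInExtChartAt, Function.comp_def] using! this
  have h2 := hasFDerivWithinAt_tangentCoordChange (I := 𝓡∂ n) (x := γ t) (y := x₀) (z := γ t)
    ⟨mem_extChartAt_source _, h⟩
  let T : V n →L[ℝ] V n := tangentCoordChange (𝓡∂ n) (γ t) x₀ (γ t)
  have h2' : HasFDerivWithinAt (extChartAt (𝓡∂ n) x₀ ∘ (extChartAt (𝓡∂ n) (γ t)).symm) T
    (range (𝓡∂ n)) (c t) := h2
  have h3 : HasDerivWithinAt (fun r => extChartAt (𝓡∂ n) x₀ ((extChartAt (𝓡∂ n) (γ t)).symm (c r)))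
      (T (L 1)) S t :=
    h2'.comp_hasDerivWithinAt t h1.hasDerivWithinAt (fun r _ => by simp [c])
  refine h3.congr_of_eventuallyEq ?_ ?_
  · have := hγ.continuousWithinAt.preimage_mem_nhdsWithin
      ((isOpen_extChartAt_source (I := 𝓡∂ n) (γ t)).mem_nhds (mem_extChartAt_source (γ t)))
    filter_upwards [this] with r hr
    exact congrArg (extChartAt (𝓡∂ n) x₀) ((extChartAt (𝓡∂ n) (γ t)).left_inv hr).symm
  · exact congrArg (extChartAt (𝓡∂ n) x₀)
      ((extChartAt (𝓡∂ n) (γ t)).left_inv (mem_extChartAt_source (γ t))).symm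

theorem hat_mfderivWithin {γ : ℝ → M} {S : Set ℝ} {t : ℝ} {x₀ : M} {u : V n}
    (hγ : ContinuousWithinAt γ S t) (h : γ t ∈ (extChartAt (𝓡∂ n) x₀).source)
    (hu : HasDerivWithinAt (fun r => extChartAt (𝓡∂ n) x₀ (γ r)) u S t)
    (hS : UniqueDiffWithinAt ℝ S t) :
    MDifferentiableWithinAt 𝓘(ℝ, ℝ) (𝓡∂ n) γ S t ∧
      hat x₀ (γ t) (mfderivWithin 𝓘(ℝ, ℝ) (𝓡∂ n) γ S t (1 : ℝ)) = u := by
  have h1 : MDifferentiableWithinAt 𝓘(ℝ, ℝ) (𝓡∂ n) γ S t := by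
    rw [mdifferentiableWithinAt_iff_target_of_mem_source (y := x₀)
      (by rwa [extChartAt_source] at h)]
    exact ⟨hγ, hu.differentiableWithinAt.mdifferentiableWithinAt⟩
  exact ⟨h1, hS.eq_deriv _ (hasDerivWithinAt_hat h1 h) hu⟩

/-! ### Tangent vectors at the boundary -/

/-- A transition map sends the half-space into itself and fixes its boundary as a set, so its
derivative `T` preserves inward vectors. Applied to `v` and `-v` this shows that `T` preserves
tangential vectors, so the zeroth coordinate is only multiplied by `(T e) 0 ≥ 0`. This factor is not
zero because `e` is in the range of `T`. -/
theorem hat_coord₀ {x₀ p : M} (hp : p ∈ (extChartAt (𝓡∂ n) x₀).source)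
    (hb : p ∈ (𝓡∂ n).boundary M) :
    ∃ c : ℝ, 0 < c ∧ ∀ v : TangentSpace (𝓡∂ n) p, (hat x₀ p v) 0 = c * normalCoord v := by
  set y := extChartAt (𝓡∂ n) p p with hy
  have hpp := mem_extChartAt_source (I := 𝓡∂ n) p
  have hy0 : y 0 = 0 := (mem_boundary_iff_coord hpp).1 hb
  have hyt : y ∈ (extChartAt (𝓡∂ n) p).target := mem_extChartAt_target p
  set ψ : V n → V n := extChartAt (𝓡∂ n) x₀ ∘ (extChartAt (𝓡∂ n) p).symm with hψ
  have hD := hasFDerivWithinAt_tangentCoordChange (I := 𝓡∂ n) (x := p) (y := x₀) (z := p) ⟨hpp, hp⟩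
  have hψy : ψ y = extChartAt (𝓡∂ n) x₀ p := by
    simp only [hψ, Function.comp, hy, (extChartAt (𝓡∂ n) p).left_inv hpp]
  have hψ0 : ψ y 0 = 0 := by rw [hψy]; exact (mem_boundary_iff_coord hp).1 hb
  have hsymm : (extChartAt (𝓡∂ n) p).symm y = p := (extChartAt (𝓡∂ n) p).left_inv hpp
  set T : V n →L[ℝ] V n := tangentCoordChange (𝓡∂ n) p x₀ p with hT
  have hD' : HasFDerivWithinAt ψ T (range (𝓡∂ n)) y := hD
  -- the derivative maps inward vectors to inward vectors
  have hinw : ∀ v : V n, 0 ≤ v 0 → 0 ≤ (T v) 0 := by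
    intro v hv
    -- The half-line stays in the half-space, so the height of its image is nonnegative and zero at
    -- `s = 0`; the right derivative is a limit of nonnegative slopes.
    have hl : HasDerivWithinAt (fun s : ℝ => ψ (y + s • v)) (T v) (Ici 0) 0 := by
      have h1 : HasDerivWithinAt (fun s : ℝ => y + s • v) v (Ici 0) 0 := by
        simpa using (((hasDerivAt_id (0 : ℝ)).smul_const v).const_add y).hasDerivWithinAt
      have h2 : HasFDerivWithinAt ψ T (range (𝓡∂ n)) ((fun s : ℝ => y + s • v) 0) := by
        simpa only [zero_smul, add_zero] using hD'
      exact h2.comp_hasDerivWithinAt 0 h1 (fun s hs => by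
        rw [range_modelWithCornersEuclideanHalfSpace]
        have : 0 ≤ s := hs
        simp only [mem_ofPred_eq, PiLp.add_apply, PiLp.smul_apply, smul_eq_mul, hy0]
        positivity)
    have hl0 : HasDerivWithinAt (fun s : ℝ => ψ (y + s • v) 0) ((T v) 0) (Ici 0) 0 :=
      ((coord₀ n).hasFDerivAt.comp_hasDerivWithinAt (0 : ℝ) hl)
    have ht := hasDerivWithinAt_iff_tendsto_slope.1 hl0
    have hne : (𝓝[Ici 0 \ {0}] (0 : ℝ)).NeBot := by
      rw [Ici_sdiff_left]; infer_instance
    refine ge_of_tendsto ht ?_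
    have hnn : ∀ᶠ s in 𝓝[Ici 0 \ {0}] (0 : ℝ), y + s • v ∈ chartOpen p := by
      have : ContinuousAt (fun s : ℝ => y + s • v) 0 := by fun_prop
      exact nhdsWithin_le_nhds (this.eventually_mem ((isOpen_chartOpen p).mem_nhds (by
        simpa using (mem_chart_target.1 hyt).1)))
    have hnn2 : ∀ᶠ s in 𝓝[Ici 0 \ {0}] (0 : ℝ),
        (extChartAt (𝓡∂ n) p).symm (y + s • v) ∈ (extChartAt (𝓡∂ n) x₀).source := by
      have hc : ContinuousWithinAt (fun s : ℝ => (extChartAt (𝓡∂ n) p).symm (y + s • v))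
          (Ici 0 \ {0}) 0 := by
        have h3 : ContinuousAt (fun s : ℝ => y + s • v) 0 := by fun_prop
        have h4 : ContinuousAt (extChartAt (𝓡∂ n) p).symm ((fun s : ℝ => y + s • v) 0) := by
          simpa only [zero_smul, add_zero] using continuousAt_extChartAt_symm p
        exact (ContinuousAt.comp (f := fun s : ℝ => y + s • v) h4 h3).continuousWithinAt
      refine hc.eventually_mem ((isOpen_extChartAt_source x₀).mem_nhds ?_)
      simpa only [zero_smul, add_zero, hsymm] using hp
    filter_upwards [hnn2, self_mem_nhdsWithin] with s h1 h2
    have hs : 0 < s := lt_of_le_of_ne h2.1 (Ne.symm h2.2)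
    rw [slope_def_field]
    simp only [zero_smul, add_zero, hψ0, sub_zero]
    exact div_nonneg (chart_coord_nonneg h1) hs.le
  have hinw0 : ∀ v : V n, v 0 = 0 → (T v) 0 = 0 := by
    intro v hv
    refine le_antisymm ?_ (hinw v hv.ge)
    have := hinw (-v) (by simp [hv])
    rw [map_neg] at this
    simpa using this
  set e : V n := EuclideanSpace.single (0 : Fin n) (1 : ℝ) with he
  have he0 : e 0 = 1 := by simp [he]
  have hform : ∀ v : V n, (T v) 0 = (T e) 0 * v 0 := by
    intro v
    have h1 := hinw0 (v - v 0 • e) (by simp [he0])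
    rw [map_sub, map_smul] at h1
    simp only [PiLp.sub_apply, PiLp.smul_apply, smul_eq_mul] at h1
    linarith
  refine ⟨(T e) 0, lt_of_le_of_ne (hinw e (by simp [he0])) fun h0 => ?_, hform⟩
  have h1 := hform (unhat x₀ p e)
  have h2 : T (unhat x₀ p e) = e := hat_unhat hp e
  rw [← h0, zero_mul, h2, he0] at h1
  exact one_ne_zero h1

end Charts

/-! ### The geodesic equation as a differential equation, independent of the chart. -/

section GeodesicEquation

open Set Filter

variable {n : ℕ} [NeZero n] {M : Type*} [TopologicalSpace M]
  [ChartedSpace (EuclideanHalfSpace n) M] [IsManifold (𝓡∂ n) ∞ M]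

/-! ### Derivatives of bilinear expressions -/

theorem hasFDerivWithinAt_bilin {E : Type*} [NormedAddCommGroup E] [NormedSpace ℝ E]
    {B : E → V n →L[ℝ] V n →L[ℝ] ℝ} {u v : E → V n} {B' : E →L[ℝ] V n →L[ℝ] V n →L[ℝ] ℝ}
    {u' v' : E →L[ℝ] V n} {s : Set E} {x : E} (hB : HasFDerivWithinAt B B' s x)
    (hu : HasFDerivWithinAt u u' s x) (hv : HasFDerivWithinAt v v' s x) :
    ∃ L : E →L[ℝ] ℝ, HasFDerivWithinAt (fun z => B z (u z) (v z)) L s x ∧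
      ∀ e, L e = B' e (u x) (v x) + B x (u' e) (v x) + B x (u x) (v' e) := by
  have h1 := hB.clm_apply hu
  refine ⟨_, h1.clm_apply hv, fun e => ?_⟩
  simp
  ring

theorem hasDerivWithinAt_bilin {B : ℝ → V n →L[ℝ] V n →L[ℝ] ℝ} {u v : ℝ → V n}
    {B' : V n →L[ℝ] V n →L[ℝ] ℝ} {u' v' : V n} {s : Set ℝ} {x : ℝ}
    (hB : HasDerivWithinAt B B' s x) (hu : HasDerivWithinAt u u' s x)
    (hv : HasDerivWithinAt v v' s x) :
    HasDerivWithinAt (fun z => B z (u z) (v z))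
      (B' (u x) (v x) + B x u' (v x) + B x (u x) v') s x := by
  have h1 := (hB.clm_apply hu).clm_apply hv
  exact h1.congr_deriv (by simp)

/-! ### The geodesic equation as a differential equation -/

/-- The quadratic Christoffel form `w ↦ Γ(v, v, w)` in terms of the derivative of the metric. -/
def chr (D : V n →L[ℝ] V n →L[ℝ] V n →L[ℝ] ℝ) (v : V n) : V n →L[ℝ] ℝ :=
  D v v - (1 / 2 : ℝ) • (D.flip v).flip v

theorem chr_apply (D : V n →L[ℝ] V n →L[ℝ] V n →L[ℝ] ℝ) (v w : V n) :
    chr D v w = D v v w - 1 / 2 * D w v v := rfl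

/-- The acceleration of geodesics in terms of the metric and its derivative. -/
def acc (G : V n →L[ℝ] V n →L[ℝ] ℝ) (D : V n →L[ℝ] V n →L[ℝ] V n →L[ℝ] ℝ) (v : V n) : V n :=
  -(G.inverse (chr D v))

theorem exists_equiv_of_pos {G : V n →L[ℝ] V n →L[ℝ] ℝ} (hG : ∀ v, v ≠ 0 → 0 < G v v) :
    ∃ e : V n ≃L[ℝ] (V n →L[ℝ] ℝ), (e : V n →L[ℝ] V n →L[ℝ] ℝ) = G := by
  have hinj : Function.Injective G := by
    refine (injective_iff_map_eq_zero G).2 fun v hv => ?_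
    by_contra h
    have := hG v h
    rw [hv] at this
    simp at this
  have hdim : Module.finrank ℝ (V n) = Module.finrank ℝ (V n →L[ℝ] ℝ) := by
    rw [← (LinearMap.toContinuousLinearMap : (V n →ₗ[ℝ] ℝ) ≃ₗ[ℝ] (V n →L[ℝ] ℝ)).finrank_eq,
      Module.finrank_linearMap, Module.finrank_self, mul_one]
  let e := LinearEquiv.ofInjectiveOfFinrankEq (G : V n →ₗ[ℝ] (V n →L[ℝ] ℝ)) hinj hdim
  refine ⟨e.toContinuousLinearEquiv, ?_⟩
  ext v w
  rfl

theorem apply_inverse_of_pos {G : V n →L[ℝ] V n →L[ℝ] ℝ} (hG : ∀ v, v ≠ 0 → 0 < G v v)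
    (α : V n →L[ℝ] ℝ) : G (G.inverse α) = α := by
  obtain ⟨e, rfl⟩ := exists_equiv_of_pos hG
  simp

theorem inverse_apply_of_pos {G : V n →L[ℝ] V n →L[ℝ] ℝ} (hG : ∀ v, v ≠ 0 → 0 < G v v)
    (v : V n) : G.inverse (G v) = v := by
  obtain ⟨e, rfl⟩ := exists_equiv_of_pos hG
  simp

/-- A positive definite form is invertible as a map to the dual space, so the weak form of the
equation, tested against all `w`, can be solved for the acceleration. -/
theorem eq_acc_iff {G : V n →L[ℝ] V n →L[ℝ] ℝ} (hG : ∀ v, v ≠ 0 → 0 < G v v)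
    {D : V n →L[ℝ] V n →L[ℝ] V n →L[ℝ] ℝ} {v a : V n} :
    a = acc G D v ↔ ∀ w, G a w + chr D v w = 0 := by
  constructor
  · rintro rfl w
    rw [acc, map_neg, apply_inverse_of_pos hG]
    simp
  · intro h
    have h1 : G (-a) = chr D v := by
      ext w; rw [map_neg]
      have := h w
      simp only [neg_apply]; linarith
    rw [acc, ← h1, inverse_apply_of_pos hG, neg_neg]

/-- The derivative of the metric in the chart at `x₀`. -/
def metricDer (g : Metric n M) (x₀ : M) (y : V n) : V n →L[ℝ] V n →L[ℝ] V n →L[ℝ] ℝ :=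
  fderivWithin ℝ (coordMetric g x₀) (extChartAt (𝓡∂ n) x₀).target y

theorem christoffel_eq_chr (g : Metric n M) (x₀ : M) (y v w : V n) :
    christoffel g x₀ y v v w = chr (metricDer g x₀ y) v w := by
  rw [chr_apply]
  simp only [christoffel]
  change (metricDer g x₀ y v v w + metricDer g x₀ y v v w - metricDer g x₀ y w v v) / 2 = _
  ring

/-- The acceleration of geodesics of `g` in the chart at `x₀`. -/
def geodesicAcc (g : Metric n M) (x₀ : M) (y v : V n) : V n :=
  acc (coordMetric g x₀ y) (metricDer g x₀ y) v

/-- Covariance of the geodesic equation. The second derivative of `ψ` enters through the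
acceleration of `ψ ∘ c` and through the derivative of the pulled-back metric; the contributions
cancel because `D²ψ` and `G₀` are symmetric. -/
theorem geodesic_transform {ψ : V n → V n} {y : V n} (hψ : ContDiffAt ℝ 2 ψ y)
    {G₀ G₁ : V n → V n →L[ℝ] V n →L[ℝ] ℝ} (hG₀ : DifferentiableAt ℝ G₀ (ψ y))
    (hG₁ : DifferentiableAt ℝ G₁ y)
    (hG : ∀ᶠ z in 𝓝 y, ∀ v w, G₁ z v w = G₀ (ψ z) (fderiv ℝ ψ z v) (fderiv ℝ ψ z w))
    (hs : ∀ v w, G₀ (ψ y) v w = G₀ (ψ y) w v) {c : ℝ → V n} {t : ℝ} (hc : ContDiffAt ℝ 2 c t)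
    (hct : c t = y) (w : V n) :
    G₀ (ψ y) (deriv (deriv (ψ ∘ c)) t) (fderiv ℝ ψ y w) +
        chr (fderiv ℝ G₀ (ψ y)) (deriv (ψ ∘ c) t) (fderiv ℝ ψ y w) =
      G₁ y (deriv (deriv c) t) w + chr (fderiv ℝ G₁ y) (deriv c t) w := by
  subst hct
  set U := fderiv ℝ ψ (c t) with hU
  set U2 := fderiv ℝ (fderiv ℝ ψ) (c t) with hU2
  have hψ1 : DifferentiableAt ℝ (fderiv ℝ ψ) (c t) :=
    (hψ.fderiv_right (m := 1) (by norm_num)).differentiableAt one_ne_zero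
  have hsym : ∀ a b, U2 a b = U2 b a := fun a b =>
    (hψ.isSymmSndFDerivAt (by simp)).eq a b
  have hdc : ∀ᶠ r in 𝓝 t, deriv (ψ ∘ c) r = fderiv ℝ ψ (c r) (deriv c r) := by
    have h1 : ∀ᶠ r in 𝓝 t, DifferentiableAt ℝ c r :=
      (hc.eventually (by simp)).mono fun r hr => hr.differentiableAt (by simp)
    have h2 : ∀ᶠ r in 𝓝 t, DifferentiableAt ℝ ψ (c r) :=
      hc.continuousAt.eventually ((hψ.eventually (by simp)).mono fun z hz =>
        hz.differentiableAt (by simp))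
    filter_upwards [h1, h2] with r hr1 hr2
    exact (hr2.hasFDerivAt.comp_hasDerivAt r hr1.hasDerivAt).deriv
  have hc1 : HasDerivAt c (deriv c t) t := (hc.differentiableAt (by simp)).hasDerivAt
  have hc2 : HasDerivAt (deriv c) (deriv (deriv c) t) t := by
    have : ContDiffAt ℝ 1 (deriv c) t :=
      (hc.fderiv_right (m := 1) (by norm_num)).clm_apply contDiffAt_const
    exact (this.differentiableAt one_ne_zero).hasDerivAt
  have hdd : deriv (deriv (ψ ∘ c)) t = U2 (deriv c t) (deriv c t) + U (deriv (deriv c) t) := by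
    rw [Filter.EventuallyEq.deriv_eq hdc]
    exact ((hψ1.hasFDerivAt.comp_hasDerivAt t hc1).clm_apply hc2).deriv
  have hD1 : ∀ u v w, fderiv ℝ G₁ (c t) u v w = fderiv ℝ G₀ (ψ (c t)) (U u) (U v) (U w) +
      G₀ (ψ (c t)) (U2 u v) (U w) + G₀ (ψ (c t)) (U v) (U2 u w) := by
    intro u v w
    have hψd : HasFDerivAt ψ U (c t) := (hψ.differentiableAt (by simp)).hasFDerivAt
    have hψc : ∀ a : V n, HasFDerivAt (fun z => fderiv ℝ ψ z a) (U2.flip a) (c t) := fun a =>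
      ((ContinuousLinearMap.apply ℝ (V n) a).hasFDerivAt.comp (c t) hψ1.hasFDerivAt)
    obtain ⟨L₁, h1, h1'⟩ := hasFDerivWithinAt_bilin (s := univ) hG₁.hasFDerivAt.hasFDerivWithinAt
      (hasFDerivWithinAt_const v (c t) _) (hasFDerivWithinAt_const w (c t) _)
    have hGψ : HasFDerivAt (fun z => G₀ (ψ z)) ((fderiv ℝ G₀ (ψ (c t))).comp U) (c t) :=
      HasFDerivAt.comp (E := V n) (F := V n) (G := V n →L[ℝ] V n →L[ℝ] ℝ) (c t) (g := G₀)
        (g' := fderiv ℝ G₀ (ψ (c t))) hG₀.hasFDerivAt hψd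
    obtain ⟨L₂, h2, h2'⟩ := hasFDerivWithinAt_bilin (s := univ) hGψ.hasFDerivWithinAt
      (hψc v).hasFDerivWithinAt (hψc w).hasFDerivWithinAt
    rw [hasFDerivWithinAt_univ] at h1 h2
    have h3 := h1.unique (h2.congr_of_eventuallyEq (hG.mono fun z hz => hz v w))
    have h4 := DFunLike.congr_fun h3 u
    rw [h1', h2'] at h4
    simpa using h4
  have hd1 : deriv (ψ ∘ c) t = U (deriv c t) := hdc.self_of_nhds
  rw [hdd, hd1, chr_apply, chr_apply, hD1, hD1, hG.self_of_nhds, map_add, add_apply,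
    hsym w (deriv c t), hs (U2 (deriv c t) w) (U (deriv c t))]
  ring

theorem two_le_infty : (2 : WithTop ℕ∞) ≤ ∞ := by
  exact WithTop.coe_le_coe.2 (le_top : (2 : ℕ∞) ≤ ⊤)

theorem hat_unhat_eq_fderiv {x₀ x₁ p : M} (hp₀ : p ∈ (extChartAt (𝓡∂ n) x₀).source)
    (hp₁ : p ∈ (extChartAt (𝓡∂ n) x₁).source) (hi : p ∈ (𝓡∂ n).interior M) (v : V n) :
    hat x₀ p (unhat x₁ p v) =
      fderiv ℝ (extChartAt (𝓡∂ n) x₀ ∘ (extChartAt (𝓡∂ n) x₁).symm) (extChartAt (𝓡∂ n) x₁ p) v := by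
  have h1 : hat x₀ p (unhat x₁ p v) = tangentCoordChange (𝓡∂ n) x₁ x₀ p v :=
    tangentCoordChange_comp ⟨⟨hp₁, mem_extChartAt_source p⟩, hp₀⟩
  rw [h1, tangentCoordChange_def, fderivWithin_of_mem_nhds]
  have := (mem_interior_iff_coord hp₁).1 hi
  exact mem_of_superset (target_mem_nhds ((extChartAt (𝓡∂ n) x₁).map_source hp₁) this)
    (extChartAt_target_subset_range x₁)

/-- By covariance the equation in one chart gives it in all charts. Interiority of `γ t` makes the
chart targets neighbourhoods, so that transition maps and metrics have full derivatives there. -/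
theorem isGeodesicAt_iff (g : Metric n M) {γ : ℝ → M} {t : ℝ} {x₁ : M}
    (hsrc : γ t ∈ (extChartAt (𝓡∂ n) x₁).source) (hi : γ t ∈ (𝓡∂ n).interior M) :
    IsGeodesicAt g γ t ↔ ContinuousAt γ t ∧
      ContDiffAt ℝ 2 (fun r => extChartAt (𝓡∂ n) x₁ (γ r)) t ∧
      deriv (deriv fun r => extChartAt (𝓡∂ n) x₁ (γ r)) t =
        geodesicAcc g x₁ (extChartAt (𝓡∂ n) x₁ (γ t))
          (deriv (fun r => extChartAt (𝓡∂ n) x₁ (γ r)) t) := by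
  have hreg : ∀ x₀ : M, γ t ∈ (chartAt (EuclideanHalfSpace n) x₀).source →
      (ContMDiffAt 𝓘(ℝ, ℝ) (𝓡∂ n) 2 γ t ↔ ContinuousAt γ t ∧
        ContDiffAt ℝ 2 (fun r => extChartAt (𝓡∂ n) x₀ (γ r)) t) := fun x₀ h => by
    have : IsManifold (𝓡∂ n) 2 M := IsManifold.of_le (n := ∞) two_le_infty
    rw [contMDiffAt_iff_target_of_mem_source h, contMDiffAt_iff_contDiffAt]; rfl
  have hpos : ∀ x₀ : M, γ t ∈ (extChartAt (𝓡∂ n) x₀).source → ∀ v, v ≠ 0 →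
      0 < coordMetric g x₀ (extChartAt (𝓡∂ n) x₀ (γ t)) v v := fun x₀ h v hv =>
    coordMetric_pos g ((extChartAt (𝓡∂ n) x₀).map_source h) hv
  constructor
  · rintro ⟨h1, h2⟩
    rw [extChartAt_source] at hsrc
    obtain ⟨h3, h4⟩ := (hreg x₁ hsrc).1 h1
    refine ⟨h3, h4, ?_⟩
    rw [← extChartAt_source (𝓡∂ n)] at hsrc
    refine (eq_acc_iff (hpos x₁ hsrc)).2 fun w => ?_
    rw [← christoffel_eq_chr g]
    rw [extChartAt_source] at hsrc
    exact h2 x₁ hsrc w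
  · rintro ⟨h1, h2, h3⟩
    have hsrc' := hsrc
    rw [extChartAt_source] at hsrc'
    refine ⟨(hreg x₁ hsrc').2 ⟨h1, h2⟩, fun x₀ hx₀ => ?_⟩
    rw [← extChartAt_source (𝓡∂ n)] at hx₀
    intro c w
    set p := γ t with hp
    set c₁ : ℝ → V n := fun r => extChartAt (𝓡∂ n) x₁ (γ r) with hc₁
    set ψ : V n → V n := extChartAt (𝓡∂ n) x₀ ∘ (extChartAt (𝓡∂ n) x₁).symm with hψ
    set y := c₁ t with hy
    have hyp : y = extChartAt (𝓡∂ n) x₁ p := rfl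
    have hsymm : (extChartAt (𝓡∂ n) x₁).symm y = p := (extChartAt (𝓡∂ n) x₁).left_inv hsrc
    have hyt : y ∈ (extChartAt (𝓡∂ n) x₁).target := (extChartAt (𝓡∂ n) x₁).map_source hsrc
    have hy0 : 0 < y 0 := (mem_interior_iff_coord hsrc).1 hi
    have hψy : ψ y = extChartAt (𝓡∂ n) x₀ p := by simp only [hψ, Function.comp, hsymm]
    have hψt : ψ y ∈ (extChartAt (𝓡∂ n) x₀).target := by
      rw [hψy]; exact (extChartAt (𝓡∂ n) x₀).map_source hx₀
    have hψ0 : 0 < ψ y 0 := by rw [hψy]; exact (mem_interior_iff_coord hx₀).1 hi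
    have hn1 := target_mem_nhds hyt hy0
    have hn0 := target_mem_nhds hψt hψ0
    have hcψ : c =ᶠ[𝓝 t] ψ ∘ c₁ := by
      filter_upwards [h1.eventually_mem ((isOpen_extChartAt_source x₁).mem_nhds hsrc)] with r hr
      simp only [c, hψ, hc₁, Function.comp, (extChartAt (𝓡∂ n) x₁).left_inv hr]
    have hψs : ContDiffAt ℝ 2 ψ y := by
      have h := contDiffWithinAt_ext_coord_change (I := 𝓡∂ n) (n := ∞) x₀ x₁ (y := y) (by
        rw [PartialEquiv.trans_source]; exact ⟨hyt, by simpa only [mem_preimage, hsymm]⟩)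
      exact (h.contDiffAt (mem_of_superset hn1 (extChartAt_target_subset_range x₁))).of_le
        two_le_infty
    have hGd : ∀ x : M, ∀ z, (extChartAt (𝓡∂ n) x).target ∈ 𝓝 z →
        DifferentiableAt ℝ (coordMetric g x) z := fun x z hz =>
      ((contDiffOn_coordMetric g x).contDiffAt hz).differentiableAt (by simp)
    have hnear : ∀ᶠ z in 𝓝 y, z ∈ (extChartAt (𝓡∂ n) x₁).target ∧ 0 < z 0 ∧
        (extChartAt (𝓡∂ n) x₁).symm z ∈ (extChartAt (𝓡∂ n) x₀).source := by
      refine Filter.Eventually.and hn1 (Filter.Eventually.and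
        ((isOpen_lt continuous_const (coord₀ n).continuous).mem_nhds hy0) ?_)
      have hcs : ContinuousAt (extChartAt (𝓡∂ n) x₁).symm y :=
        (continuousOn_extChartAt_symm x₁).continuousAt hn1
      exact hcs.eventually_mem ((isOpen_extChartAt_source x₀).mem_nhds (by rwa [hsymm]))
    have hGG : ∀ᶠ z in 𝓝 y, ∀ v w, coordMetric g x₁ z v w =
        coordMetric g x₀ (ψ z) (fderiv ℝ ψ z v) (fderiv ℝ ψ z w) := by
      filter_upwards [hnear] with z hz v w
      set q := (extChartAt (𝓡∂ n) x₁).symm z with hq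
      have hq1 : q ∈ (extChartAt (𝓡∂ n) x₁).source := (extChartAt (𝓡∂ n) x₁).map_target hz.1
      have hqz : extChartAt (𝓡∂ n) x₁ q = z := (extChartAt (𝓡∂ n) x₁).right_inv hz.1
      have hqi : q ∈ (𝓡∂ n).interior M := (mem_interior_iff_coord hq1).2 (by rw [hqz]; exact hz.2.1)
      rw [coordMetric_eq_inner, inner_eq_coordMetric g hz.2.2, hat_unhat_eq_fderiv hz.2.2 hq1 hqi,
        hat_unhat_eq_fderiv hz.2.2 hq1 hqi, hqz]
      rfl
    have htr := geodesic_transform (c := c₁) (t := t) (y := y) hψs (hGd x₀ _ hn0) (hGd x₁ _ hn1) hGG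
      (fun v w => coordMetric_symm g x₀ _ v w) h2 rfl
    -- The test vector `w` expressed in the chart at `x₁`, so that the derivative of the transition
    -- map returns `w`.
    set w' : V n := hat x₁ p (unhat x₀ p w) with hw'
    have hw : fderiv ℝ ψ y w' = w := by
      rw [← hat_unhat_eq_fderiv hx₀ hsrc hi, hw', unhat_hat hsrc, hat_unhat hx₀]
    have h4 := htr w'
    rw [hw, ← Filter.EventuallyEq.deriv_eq (Filter.EventuallyEq.deriv hcψ), ← hcψ.deriv_eq] at h4
    have hct : c t = ψ y := hcψ.self_of_nhds
    rw [christoffel_eq_chr g, hct, metricDer,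
      fderivWithin_of_mem_nhds hn0, h4]
    have h5 := (eq_acc_iff (hpos x₁ hsrc)).1 h3 w'
    rw [metricDer, fderivWithin_of_mem_nhds hn1] at h5
    exact h5

end GeodesicEquation

set_option maxSynthPendingDepth 3

/-! ### Regularity of families of metrics and of their geodesic flow. -/

section Families

open Set Filter

variable {n : ℕ} [NeZero n] {M : Type*} [TopologicalSpace M]
  [ChartedSpace (EuclideanHalfSpace n) M] [IsManifold (𝓡∂ n) ∞ M]

/-! ### Joint regularity of families of metrics -/

/-- `U` is not open, so the total derivative within `J ×ˢ U` is assembled by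
`hasFDerivWithinAt_of_partial`; it is continuous because both partial derivatives are. -/
theorem contDiffOn_one_of_partial {F : Type*} [NormedAddCommGroup F] [NormedSpace ℝ F]
    {f : ℝ → V n → F} {J : Set ℝ} {U : Set (V n)} (hJ : IsOpen J) (hU : UniqueDiffOn ℝ U)
    (h₁ : ∀ s ∈ J, ∀ y ∈ U, DifferentiableAt ℝ (fun s' => f s' y) s)
    (h₁c : ContinuousOn (fun p : ℝ × V n => deriv (fun s' => f s' p.2) p.1) (J ×ˢ U))
    (h₂ : ∀ s ∈ J, DifferentiableOn ℝ (f s) U)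
    (h₂c : ContinuousOn (fun p : ℝ × V n => fderivWithin ℝ (f p.1) U p.2) (J ×ˢ U)) :
    ContDiffOn ℝ 1 (fun p : ℝ × V n => f p.1 p.2) (J ×ˢ U) := by
  have hud : UniqueDiffOn ℝ (J ×ˢ U) := hJ.uniqueDiffOn.prod hU
  have hsub : ∀ p ∈ J ×ˢ U, J ×ˢ U ∈ 𝓝[univ ×ˢ U] p := fun p hp => by
    have : J ×ˢ U = (univ ×ˢ U) ∩ (J ×ˢ univ) := by
      rw [prod_inter_prod, univ_inter, inter_univ]
    rw [this]
    exact inter_mem_nhdsWithin _ ((hJ.prod isOpen_univ).mem_nhds ⟨hp.1, mem_univ _⟩)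
  have hd : ∀ p ∈ J ×ˢ U, HasFDerivWithinAt (fun p : ℝ × V n => f p.1 p.2)
      ((ContinuousLinearMap.toSpanSingleton ℝ (deriv (fun s' => f s' p.2) p.1)).comp
        (ContinuousLinearMap.fst ℝ ℝ (V n)) +
        (fderivWithin ℝ (f p.1) U p.2).comp (ContinuousLinearMap.snd ℝ ℝ (V n))) (J ×ˢ U) p := by
    rintro ⟨s, y⟩ hp
    refine (hasFDerivWithinAt_of_partial (f := f) (f₁ := fun s y => deriv (fun s' => f s' y) s)
      (U := U) ?_ ?_ ?_).mono (prod_mono (subset_univ _) subset_rfl)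
    · filter_upwards [hsub _ hp] with q hq
      exact (h₁ _ hq.1 _ hq.2).hasDerivAt
    · exact (h₁c _ hp).mono_of_mem_nhdsWithin (hsub _ hp)
    · exact (h₂ _ hp.1 _ hp.2).hasFDerivWithinAt
  refine (contDiffOn_succ_iff_fderivWithin (n := 0) hud).2 ⟨fun p hp =>
    (hd p hp).differentiableWithinAt, by simp, ?_⟩
  rw [contDiffOn_zero]
  refine ContinuousOn.congr ?_ fun p hp => (hd p hp).fderivWithin (hud p hp)
  refine ContinuousOn.add ?_ (h₂c.clm_comp continuousOn_const)
  refine ContinuousOn.clm_comp ?_ continuousOn_const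
  exact ((ContinuousLinearMap.toSpanSingletonCLE (𝕜 := ℝ) (E := F)).continuous).comp_continuousOn h₁c

variable {ε : ℝ} {g : ℝ → Metric n M}

theorem IsC1Family.contDiffOn_coordMetric (hg : IsC1Family ε g) (x₀ : M) :
    ContDiffOn ℝ 1 (fun p : ℝ × V n => coordMetric (g p.1) x₀ p.2)
      (Ioo (-ε) ε ×ˢ (extChartAt (𝓡∂ n) x₀).target) := by
  have hU := uniqueDiffOn_target (n := n) x₀
  set U := (extChartAt (𝓡∂ n) x₀).target with hUd
  obtain ⟨-, h2, h3⟩ := hg x₀ 0 (by norm_num)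
  obtain ⟨h4, -, -⟩ := hg x₀ 1 (by norm_num)
  set e := continuousMultilinearCurryFin0 ℝ (V n) (V n →L[ℝ] V n →L[ℝ] ℝ) with he
  have he0 : ∀ (s : ℝ) (y : V n), coordMetric (g s) x₀ y =
      e (iteratedFDerivWithin ℝ 0 (coordMetric (g s) x₀) U y) := fun s y => by
    rw [iteratedFDerivWithin_zero_eq_comp]; simp [e]
  set e1 := continuousMultilinearCurryFin1 ℝ (V n) (V n →L[ℝ] V n →L[ℝ] ℝ) with he1
  have he1' : ∀ (s : ℝ), ∀ y ∈ U, fderivWithin ℝ (coordMetric (g s) x₀) U y =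
      e1 (iteratedFDerivWithin ℝ 1 (coordMetric (g s) x₀) U y) := fun s y hy => by
    ext a b c
    simp only [e1, continuousMultilinearCurryFin1_apply]
    rw [iteratedFDerivWithin_one_apply (hU y hy)]
    rfl
  have hderiv : ∀ s ∈ Ioo (-ε) ε, ∀ y ∈ U, HasDerivAt (fun s' => coordMetric (g s') x₀ y)
      (e (deriv (fun s' => iteratedFDerivWithin ℝ 0 (coordMetric (g s') x₀) U y) s)) s := by
    intro s hs y hy
    have := (e.toContinuousLinearEquiv.hasFDerivAt).comp_hasDerivAt s (h2 s hs y hy).hasDerivAt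
    exact this.congr_of_eventuallyEq (Eventually.of_forall fun s' => he0 s' y)
  refine contDiffOn_one_of_partial isOpen_Ioo hU
    (fun s hs y hy => (hderiv s hs y hy).differentiableAt) ?_
    (fun s _ => (BrokenRay.contDiffOn_coordMetric (g s) x₀).differentiableOn (by simp)) ?_
  · refine (e.continuous.comp_continuousOn h3).congr fun p hp => ?_
    exact (hderiv p.1 hp.1 p.2 hp.2).deriv
  · exact (e1.continuous.comp_continuousOn h4).congr fun p hp => he1' p.1 p.2 hp.2

/-- This is where the order-two derivatives in `IsC1Family` enter. A metric derivative that is `C¹`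
in all variables makes the geodesic vector field `C¹` and hence its flow differentiable. -/
theorem IsC1Family.contDiffOn_metricDer (hg : IsC1Family ε g) (x₀ : M) :
    ContDiffOn ℝ 1 (fun p : ℝ × V n => metricDer (g p.1) x₀ p.2)
      (Ioo (-ε) ε ×ˢ (extChartAt (𝓡∂ n) x₀).target) := by
  have hU := uniqueDiffOn_target (n := n) x₀
  obtain ⟨-, h2, h3⟩ := hg x₀ 1 (by norm_num)
  obtain ⟨h4, -, -⟩ := hg x₀ 2 (by norm_num)
  set e1 := continuousMultilinearCurryFin1 ℝ (V n) (V n →L[ℝ] V n →L[ℝ] ℝ) with he1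
  have he1' : ∀ (s : ℝ), ∀ y ∈ (extChartAt (𝓡∂ n) x₀).target, metricDer (g s) x₀ y =
      e1 (iteratedFDerivWithin ℝ 1 (coordMetric (g s) x₀) (extChartAt (𝓡∂ n) x₀).target y) :=
    fun s y hy => by
    ext a b c
    simp only [e1, continuousMultilinearCurryFin1_apply]
    rw [iteratedFDerivWithin_one_apply (hU y hy)]
    rfl
  have hderiv : ∀ s ∈ Ioo (-ε) ε, ∀ y ∈ (extChartAt (𝓡∂ n) x₀).target,
      HasDerivAt (fun s' => metricDer (g s') x₀ y)
      (e1 (deriv (fun s' => iteratedFDerivWithin ℝ 1 (coordMetric (g s') x₀)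
        (extChartAt (𝓡∂ n) x₀).target y) s)) s := by
    intro s hs y hy
    have := (e1.toContinuousLinearEquiv.hasFDerivAt).comp_hasDerivAt s (h2 s hs y hy).hasDerivAt
    exact this.congr_of_eventuallyEq (Eventually.of_forall fun s' => he1' s' y hy)
  refine contDiffOn_one_of_partial isOpen_Ioo hU
    (fun s hs y hy => (hderiv s hs y hy).differentiableAt) ?_ (fun s _ => ?_) ?_
  · refine (e1.continuous.comp_continuousOn h3).congr fun p hp => ?_
    exact (hderiv p.1 hp.1 p.2 hp.2).deriv
  · have h := (BrokenRay.contDiffOn_coordMetric (g s) x₀).fderivWithin (m := 1) hU (by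
      norm_num; exact two_le_infty)
    exact h.differentiableOn one_ne_zero
  · rw [continuousOn_clm_apply]
    intro a
    rw [continuousOn_clm_apply]
    intro b
    have h5 : ContinuousOn (fun p : ℝ × V n => (iteratedFDerivWithin ℝ 2 (coordMetric (g p.1) x₀)
        (extChartAt (𝓡∂ n) x₀).target p.2) ![a, b])
        (Ioo (-ε) ε ×ˢ (extChartAt (𝓡∂ n) x₀).target) :=
      (ContinuousMultilinearMap.apply ℝ (fun _ : Fin 2 => V n) (V n →L[ℝ] V n →L[ℝ] ℝ)
        ![a, b]).continuous.comp_continuousOn h4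
    refine h5.congr fun p hp => ?_
    exact (iteratedFDerivWithin_two_apply (coordMetric (g p.1) x₀) hU hp.2 ![a, b]).symm

theorem contDiff_chr : ContDiff ℝ 1 (fun p : (V n →L[ℝ] V n →L[ℝ] V n →L[ℝ] ℝ) × V n =>
    chr p.1 p.2) := by
  unfold chr
  refine ContDiff.sub ((contDiff_fst.clm_apply contDiff_snd).clm_apply contDiff_snd)
    (ContDiff.const_smul _ ?_)
  have h1 : ContDiff ℝ 1 (fun p : (V n →L[ℝ] V n →L[ℝ] V n →L[ℝ] ℝ) × V n => p.1.flip p.2) :=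
    ((ContinuousLinearMap.flipₗᵢ ℝ (V n) (V n) (V n →L[ℝ] ℝ)).contDiff.comp contDiff_fst).clm_apply
      contDiff_snd
  exact ((ContinuousLinearMap.flipₗᵢ ℝ (V n) (V n) ℝ).contDiff.comp h1).clm_apply contDiff_snd

/-- Inversion of linear maps is smooth at invertible ones, and positive definite forms are
invertible. -/
theorem IsC1Family.contDiffOn_inverse (hg : IsC1Family ε g) (x₀ : M) :
    ContDiffOn ℝ 1 (fun p : ℝ × V n => (coordMetric (g p.1) x₀ p.2).inverse)
      (Ioo (-ε) ε ×ˢ (extChartAt (𝓡∂ n) x₀).target) := by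
  intro p hp
  obtain ⟨e, he⟩ := exists_equiv_of_pos (G := coordMetric (g p.1) x₀ p.2) fun v hv =>
    coordMetric_pos (g p.1) hp.2 hv
  have h1 := contDiffAt_map_inverse (𝕜 := ℝ) (n := 1) e
  rw [he] at h1
  exact h1.comp_contDiffWithinAt p (hg.contDiffOn_coordMetric x₀ p hp)

theorem IsC1Family.contDiffOn_geodesicAcc (hg : IsC1Family ε g) (x₀ : M) :
    ContDiffOn ℝ 1 (fun p : ℝ × (V n × V n) => geodesicAcc (g p.1) x₀ p.2.1 p.2.2)
      (Ioo (-ε) ε ×ˢ ((extChartAt (𝓡∂ n) x₀).target ×ˢ univ)) := by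
  have hm : MapsTo (fun p : ℝ × (V n × V n) => (p.1, p.2.1))
      (Ioo (-ε) ε ×ˢ ((extChartAt (𝓡∂ n) x₀).target ×ˢ univ))
      (Ioo (-ε) ε ×ˢ (extChartAt (𝓡∂ n) x₀).target) := fun p hp => ⟨hp.1, hp.2.1⟩
  have hp : ContDiff ℝ 1 (fun p : ℝ × (V n × V n) => (p.1, p.2.1)) :=
    contDiff_fst.prodMk (contDiff_fst.comp contDiff_snd)
  have h1 := (hg.contDiffOn_inverse x₀).comp hp.contDiffOn hm
  have h2 := (hg.contDiffOn_metricDer x₀).comp hp.contDiffOn hm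
  have h3 : ContDiffOn ℝ 1 (fun p : ℝ × (V n × V n) => chr (metricDer (g p.1) x₀ p.2.1) p.2.2)
      (Ioo (-ε) ε ×ˢ ((extChartAt (𝓡∂ n) x₀).target ×ˢ univ)) :=
    contDiff_chr.comp_contDiffOn (h2.prodMk (contDiff_snd.comp contDiff_snd).contDiffOn)
  exact (h1.clm_apply h3).neg

/-- The acceleration of geodesics extends across the boundary. -/
theorem IsC1Family.exists_acc_extension (hg : IsC1Family ε g) (x₀ : M) {s₀ : ℝ}
    (hs₀ : s₀ ∈ Ioo (-ε) ε) {y₀ : V n} (hy₀ : y₀ ∈ (extChartAt (𝓡∂ n) x₀).target) (v₀ : V n) :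
    ∃ a : ℝ × (V n × V n) → V n, ContDiffAt ℝ 1 a (s₀, (y₀, v₀)) ∧
      ∀ s y v, 0 ≤ y 0 → a (s, (y, v)) = geodesicAcc (g s) x₀ y v := by
  set e : V n := EuclideanSpace.single (0 : Fin n) (1 : ℝ) with he
  -- The reflection of the position in the boundary hyperplane; parameter and velocity are left
  -- alone.
  let ρ₀ : V n →L[ℝ] V n := ContinuousLinearMap.id ℝ (V n) - (2 : ℝ) • (coord₀ n).smulRight e
  let ρ : ℝ × (V n × V n) →L[ℝ] ℝ × (V n × V n) :=
    (ContinuousLinearMap.id ℝ ℝ).prodMap (ρ₀.prodMap (ContinuousLinearMap.id ℝ (V n)))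
  let ℓ : ℝ × (V n × V n) →L[ℝ] ℝ :=
    (coord₀ n).comp ((ContinuousLinearMap.fst ℝ (V n) (V n)).comp
      (ContinuousLinearMap.snd ℝ ℝ (V n × V n)))
  have hset : (Ioo (-ε) ε ×ˢ (chartOpen x₀ ×ˢ univ)) ∩ {z | 0 ≤ ℓ z} =
      Ioo (-ε) ε ×ˢ ((extChartAt (𝓡∂ n) x₀).target ×ˢ (univ : Set (V n))) := by
    ext z
    simp only [mem_inter_iff, mem_prod, mem_univ, and_true, mem_chart_target, mem_ofPred_eq]
    exact and_assoc
  have he0 : e 0 = 1 := by simp [e]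
  obtain ⟨a, ha, ha'⟩ := exists_contDiffAt_extension (f := fun p : ℝ × (V n × V n) =>
      geodesicAcc (g p.1) x₀ p.2.1 p.2.2) (z₀ := (s₀, (y₀, v₀)))
    (O := Ioo (-ε) ε ×ˢ (chartOpen x₀ ×ˢ univ)) ℓ ρ (e := (0, (e, 0)))
    (by simp [ℓ, he0]) (fun z => by simp [ℓ, ρ, ρ₀, he0]; ring) (fun z hz => by
      have : z.2.1 0 = 0 := hz
      ext : 1
      · rfl
      · ext : 1
        · simp [ρ, ρ₀, this]
        · rfl)
    (isOpen_Ioo.prod ((isOpen_chartOpen x₀).prod isOpen_univ))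
    (by rw [hset]; exact hg.contDiffOn_geodesicAcc x₀)
    ⟨hs₀, (mem_chart_target.1 hy₀).1, mem_univ _⟩ (mem_chart_target.1 hy₀).2
  exact ⟨a, ha, fun s y v h => ha' (s, (y, v)) h⟩

/-- The flow of the geodesic equations of the metrics `g s` in the chart at `x₀`. -/
structure IsGeodesicFlow (g : ℝ → Metric n M) (x₀ : M) (η : ℝ) (N O : Set (ℝ × (V n × V n)))
    (a : ℝ × (V n × V n) → V n) (C U : ℝ × (V n × V n) → ℝ → V n) : Prop where
  pos : 0 < η
  acc_eq : ∀ s y v, 0 ≤ y 0 → a (s, (y, v)) = geodesicAcc (g s) x₀ y v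
  isOpen : IsOpen N
  initial : ∀ z ∈ N, C z 0 = z.2.1 ∧ U z 0 = z.2.2
  hasDerivAt_C : ∀ z ∈ N, ∀ t ∈ Icc (-η) η, HasDerivAt (C z) (U z t) t
  hasDerivAt_U : ∀ z ∈ N, ∀ t ∈ Icc (-η) η, HasDerivAt (U z) (a (z.1, (C z t, U z t))) t
  mem : ∀ z ∈ N, ∀ t ∈ Icc (-η) η, (z.1, (C z t, U z t)) ∈ O
  mem_chartOpen : ∀ z ∈ N, ∀ t ∈ Icc (-η) η, C z t ∈ chartOpen x₀
  variation : ∀ σ : ℝ → V n × V n, (0, σ 0) ∈ N → DifferentiableAt ℝ σ 0 →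
    ∃ wy wv : ℝ → V n, (∀ t ∈ Icc 0 η, HasDerivWithinAt wy (wv t) (Icc 0 η) t) ∧
      (∀ t ∈ Ico 0 η, HasFDerivAt (fun p : ℝ × ℝ => C (p.1, σ p.1) p.2)
        ((ContinuousLinearMap.fst ℝ ℝ ℝ).smulRight (wy t) +
          (ContinuousLinearMap.snd ℝ ℝ ℝ).smulRight (U (0, σ 0) t)) (0, t)) ∧
      (∀ t ∈ Ico 0 η, HasFDerivAt (fun p : ℝ × ℝ => U (p.1, σ p.1) p.2)
        ((ContinuousLinearMap.fst ℝ ℝ ℝ).smulRight (wv t) +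
          (ContinuousLinearMap.snd ℝ ℝ ℝ).smulRight (a (0, (C (0, σ 0) t, U (0, σ 0) t)))) (0, t))

/-- The parameter is made a state variable with zero velocity, so that differentiability of a flow
in its initial value already contains differentiability in `s`. The acceleration is an extension
across the boundary; its trajectories are geodesics only as long as they remain in the half-space.
-/
theorem IsC1Family.exists_geodesicFlow (hε : 0 < ε) (hg : IsC1Family ε g) (x₀ : M) {y₀ : V n}
    (hy₀ : y₀ ∈ (extChartAt (𝓡∂ n) x₀).target) (v₀ : V n) {O : Set (ℝ × (V n × V n))}
    (hO : O ∈ 𝓝 ((0 : ℝ), (y₀, v₀))) :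
    ∃ η, ∃ N ∈ 𝓝 ((0 : ℝ), (y₀, v₀)), ∃ a C U, IsGeodesicFlow g x₀ η N O a C U := by
  obtain ⟨a, ha, ha'⟩ := hg.exists_acc_extension x₀ (s₀ := 0) ⟨by linarith, hε⟩ hy₀ v₀
  set X : ℝ × (V n × V n) → ℝ × (V n × V n) := fun z => (0, (z.2.2, a z)) with hX
  have hXc : ContDiffAt ℝ 1 X (0, (y₀, v₀)) :=
    contDiffAt_const.prodMk ((contDiff_snd.comp contDiff_snd).contDiffAt.prodMk ha)
  have hO' : {z ∈ O | z.2.1 ∈ chartOpen x₀ ∧ ContDiffAt ℝ 1 a z} ∈ 𝓝 ((0 : ℝ), (y₀, v₀)) := by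
    refine Filter.Eventually.and hO (Filter.Eventually.and ?_ (ha.eventually (by simp)))
    have : ContinuousAt (fun z : ℝ × (V n × V n) => z.2.1) (0, (y₀, v₀)) := by fun_prop
    exact this.eventually_mem ((isOpen_chartOpen x₀).mem_nhds (mem_chart_target.1 hy₀).1)
  obtain ⟨η, hη, r, hr, Φ, hΦ0, hΦ, hΦc, hΦA⟩ := exists_flow hXc hO'
  -- The parameter component has zero derivative, so it is constant along trajectories.
  have h1 : ∀ z ∈ Metric.ball ((0 : ℝ), (y₀, v₀)) r, ∀ t ∈ Icc (-η) η, (Φ z t).1 = z.1 := by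
    intro z hz t ht
    have hd : ∀ t ∈ Icc (-η) η, HasDerivWithinAt (fun t => (Φ z t).1) 0 (Icc (-η) η) t :=
      fun t ht => ((ContinuousLinearMap.fst ℝ ℝ (V n × V n)).hasFDerivAt.comp_hasDerivAt t
        (hΦ z hz t ht).1).hasDerivWithinAt
    have h := (convex_Icc (-η) η).norm_image_sub_le_of_norm_hasDerivWithin_le (C := 0) hd
      (by simp) (show (0 : ℝ) ∈ Icc (-η) η from ⟨by linarith, hη.le⟩) ht
    rw [zero_mul, norm_le_zero_iff, sub_eq_zero] at h
    rw [h, hΦ0 z hz]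
  have h1' : ∀ z ∈ Metric.ball ((0 : ℝ), (y₀, v₀)) r, ∀ t ∈ Icc (-η) η,
      (z.1, ((Φ z t).2.1, (Φ z t).2.2)) = Φ z t := fun z hz t ht => by
    rw [← h1 z hz t ht]
  have hpos : Icc 0 η ⊆ Icc (-η) η := Icc_subset_Icc_left (by linarith)
  refine ⟨η, Metric.ball ((0 : ℝ), (y₀, v₀)) r, Metric.ball_mem_nhds _ hr, a,
    fun z t => (Φ z t).2.1, fun z t => (Φ z t).2.2, hη, ha', Metric.isOpen_ball,
    fun z hz => by simp [hΦ0 z hz],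
    fun z hz t ht => ?_, fun z hz t ht => ?_, fun z hz t ht => ?_, fun z hz t ht => ?_,
    fun σ hσN hσ => ?_⟩
  · exact ((ContinuousLinearMap.fst ℝ (V n) (V n)).comp
      (ContinuousLinearMap.snd ℝ ℝ (V n × V n))).hasFDerivAt.comp_hasDerivAt t (hΦ z hz t ht).1
  · rw [h1' z hz t ht]
    exact ((ContinuousLinearMap.snd ℝ (V n) (V n)).comp
      (ContinuousLinearMap.snd ℝ ℝ (V n × V n))).hasFDerivAt.comp_hasDerivAt t (hΦ z hz t ht).1
  · rw [h1' z hz t ht]; exact (hΦ z hz t ht).2.1.1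
  · exact (hΦ z hz t ht).2.1.2.1
  · obtain ⟨A, hA0, hA, hA'⟩ := hΦA _ hσN
    -- The derivative at `0` of `s ↦ (s, σ s)`, the curve of initial data; `A t ζ` is the variation
    -- field along the trajectory.
    set ζ : ℝ × (V n × V n) := (1, deriv σ 0) with hζ
    set z₁ : ℝ × (V n × V n) := (0, σ 0) with hz₁
    have hjoint : ∀ t ∈ Ico 0 η, HasFDerivAt (fun p : ℝ × ℝ => Φ (p.1, σ p.1) p.2)
        ((ContinuousLinearMap.fst ℝ ℝ ℝ).smulRight (A t ζ) +
          (ContinuousLinearMap.snd ℝ ℝ ℝ).smulRight (X (Φ z₁ t))) (0, t) := by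
      intro t ht
      have htI : Icc (-η) η ∈ 𝓝 t := Icc_mem_nhds (by linarith [ht.1]) ht.2
      have hN : Metric.ball ((0 : ℝ), (y₀, v₀)) r ∈ 𝓝 z₁ := Metric.isOpen_ball.mem_nhds hσN
      have htη : t ∈ Icc (-η) η := hpos ⟨ht.1, ht.2.le⟩
      have hcΦ : ContinuousAt (fun p : ℝ × (ℝ × (V n × V n)) => Φ p.2 p.1) (t, z₁) := by
        have h3 : ContinuousAt (fun p : (ℝ × (V n × V n)) × ℝ => Φ p.1 p.2) (z₁, t) :=
          hΦc.continuousAt (prod_mem_nhds hN htI)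
        exact ContinuousAt.comp (f := fun p : ℝ × (ℝ × (V n × V n)) => (p.2, p.1))
          (x := (t, z₁)) h3 (by fun_prop)
      have hp := hasFDerivWithinAt_of_partial (f := fun t z => Φ z t) (f₁ := fun t z => X (Φ z t))
        (s₀ := t) (y₀ := z₁) (U := univ) (f₂ := A t) (by
          rw [univ_prod_univ, nhdsWithin_univ]
          filter_upwards [prod_mem_nhds htI hN] with p hp
          exact (hΦ p.2 hp.2 p.1 hp.1).1) (by
          rw [univ_prod_univ, continuousWithinAt_univ]
          have hXca : ContinuousAt X (Φ z₁ t) :=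
            continuousAt_const.prodMk ((continuous_snd.comp continuous_snd).continuousAt.prodMk
              (hΦ z₁ hσN t htη).2.1.2.2.continuousAt)
          exact ContinuousAt.comp (g := X) (f := fun p : ℝ × (ℝ × (V n × V n)) => Φ p.2 p.1)
            (x := (t, z₁)) hXca hcΦ)
        (hA t ⟨ht.1, ht.2.le⟩).hasFDerivWithinAt
      rw [univ_prod_univ, hasFDerivWithinAt_univ] at hp
      have hσ' : HasFDerivAt (fun p : ℝ × ℝ => (p.2, (p.1, σ p.1)))
          ((ContinuousLinearMap.snd ℝ ℝ ℝ).prod ((ContinuousLinearMap.fst ℝ ℝ ℝ).prod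
            ((ContinuousLinearMap.toSpanSingleton ℝ (deriv σ 0)).comp
              (ContinuousLinearMap.fst ℝ ℝ ℝ)))) (0, t) := by
        refine hasFDerivAt_snd.prodMk (hasFDerivAt_fst.prodMk ?_)
        exact HasFDerivAt.comp (g := σ) (f := fun p : ℝ × ℝ => p.1) (0, t)
          hσ.hasDerivAt.hasFDerivAt hasFDerivAt_fst
      have h4 := HasFDerivAt.comp (f := fun p : ℝ × ℝ => (p.2, (p.1, σ p.1))) (0, t) hp hσ'
      refine h4.congr_fderiv ?_
      refine ContinuousLinearMap.ext fun p => ?_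
      have h5 : ((p.1, p.1 • deriv σ 0) : ℝ × (V n × V n)) = p.1 • ζ := by simp [ζ]
      simp only [ContinuousLinearMap.comp_apply, add_apply,
        ContinuousLinearMap.prod_apply, ContinuousLinearMap.coe_fst', ContinuousLinearMap.coe_snd',
        ContinuousLinearMap.toSpanSingleton_apply, ContinuousLinearMap.smulRight_apply, h5, map_smul]
      abel
    refine ⟨fun t => (A t ζ).2.1, fun t => (A t ζ).2.2, fun t ht => ?_, fun t ht => ?_,
      fun t ht => ?_⟩
    · have h3 := (hA' t ht).clm_apply (hasDerivWithinAt_const t _ ζ)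
      have hfd : HasFDerivAt X (fderiv ℝ X (Φ z₁ t)) (Φ z₁ t) :=
        ((hΦ _ hσN t (hpos ht)).2.2.differentiableAt one_ne_zero).hasFDerivAt
      -- The position component of `X` is the velocity. Linearized, this says that the variation of
      -- the velocity is the time derivative of the variation of the position.
      have h4 : ∀ w, (fderiv ℝ X (Φ z₁ t) w).2.1 = w.2.2 := by
        have h5 : HasFDerivAt (fun z : ℝ × (V n × V n) => z.2.2)
            (((ContinuousLinearMap.fst ℝ (V n) (V n)).comp
              (ContinuousLinearMap.snd ℝ ℝ (V n × V n))).comp (fderiv ℝ X (Φ z₁ t))) (Φ z₁ t) :=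
          ((ContinuousLinearMap.fst ℝ (V n) (V n)).comp
            (ContinuousLinearMap.snd ℝ ℝ (V n × V n))).hasFDerivAt.comp (Φ z₁ t) hfd
        have h6 := h5.unique ((ContinuousLinearMap.snd ℝ (V n) (V n)).comp
          (ContinuousLinearMap.snd ℝ ℝ (V n × V n))).hasFDerivAt
        exact fun w => DFunLike.congr_fun h6 w
      have h7 := ((ContinuousLinearMap.fst ℝ (V n) (V n)).comp
        (ContinuousLinearMap.snd ℝ ℝ (V n × V n))).hasFDerivAt.comp_hasDerivWithinAt t h3
      refine h7.congr_deriv ?_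
      simp [h4]
    · have h3 := ((ContinuousLinearMap.fst ℝ (V n) (V n)).comp
        (ContinuousLinearMap.snd ℝ ℝ (V n × V n))).hasFDerivAt.comp (0, t) (hjoint t ht)
      exact h3.congr_fderiv (by ext <;> simp [hX])
    · have h3 := ((ContinuousLinearMap.snd ℝ (V n) (V n)).comp
        (ContinuousLinearMap.snd ℝ ℝ (V n × V n))).hasFDerivAt.comp (0, t) (hjoint t ht)
      have h8 := h1' z₁ hσN t (hpos ⟨ht.1, ht.2.le⟩)
      refine h3.congr_fderiv ?_
      rw [show ((0 : ℝ), ((Φ z₁ t).2.1, (Φ z₁ t).2.2)) = Φ z₁ t from h8]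
      ext <;> simp [hX]

end Families

/-! ### Tangent vectors in charts and geodesic arcs up to their end times. -/

section Arcs

open Set Filter

variable {n : ℕ} [NeZero n] {M : Type*} [TopologicalSpace M]
  [ChartedSpace (EuclideanHalfSpace n) M] [IsManifold (𝓡∂ n) ∞ M]

/-! ### Tangent vectors in coordinates -/

/-- A tangent vector in the coordinates of the chart at `x₀`. -/
def chartState (x₀ : M) (p : TangentBundle (𝓡∂ n) M) : V n × V n :=
  (extChartAt (𝓡∂ n) x₀ p.proj, hat x₀ p.proj p.snd)

/-- The tangent vector with given coordinates in the chart at `x₀`. -/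
def ofChartState (x₀ : M) (z : V n × V n) : TangentBundle (𝓡∂ n) M :=
  ⟨(extChartAt (𝓡∂ n) x₀).symm z.1, unhat x₀ ((extChartAt (𝓡∂ n) x₀).symm z.1) z.2⟩

theorem chartState_ofChartState {x₀ : M} {z : V n × V n}
    (hz : z.1 ∈ (extChartAt (𝓡∂ n) x₀).target) : chartState x₀ (ofChartState x₀ z) = z :=
  Prod.ext ((extChartAt (𝓡∂ n) x₀).right_inv hz)
    (hat_unhat ((extChartAt (𝓡∂ n) x₀).map_target hz) z.2)

theorem ofChartState_chartState {x₀ : M} {p : TangentBundle (𝓡∂ n) M}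
    (hp : p.proj ∈ (extChartAt (𝓡∂ n) x₀).source) : ofChartState x₀ (chartState x₀ p) = p := by
  obtain ⟨p, v⟩ := p
  have h : (extChartAt (𝓡∂ n) x₀).symm (extChartAt (𝓡∂ n) x₀ p) = p :=
    (extChartAt (𝓡∂ n) x₀).left_inv hp
  have h2 : ∀ q : M, q = p → (⟨q, unhat x₀ q (hat x₀ p v)⟩ : TangentBundle (𝓡∂ n) M) = ⟨p, v⟩ := by
    rintro q rfl
    rw [unhat_hat hp]
  exact h2 _ h

theorem chartState_injOn {x₀ : M} {p q : TangentBundle (𝓡∂ n) M}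
    (hp : p.proj ∈ (extChartAt (𝓡∂ n) x₀).source) (hq : q.proj ∈ (extChartAt (𝓡∂ n) x₀).source)
    (h : chartState x₀ p = chartState x₀ q) : p = q := by
  rw [← ofChartState_chartState hp, h, ofChartState_chartState hq]

theorem mem_tangent_source {x₀ : M} {p : TangentBundle (𝓡∂ n) M} :
    p ∈ (extChartAt (𝓡∂ n).tangent (⟨x₀, 0⟩ : TangentBundle (𝓡∂ n) M)).source ↔
      p.proj ∈ (extChartAt (𝓡∂ n) x₀).source := by
  simp

theorem continuousAt_iff_chartState {σ : ℝ → TangentBundle (𝓡∂ n) M} {s₀ : ℝ} {x₀ : M}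
    (h : (σ s₀).proj ∈ (extChartAt (𝓡∂ n) x₀).source)
    (hc : ContinuousAt (fun s => (σ s).proj) s₀)
    (hd : ContinuousAt (fun s => chartState x₀ (σ s)) s₀) : ContinuousAt σ s₀ := by
  set e := extChartAt (𝓡∂ n).tangent (⟨x₀, 0⟩ : TangentBundle (𝓡∂ n) M) with he
  have h1 : ContinuousAt (fun s => e (σ s)) s₀ := hd
  have h2 : ContinuousWithinAt e.symm e.target (e (σ s₀)) :=
    continuousOn_extChartAt_symm _ _ (e.map_source (mem_tangent_source.2 h))
  have hev : ∀ᶠ s in 𝓝 s₀, σ s ∈ e.source := by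
    filter_upwards [hc.eventually_mem ((isOpen_extChartAt_source x₀).mem_nhds h)] with s hs
    exact mem_tangent_source.2 hs
  have h3 : Tendsto (fun s => e (σ s)) (𝓝 s₀) (𝓝[e.target] (e (σ s₀))) :=
    tendsto_nhdsWithin_iff.2 ⟨h1, hev.mono fun s hs => e.map_source hs⟩
  have h4 := h2.tendsto.comp h3
  rw [e.left_inv (mem_tangent_source.2 h)] at h4
  exact h4.congr' (hev.mono fun s hs => e.left_inv hs)

/-- `chartState x₀` is, by definition, the chart of the tangent bundle at the zero vector over `x₀`.
Differentiability of the scattering relation thus becomes differentiability of position and velocity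
coordinates. -/
theorem mdifferentiableAt_iff_chartState {σ : ℝ → TangentBundle (𝓡∂ n) M} {s₀ : ℝ} {x₀ : M}
    (h : (σ s₀).proj ∈ (extChartAt (𝓡∂ n) x₀).source) :
    MDifferentiableAt 𝓘(ℝ, ℝ) (𝓡∂ n).tangent σ s₀ ↔
      ContinuousAt (fun s => (σ s).proj) s₀ ∧
        DifferentiableAt ℝ (fun s => chartState x₀ (σ s)) s₀ := by
  have : IsManifold (𝓡∂ n) (1 + 1) M := IsManifold.of_le (n := ∞) (by norm_num; exact two_le_infty)
  have : IsManifold (𝓡∂ n).tangent 1 (TangentBundle (𝓡∂ n) M) := inferInstance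
  have h' := mem_tangent_source.2 h
  rw [extChartAt_source] at h'
  rw [mdifferentiableAt_iff_target_of_mem_source h', mdifferentiableAt_iff_differentiableAt]
  constructor
  · rintro ⟨h1, h2⟩
    exact ⟨(FiberBundle.continuous_proj (V n) (TangentSpace (𝓡∂ n))).continuousAt.comp h1, h2⟩
  · rintro ⟨h1, h2⟩
    exact ⟨continuousAt_iff_chartState h h1 h2.continuousAt, h2⟩

/-! ### Geodesic arcs -/

/-- The velocity of the restriction of a curve to `[a, b]`, as a point of the tangent bundle. -/
def state (γ : ℝ → M) (a b t : ℝ) : TangentBundle (𝓡∂ n) M := ⟨γ t, velocityOn γ a b t⟩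

/-- `γ` is a geodesic of `g` in the interior of `M` on `(a, b)` and is `C¹` on `[a, b]`. -/
structure IsArc (g : Metric n M) (γ : ℝ → M) (a b : ℝ) : Prop where
  lt : a < b
  contMDiffOn : ContMDiffOn 𝓘(ℝ, ℝ) (𝓡∂ n) 1 γ (Icc a b)
  mem_interior : ∀ r ∈ Ioo a b, γ r ∈ (𝓡∂ n).interior M
  geodesic : ∀ r ∈ Ioo a b, IsGeodesicAt g γ r

/-- A single metric is a constant family, so the regularity and extension results for families cover
it. -/
theorem isC1Family_const (g : Metric n M) : IsC1Family 1 fun _ => g := by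
  intro x₀ k hk U D
  refine ⟨?_, fun s _ y _ => differentiableAt_const _, ?_⟩
  · have h := (contDiffOn_coordMetric g x₀).continuousOn_iteratedFDerivWithin (m := k)
      (by exact_mod_cast le_top) (uniqueDiffOn_target x₀)
    exact h.comp continuousOn_snd fun p hp => hp.2
  · simp only [D, deriv_const]
    exact continuousOn_const

theorem continuousOn_geodesicAcc (g : Metric n M) (x₀ : M) :
    ContinuousOn (fun z : V n × V n => geodesicAcc g x₀ z.1 z.2)
      ((extChartAt (𝓡∂ n) x₀).target ×ˢ univ) :=
  ((isC1Family_const g).contDiffOn_geodesicAcc x₀).continuousOn.comp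
    (f := fun z : V n × V n => ((0 : ℝ), z)) (by fun_prop)
    fun z hz => ⟨by constructor <;> norm_num, hz⟩

/-- The equality is stated in the tangent bundle because the velocities of the two curves live in
tangent spaces whose base points are only propositionally equal. -/
theorem velocityOn_congr {γ γ' : ℝ → M} {a b : ℝ} (h : EqOn γ γ' (Icc a b)) {t : ℝ}
    (ht : t ∈ Icc a b) : state (n := n) γ a b t = state γ' a b t := by
  have h1 : ∀ q : M, q = γ' t → ∀ L : ℝ →L[ℝ] V n,
      (⟨q, L (1 : ℝ)⟩ : TangentBundle (𝓡∂ n) M) = ⟨γ' t, L (1 : ℝ)⟩ := by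
    rintro q rfl L; rfl
  have h2 : mfderivWithin 𝓘(ℝ, ℝ) (𝓡∂ n) γ (Icc a b) t =
      mfderivWithin 𝓘(ℝ, ℝ) (𝓡∂ n) γ' (Icc a b) t := mfderivWithin_congr h (h ht)
  unfold state velocityOn
  rw [h2]
  exact h1 _ (h ht) _

theorem velocityOn_mono {γ : ℝ → M} {a b a' b' t : ℝ}
    (h : MDifferentiableWithinAt 𝓘(ℝ, ℝ) (𝓡∂ n) γ (Icc a b) t) (ha : a ≤ a') (hb : b' ≤ b)
    (hab : a' < b') (ht : t ∈ Icc a' b') : velocityOn (n := n) γ a' b' t = velocityOn γ a b t := by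
  have := mfderivWithin_subset (Icc_subset_Icc ha hb)
    (uniqueMDiffWithinAt_iff_uniqueDiffWithinAt.2 (uniqueDiffOn_Icc hab t ht)) h
  unfold velocityOn
  rw [this]

namespace IsArc

variable {g : Metric n M} {γ γ' : ℝ → M} {a b c : ℝ}

theorem mdifferentiableWithinAt (h : IsArc g γ a b) {t : ℝ} (ht : t ∈ Icc a b) :
    MDifferentiableWithinAt 𝓘(ℝ, ℝ) (𝓡∂ n) γ (Icc a b) t :=
  (h.contMDiffOn t ht).mdifferentiableWithinAt one_ne_zero

theorem state_mono (h : IsArc g γ a b) {a' b' t : ℝ} (ha : a ≤ a') (hb : b' ≤ b)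
    (hab : a' < b') (ht : t ∈ Icc a' b') : state (n := n) γ a' b' t = state γ a b t := by
  unfold state
  rw [velocityOn_mono (h.mdifferentiableWithinAt (Icc_subset_Icc ha hb ht)) ha hb hab ht]

theorem mono (h : IsArc g γ a b) {a' b' : ℝ} (ha : a ≤ a') (hb : b' ≤ b) (hab : a' < b') :
    IsArc g γ a' b' :=
  ⟨hab, h.contMDiffOn.mono (Icc_subset_Icc ha hb),
    fun r hr => h.mem_interior r (Ioo_subset_Ioo ha hb hr),
    fun r hr => h.geodesic r (Ioo_subset_Ioo ha hb hr)⟩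

end IsArc

theorem IsGeodesicAt.congr {g : Metric n M} {γ γ' : ℝ → M} {t : ℝ} (h : IsGeodesicAt g γ t)
    (hi : γ t ∈ (𝓡∂ n).interior M) (he : γ' =ᶠ[𝓝 t] γ) : IsGeodesicAt g γ' t := by
  have hs := mem_extChartAt_source (I := 𝓡∂ n) (γ t)
  rw [isGeodesicAt_iff g hs hi] at h
  have h0 := he.self_of_nhds
  have h1 : (fun r => extChartAt (𝓡∂ n) (γ t) (γ' r)) =ᶠ[𝓝 t]
      fun r => extChartAt (𝓡∂ n) (γ t) (γ r) := he.mono fun r hr => by simp only [hr]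
  rw [isGeodesicAt_iff (x₁ := γ t) g (by rwa [h0]) (by rwa [h0])]
  refine ⟨h.1.congr he.symm, h.2.1.congr_of_eventuallyEq h1, ?_⟩
  rw [h1.deriv.deriv_eq, h1.deriv_eq, h0]
  exact h.2.2

theorem IsArc.congr {g : Metric n M} {γ γ' : ℝ → M} {a b : ℝ} (h : IsArc g γ a b)
    (he : EqOn γ' γ (Icc a b)) : IsArc g γ' a b :=
  ⟨h.lt, h.contMDiffOn.congr he,
    fun r hr => by rw [he (Ioo_subset_Icc_self hr)]; exact h.mem_interior r hr,
    fun r hr => (h.geodesic r hr).congr (h.mem_interior r hr)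
      (eventually_of_mem (Ioo_mem_nhds hr.1 hr.2) fun x hx => he (Ioo_subset_Icc_self hx))⟩

/-- The differential equation bootstraps: its right side is continuous along the curve, so `u` is
`C¹` and the curve is `C²`, as `IsGeodesicAt` demands. -/
theorem isGeodesicAt_of_chart {g : Metric n M} {γ : ℝ → M} {t : ℝ} {x₀ : M} {u : ℝ → V n}
    (hs : γ t ∈ (extChartAt (𝓡∂ n) x₀).source) (hi : γ t ∈ (𝓡∂ n).interior M)
    (hc : ContinuousAt γ t)
    (h1 : ∀ᶠ r in 𝓝 t, HasDerivAt (fun r => extChartAt (𝓡∂ n) x₀ (γ r)) (u r) r)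
    (h2 : ∀ᶠ r in 𝓝 t, HasDerivAt u (geodesicAcc g x₀ (extChartAt (𝓡∂ n) x₀ (γ r)) (u r)) r) :
    IsGeodesicAt g γ t := by
  set c : ℝ → V n := fun r => extChartAt (𝓡∂ n) x₀ (γ r) with hcd
  rw [isGeodesicAt_iff g hs hi]
  have hsrc := hc.eventually_mem ((isOpen_extChartAt_source (I := 𝓡∂ n) x₀).mem_nhds hs)
  obtain ⟨O, hO, hOo, htO⟩ := eventually_nhds_iff.1 ((h1.and h2).and hsrc)
  have hd1 : ∀ r ∈ O, deriv c r = u r := fun r hr => (hO r hr).1.1.deriv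
  have he1 : deriv c =ᶠ[𝓝 t] u := eventually_of_mem (hOo.mem_nhds htO) hd1
  refine ⟨hc, ?_, ?_⟩
  · have hu : ContDiffOn ℝ 1 u O := by
      rw [show (1 : WithTop ℕ∞) = 0 + 1 by norm_num, contDiffOn_succ_iff_deriv_of_isOpen hOo]
      refine ⟨fun r hr => (hO r hr).1.2.differentiableAt.differentiableWithinAt, by simp, ?_⟩
      rw [contDiffOn_zero]
      have hcu : ContinuousOn (fun r => (c r, u r)) O := fun r hr =>
        ((hO r hr).1.1.continuousAt.prodMk (hO r hr).1.2.continuousAt).continuousWithinAt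
      exact ((continuousOn_geodesicAcc g x₀).comp hcu fun r hr =>
        ⟨(extChartAt (𝓡∂ n) x₀).map_source (hO r hr).2, mem_univ _⟩).congr
          fun r hr => (hO r hr).1.2.deriv
    have h3 : ContDiffOn ℝ 2 c O := by
      rw [show (2 : WithTop ℕ∞) = 1 + 1 by norm_num, contDiffOn_succ_iff_deriv_of_isOpen hOo]
      exact ⟨fun r hr => (hO r hr).1.1.differentiableAt.differentiableWithinAt, by simp,
        hu.congr hd1⟩
    exact h3.contDiffAt (hOo.mem_nhds htO)
  · rw [he1.deriv_eq, hd1 t htO]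
    exact (hO t htO).1.2.deriv

namespace IsArc

variable {g : Metric n M} {γ γ' : ℝ → M} {a b c : ℝ}

theorem eventually_mem_source (h : IsArc g γ a b) {t : ℝ} (ht : t ∈ Icc a b) {x₀ : M}
    (hs : γ t ∈ (extChartAt (𝓡∂ n) x₀).source) :
    ∀ᶠ r in 𝓝[Icc a b] t, γ r ∈ (extChartAt (𝓡∂ n) x₀).source :=
  (h.contMDiffOn t ht).continuousWithinAt.eventually_mem
    ((isOpen_extChartAt_source x₀).mem_nhds hs)

theorem hasDerivWithinAt_fst (h : IsArc g γ a b) {t : ℝ} (ht : t ∈ Icc a b) {x₀ : M}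
    (hs : γ t ∈ (extChartAt (𝓡∂ n) x₀).source) :
    HasDerivWithinAt (fun r => extChartAt (𝓡∂ n) x₀ (γ r))
      (chartState x₀ (state γ a b t)).2 (Icc a b) t :=
  hasDerivWithinAt_hat (h.mdifferentiableWithinAt ht) hs

theorem continuousWithinAt_chartState (h : IsArc g γ a b) {t : ℝ} (ht : t ∈ Icc a b) {x₀ : M}
    (hs : γ t ∈ (extChartAt (𝓡∂ n) x₀).source) :
    ContinuousWithinAt (fun r => chartState x₀ (state (n := n) γ a b r)) (Icc a b) t := by
  refine (h.hasDerivWithinAt_fst ht hs).continuousWithinAt.prodMk ?_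
  have hs' := hs
  rw [extChartAt_source] at hs'
  have : IsManifold (𝓡∂ n) 1 M := IsManifold.of_le (n := ∞) (by simp)
  have h1 := (contMDiffWithinAt_iff_contDiffWithinAt.1
    ((contMDiffWithinAt_iff_target_of_mem_source hs').1 (h.contMDiffOn t ht)).2)
  have h2 := (h1.fderivWithin_right (m := 0) (uniqueDiffOn_Icc h.lt) (by simp)
    ht).continuousWithinAt.clm_apply (continuousWithinAt_const (b := (1 : ℝ)))
  refine h2.congr_of_eventuallyEq ?_ ?_
  · filter_upwards [h.eventually_mem_source ht hs, self_mem_nhdsWithin] with r hr hr'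
    exact ((h.hasDerivWithinAt_fst hr' hr).derivWithin (uniqueDiffOn_Icc h.lt r hr')).symm
  · exact ((h.hasDerivWithinAt_fst ht hs).derivWithin (uniqueDiffOn_Icc h.lt t ht)).symm

theorem hasDerivAt_snd_of_mem_Ioo (h : IsArc g γ a b) {t : ℝ} (ht : t ∈ Ioo a b) {x₀ : M}
    (hs : γ t ∈ (extChartAt (𝓡∂ n) x₀).source) :
    HasDerivAt (fun r => (chartState x₀ (state γ a b r)).2)
      (geodesicAcc g x₀ (extChartAt (𝓡∂ n) x₀ (γ t)) (chartState x₀ (state γ a b t)).2) t := by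
  obtain ⟨-, h1, h2⟩ := (isGeodesicAt_iff g hs (h.mem_interior t ht)).1 (h.geodesic t ht)
  have hI := Icc_mem_nhds ht.1 ht.2
  have hd : ∀ r ∈ Ioo a b, γ r ∈ (extChartAt (𝓡∂ n) x₀).source →
      deriv (fun r => extChartAt (𝓡∂ n) x₀ (γ r)) r = (chartState x₀ (state γ a b r)).2 :=
    fun r hr hr' => ((h.hasDerivWithinAt_fst (Ioo_subset_Icc_self hr) hr').hasDerivAt
      (Icc_mem_nhds hr.1 hr.2)).deriv
  have he : (fun r => (chartState x₀ (state γ a b r)).2) =ᶠ[𝓝 t]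
      deriv fun r => extChartAt (𝓡∂ n) x₀ (γ r) := by
    have := h.eventually_mem_source (Ioo_subset_Icc_self ht) hs
    rw [nhdsWithin_eq_nhds.2 hI] at this
    filter_upwards [this, Ioo_mem_nhds ht.1 ht.2] with r hr hr'
    exact (hd r hr' hr).symm
  rw [← hd t ht hs, ← h2]
  refine HasDerivAt.congr_of_eventuallyEq ?_ he
  refine DifferentiableAt.hasDerivAt ?_
  have h3 := (h1.fderiv_right (m := 1) (by norm_num)).differentiableAt one_ne_zero
  exact h3.clm_apply (differentiableAt_const (1 : ℝ))

/-- At an end time the arc is only known to be `C¹`. The acceleration is continuous up to the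
boundary, so the derivative of the velocity has a limit there, and a continuous function whose
derivative has a limit is one-sidedly differentiable. -/
theorem hasDerivWithinAt_snd (h : IsArc g γ a b) {t : ℝ} (ht : t ∈ Icc a b) {x₀ : M}
    (hs : γ t ∈ (extChartAt (𝓡∂ n) x₀).source) :
    HasDerivWithinAt (fun r => (chartState x₀ (state γ a b r)).2)
      (geodesicAcc g x₀ (extChartAt (𝓡∂ n) x₀ (γ t)) (chartState x₀ (state γ a b t)).2)
      (Icc a b) t := by
  by_cases hi : t ∈ Ioo a b
  · exact (h.hasDerivAt_snd_of_mem_Ioo hi hs).hasDerivWithinAt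
  have hsrc := h.eventually_mem_source ht hs
  have hcont := h.continuousWithinAt_chartState ht hs
  have hlim : Tendsto (fun r => deriv (fun r => (chartState x₀ (state γ a b r)).2) r) (𝓝[Ioo a b] t)
      (𝓝 (geodesicAcc g x₀ (extChartAt (𝓡∂ n) x₀ (γ t)) (chartState x₀ (state γ a b t)).2)) := by
    have hA := (continuousOn_geodesicAcc g x₀ (chartState x₀ (state γ a b t))
      ⟨(extChartAt (𝓡∂ n) x₀).map_source hs, mem_univ _⟩).tendsto
    have h2 : Tendsto (fun r => chartState x₀ (state γ a b r)) (𝓝[Icc a b] t)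
        (𝓝[(extChartAt (𝓡∂ n) x₀).target ×ˢ univ] (chartState x₀ (state γ a b t))) :=
      tendsto_nhdsWithin_iff.2 ⟨hcont, hsrc.mono fun r hr =>
        ⟨(extChartAt (𝓡∂ n) x₀).map_source hr, mem_univ _⟩⟩
    refine ((hA.comp h2).mono_left (nhdsWithin_mono t Ioo_subset_Icc_self)).congr' ?_
    filter_upwards [nhdsWithin_mono t Ioo_subset_Icc_self hsrc, self_mem_nhdsWithin] with r hr hr'
    exact (h.hasDerivAt_snd_of_mem_Ioo hr' hr).deriv.symm
  obtain ⟨O, hO, hOo, htO⟩ := mem_nhdsWithin.1 hsrc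
  have hdiff : DifferentiableOn ℝ (fun r => (chartState x₀ (state γ a b r)).2) (Ioo a b ∩ O) :=
    fun r hr => (h.hasDerivAt_snd_of_mem_Ioo hr.1
      (htO ⟨hr.2, Ioo_subset_Icc_self hr.1⟩)).differentiableAt.differentiableWithinAt
  have hcw : ContinuousWithinAt (fun r => (chartState x₀ (state γ a b r)).2) (Ioo a b ∩ O) t :=
    hcont.snd.mono fun r hr => Ioo_subset_Icc_self hr.1
  rcases eq_or_lt_of_le ht.1 with hat | hat
  · subst hat
    have hI : 𝓝[>] a = 𝓝[Ioo a b] a := (nhdsWithin_Ioo_eq_nhdsGT h.lt).symm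
    refine (hasDerivWithinAt_Ici_of_tendsto_deriv hdiff hcw ?_ ?_).mono Icc_subset_Ici_self
    · rw [hI]; exact inter_mem self_mem_nhdsWithin (mem_nhdsWithin_of_mem_nhds (hO.mem_nhds hOo))
    · rw [hI]; exact hlim
  · have htb : t = b := le_antisymm ht.2 (not_lt.1 fun h' => hi ⟨hat, h'⟩)
    subst htb
    have hI : 𝓝[<] t = 𝓝[Ioo a t] t := (nhdsWithin_Ioo_eq_nhdsLT h.lt).symm
    refine (hasDerivWithinAt_Iic_of_tendsto_deriv hdiff hcw ?_ ?_).mono Icc_subset_Iic_self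
    · rw [hI]; exact inter_mem self_mem_nhdsWithin (mem_nhdsWithin_of_mem_nhds (hO.mem_nhds hOo))
    · rw [hI]; exact hlim

end IsArc

end Arcs

/-! ### Conservation of energy, gluing and uniqueness of geodesics. -/

section ArcUniqueness

open Set Filter

variable {n : ℕ} [NeZero n] {M : Type*} [TopologicalSpace M]
  [ChartedSpace (EuclideanHalfSpace n) M] [IsManifold (𝓡∂ n) ∞ M]

/-! ### Conservation of energy -/

theorem geodesicAcc_spec (g : Metric n M) {x₀ : M} {y : V n}
    (hy : y ∈ (extChartAt (𝓡∂ n) x₀).target) (v w : V n) :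
    coordMetric g x₀ y (geodesicAcc g x₀ y v) w =
      1 / 2 * metricDer g x₀ y w v v - metricDer g x₀ y v v w := by
  have h := (eq_acc_iff (fun v hv => coordMetric_pos g hy hv)).1
    (rfl : geodesicAcc g x₀ y v = acc (coordMetric g x₀ y) (metricDer g x₀ y) v) w
  rw [chr_apply] at h
  linarith

/-- The derivative of the inner product of the velocity of a geodesic with a vector field. -/
theorem hasDerivWithinAt_momentum (g : Metric n M) (x₀ : M) {c u W : ℝ → V n} {W' : V n}
    {S : Set ℝ} {t : ℝ} (hc : HasDerivWithinAt c (u t) S t)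
    (hu : HasDerivWithinAt u (geodesicAcc g x₀ (c t) (u t)) S t) (hW : HasDerivWithinAt W W' S t)
    (ht : c t ∈ (extChartAt (𝓡∂ n) x₀).target)
    (hm : ∀ᶠ r in 𝓝[S] t, c r ∈ (extChartAt (𝓡∂ n) x₀).target) :
    HasDerivWithinAt (fun r => coordMetric g x₀ (c r) (u r) (W r))
      (1 / 2 * metricDer g x₀ (c t) (W t) (u t) (u t) + coordMetric g x₀ (c t) (u t) W') S t := by
  have hG : HasFDerivWithinAt (coordMetric g x₀) (metricDer g x₀ (c t))
      (extChartAt (𝓡∂ n) x₀).target (c t) :=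
    ((contDiffOn_coordMetric g x₀).differentiableOn (by simp) _ ht).hasFDerivWithinAt
  -- The metric is differentiable only within the chart target, so the chain rule is applied on the
  -- times spent there, a neighbourhood of `t` within `S`.
  set S' := S ∩ c ⁻¹' (extChartAt (𝓡∂ n) x₀).target with hS'
  have hSS : S' ∈ 𝓝[S] t := Filter.Eventually.and (p := fun r => r ∈ S) self_mem_nhdsWithin hm
  have hsub : S' ⊆ S := inter_subset_left
  have hGc := hG.comp_hasDerivWithinAt t (hc.mono hsub) (fun r hr => hr.2)
  have h := hasDerivWithinAt_bilin (B := fun r => coordMetric g x₀ (c r)) hGc (hu.mono hsub)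
    (hW.mono hsub)
  refine (h.mono_of_mem_nhdsWithin hSS).congr_deriv ?_
  -- The geodesic equation replaces `∂_u g(u, W) + g(u̇, W)` by `½ ∂_W g(u, u)`.
  have hacc := geodesicAcc_spec g ht (u t) (W t)
  linarith

/-- The momentum identity with `W = u`: the two terms are `½ ∂_u g(u, u)` and its negative. -/
theorem hasDerivWithinAt_energy (g : Metric n M) (x₀ : M) {c u : ℝ → V n}
    {S : Set ℝ} {t : ℝ} (hc : HasDerivWithinAt c (u t) S t)
    (hu : HasDerivWithinAt u (geodesicAcc g x₀ (c t) (u t)) S t)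
    (ht : c t ∈ (extChartAt (𝓡∂ n) x₀).target)
    (hm : ∀ᶠ r in 𝓝[S] t, c r ∈ (extChartAt (𝓡∂ n) x₀).target) :
    HasDerivWithinAt (fun r => coordMetric g x₀ (c r) (u r) (u r)) 0 S t := by
  refine (hasDerivWithinAt_momentum g x₀ hc hu hu ht hm).congr_deriv ?_
  rw [coordMetric_symm, geodesicAcc_spec g ht]
  ring

/-- The squared length of a tangent vector. -/
def normSq (g : Metric n M) (p : TangentBundle (𝓡∂ n) M) : ℝ := g.inner p.proj p.snd p.snd

theorem normSq_eq (g : Metric n M) {x₀ : M} {p : TangentBundle (𝓡∂ n) M}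
    (hp : p.proj ∈ (extChartAt (𝓡∂ n) x₀).source) :
    normSq g p = coordMetric g x₀ (chartState x₀ p).1 (chartState x₀ p).2 (chartState x₀ p).2 :=
  inner_eq_coordMetric g hp _ _

theorem IsArc.normSq_const {g : Metric n M} {γ : ℝ → M} {a b : ℝ} (h : IsArc g γ a b) {t : ℝ}
    (ht : t ∈ Icc a b) : normSq g (state γ a b t) = normSq g (state γ a b a) := by
  have key : ∀ t ∈ Icc a b,
      HasDerivWithinAt (fun r => normSq g (state γ a b r)) 0 (Icc a b) t := by
    intro t ht
    have hs := mem_extChartAt_source (I := 𝓡∂ n) (γ t)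
    have h1 := h.hasDerivWithinAt_fst ht hs
    have h2 := h.hasDerivWithinAt_snd ht hs
    have hsrc := h.eventually_mem_source ht hs
    have h3 := hasDerivWithinAt_energy g (γ t)
      (c := fun r => extChartAt (𝓡∂ n) (γ t) (γ r))
      (u := fun r => (chartState (γ t) (state γ a b r)).2) h1 h2
      ((extChartAt (𝓡∂ n) (γ t)).map_source hs)
      (hsrc.mono fun r hr => (extChartAt (𝓡∂ n) (γ t)).map_source hr)
    exact h3.congr_of_eventuallyEq (hsrc.mono fun r hr => normSq_eq g hr) (normSq_eq g hs)
  exact constant_of_derivWithin_zero (fun t ht => (key t ht).differentiableWithinAt)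
    (fun t ht => (key t (Ico_subset_Icc_self ht)).derivWithin
      (uniqueDiffOn_Icc h.lt t (Ico_subset_Icc_self ht))) t ht

/-! ### Arcs in coordinates -/

theorem isArc_of_chart {g : Metric n M} {x₀ : M} {c u : ℝ → V n} {a b : ℝ} (hab : a < b)
    (hc : ∀ t ∈ Icc a b, HasDerivWithinAt c (u t) (Icc a b) t)
    (hu : ∀ t ∈ Icc a b, HasDerivWithinAt u (geodesicAcc g x₀ (c t) (u t)) (Icc a b) t)
    (ht : ∀ t ∈ Icc a b, c t ∈ (extChartAt (𝓡∂ n) x₀).target) (hi : ∀ t ∈ Ioo a b, 0 < c t 0) :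
    IsArc g (fun t => (extChartAt (𝓡∂ n) x₀).symm (c t)) a b ∧
      ∀ t ∈ Icc a b, state (n := n) (fun t => (extChartAt (𝓡∂ n) x₀).symm (c t)) a b t =
        ofChartState x₀ (c t, u t) := by
  set γ : ℝ → M := fun t => (extChartAt (𝓡∂ n) x₀).symm (c t) with hγ
  have hud := uniqueDiffOn_Icc hab
  have hsrc : ∀ t ∈ Icc a b, γ t ∈ (extChartAt (𝓡∂ n) x₀).source := fun t h =>
    (extChartAt (𝓡∂ n) x₀).map_target (ht t h)
  have hφ : ∀ t ∈ Icc a b, extChartAt (𝓡∂ n) x₀ (γ t) = c t := fun t h =>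
    (extChartAt (𝓡∂ n) x₀).right_inv (ht t h)
  have hC1 : ContDiffOn ℝ 1 c (Icc a b) := by
    rw [show (1 : WithTop ℕ∞) = 0 + 1 by norm_num, contDiffOn_succ_iff_derivWithin hud]
    refine ⟨fun r hr => (hc r hr).differentiableWithinAt, by simp, ?_⟩
    rw [contDiffOn_zero]
    exact ContinuousOn.congr (fun r hr => (hu r hr).continuousWithinAt)
      fun r hr => (hc r hr).derivWithin (hud r hr)
  have hγ1 : ContMDiffOn 𝓘(ℝ, ℝ) (𝓡∂ n) 1 γ (Icc a b) :=
    ((contMDiffOn_extChartAt_symm (n := ∞) x₀).of_le (by simp)).comp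
      (contMDiffOn_iff_contDiffOn.2 hC1) ht
  have hint : ∀ t ∈ Ioo a b, γ t ∈ (𝓡∂ n).interior M := fun t h => by
    have h' := Ioo_subset_Icc_self h
    rw [mem_interior_iff_coord (hsrc t h'), hφ t h']
    exact hi t h
  refine ⟨⟨hab, hγ1, hint, fun t h => ?_⟩, fun t h => ?_⟩
  · have hI := Ioo_mem_nhds h.1 h.2
    refine isGeodesicAt_of_chart (u := u) (hsrc t (Ioo_subset_Icc_self h)) (hint t h)
      ((hγ1.continuousOn).continuousAt (Icc_mem_nhds h.1 h.2)) ?_ ?_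
    · filter_upwards [hI] with r hr
      have hr' := Ioo_subset_Icc_self hr
      exact ((hc r hr').congr hφ (hφ r hr')).hasDerivAt (Icc_mem_nhds hr.1 hr.2)
    · filter_upwards [hI] with r hr
      have hr' := Ioo_subset_Icc_self hr
      rw [hφ r hr']
      exact (hu r hr').hasDerivAt (Icc_mem_nhds hr.1 hr.2)
  · have hmem : (state (n := n) γ a b t).proj ∈ (extChartAt (𝓡∂ n) x₀).source := hsrc t h
    refine chartState_injOn hmem (hsrc t h) ?_
    rw [chartState_ofChartState (ht t h)]
    refine Prod.ext (hφ t h) ?_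
    exact (hat_mfderivWithin (hγ1.continuousOn t h) (hsrc t h)
      ((hc t h).congr hφ (hφ t h)) (hud t h)).2

theorem hasDerivAt_of_Icc_union {F : Type*} [NormedAddCommGroup F] [NormedSpace ℝ F] {f : ℝ → F}
    {f' : F} {a b c r : ℝ} (hr : r ∈ Ioo a c) (h₁ : r ≤ b → HasDerivWithinAt f f' (Icc a b) r)
    (h₂ : b ≤ r → HasDerivWithinAt f f' (Icc b c) r) : HasDerivAt f f' r := by
  rcases lt_trichotomy r b with h | h | h
  · exact (h₁ h.le).hasDerivAt (Icc_mem_nhds hr.1 h)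
  · have := (h₁ h.le).union (h₂ h.ge)
    rw [Icc_union_Icc_eq_Icc (h ▸ hr.1.le) (h ▸ hr.2.le)] at this
    exact this.hasDerivAt (Icc_mem_nhds hr.1 hr.2)
  · exact (h₂ h.le).hasDerivAt (Icc_mem_nhds h hr.2)

/-- The acceleration is a function of the state. Equal states at `b` therefore give equal one-sided
accelerations, and the joined curve solves the geodesic equation at `b` as well. -/
theorem IsArc.union {g : Metric n M} {γ : ℝ → M} {a b c : ℝ} (h₁ : IsArc g γ a b)
    (h₂ : IsArc g γ b c) (hst : state (n := n) γ a b b = state γ b c b) (hi : γ b ∈ (𝓡∂ n).interior M) :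
    IsArc g γ a c := by
  have hab := h₁.lt
  have hbc := h₂.lt
  have hba : b ∈ Icc a b := right_mem_Icc.2 hab.le
  have hbc' : b ∈ Icc b c := left_mem_Icc.2 hbc.le
  have hcont : ContinuousAt γ b := by
    have := (h₁.contMDiffOn b hba).continuousWithinAt.union (h₂.contMDiffOn b hbc').continuousWithinAt
    rw [Icc_union_Icc_eq_Icc hab.le hbc.le] at this
    exact this.continuousAt (Icc_mem_nhds hab hbc)
  have hs := mem_extChartAt_source (I := 𝓡∂ n) (γ b)
  have hgeo : IsGeodesicAt g γ b := by
    set u : ℝ → V n := fun r => if r ≤ b then (chartState (γ b) (state γ a b r)).2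
      else (chartState (γ b) (state γ b c r)).2 with hu
    have hu1 : ∀ r ∈ Icc a b, u r = (chartState (γ b) (state γ a b r)).2 := fun r hr => if_pos hr.2
    have hu2 : ∀ r ∈ Icc b c, u r = (chartState (γ b) (state γ b c r)).2 := fun r hr => by
      rcases eq_or_lt_of_le hr.1 with h | h
      · subst h; rw [hu1 b hba, hst]
      · exact if_neg (not_le.2 h)
    have hsrc := hcont.eventually_mem ((isOpen_extChartAt_source (I := 𝓡∂ n) (γ b)).mem_nhds hs)
    refine isGeodesicAt_of_chart (u := u) hs hi hcont ?_ ?_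
    · filter_upwards [hsrc, Ioo_mem_nhds hab hbc] with r hr hr'
      refine hasDerivAt_of_Icc_union (b := b) hr' (fun h => ?_) fun h => ?_
      · rw [hu1 r ⟨hr'.1.le, h⟩]; exact h₁.hasDerivWithinAt_fst ⟨hr'.1.le, h⟩ hr
      · rw [hu2 r ⟨h, hr'.2.le⟩]; exact h₂.hasDerivWithinAt_fst ⟨h, hr'.2.le⟩ hr
    · filter_upwards [hsrc, Ioo_mem_nhds hab hbc] with r hr hr'
      refine hasDerivAt_of_Icc_union (b := b) hr' (fun h => ?_) fun h => ?_
      · rw [hu1 r ⟨hr'.1.le, h⟩]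
        exact (h₁.hasDerivWithinAt_snd ⟨hr'.1.le, h⟩ hr).congr hu1 (hu1 r ⟨hr'.1.le, h⟩)
      · rw [hu2 r ⟨h, hr'.2.le⟩]
        exact (h₂.hasDerivWithinAt_snd ⟨h, hr'.2.le⟩ hr).congr hu2 (hu2 r ⟨h, hr'.2.le⟩)
  refine ⟨hab.trans hbc, fun r hr => ?_, fun r hr => ?_, fun r hr => ?_⟩
  · rcases lt_trichotomy r b with h | h | h
    · refine (h₁.contMDiffOn r ⟨hr.1, h.le⟩).mono_of_mem_nhdsWithin ?_
      refine mem_nhdsWithin.2 ⟨Iio b, isOpen_Iio, h, fun x hx => ⟨hx.2.1, le_of_lt hx.1⟩⟩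
    · subst h
      exact (hgeo.1.of_le one_le_two).contMDiffWithinAt
    · refine (h₂.contMDiffOn r ⟨h.le, hr.2⟩).mono_of_mem_nhdsWithin ?_
      refine mem_nhdsWithin.2 ⟨Ioi b, isOpen_Ioi, h, fun x hx => ⟨le_of_lt hx.1, hx.2.2⟩⟩
  · rcases lt_trichotomy r b with h | h | h
    · exact h₁.mem_interior r ⟨hr.1, h⟩
    · exact h ▸ hi
    · exact h₂.mem_interior r ⟨h, hr.2⟩
  · rcases lt_trichotomy r b with h | h | h
    · exact h₁.geodesic r ⟨hr.1, h⟩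
    · exact h ▸ hgeo
    · exact h₂.geodesic r ⟨h, hr.2⟩

/-- Two curves which agree at `b`, joined there. -/
def joinAt (b : ℝ) (γ γ' : ℝ → M) (r : ℝ) : M := if r ≤ b then γ r else γ' r

theorem joinAt_left {b : ℝ} (γ γ' : ℝ → M) {r : ℝ} (h : r ≤ b) : joinAt b γ γ' r = γ r := if_pos h

theorem joinAt_right {b : ℝ} {γ γ' : ℝ → M} (hb : γ b = γ' b) {r : ℝ} (h : b ≤ r) :
    joinAt b γ γ' r = γ' r := by
  rcases eq_or_lt_of_le h with rfl | h
  · exact (joinAt_left γ γ' le_rfl).trans hb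
  · exact if_neg (not_le.2 h)

theorem state_fst {γ γ' : ℝ → M} {a b a' b' t t' : ℝ}
    (h : state (n := n) γ a b t = state γ' a' b' t') : γ t = γ' t' :=
  congrArg Bundle.TotalSpace.proj h

theorem IsArc.joinAt {g : Metric n M} {γ γ' : ℝ → M} {a b c : ℝ} (h₁ : IsArc g γ a b)
    (h₂ : IsArc g γ' b c) (hst : state (n := n) γ a b b = state γ' b c b)
    (hi : γ b ∈ (𝓡∂ n).interior M) :
    IsArc g (joinAt b γ γ') a c ∧ state (n := n) (BrokenRay.joinAt b γ γ') a c a = state γ a b a ∧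
      state (n := n) (BrokenRay.joinAt b γ γ') a c c = state γ' b c c := by
  have hb : γ b = γ' b := state_fst hst
  have e1 : EqOn (BrokenRay.joinAt b γ γ') γ (Icc a b) := fun r hr => joinAt_left γ γ' hr.2
  have e2 : EqOn (BrokenRay.joinAt b γ γ') γ' (Icc b c) := fun r hr => joinAt_right hb hr.1
  have hb1 : b ∈ Icc a b := right_mem_Icc.2 h₁.lt.le
  have hb2 : b ∈ Icc b c := left_mem_Icc.2 h₂.lt.le
  have h := (h₁.congr e1).union (h₂.congr e2)
    (by rw [velocityOn_congr e1 hb1, velocityOn_congr e2 hb2, hst]) (by rwa [e1 hb1])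
  refine ⟨h, ?_, ?_⟩
  · rw [← velocityOn_congr e1 (left_mem_Icc.2 h₁.lt.le)]
    exact (h.state_mono le_rfl h₂.lt.le h₁.lt (left_mem_Icc.2 h₁.lt.le)).symm
  · rw [← velocityOn_congr e2 (right_mem_Icc.2 h₂.lt.le)]
    exact (h.state_mono h₁.lt.le le_rfl h₂.lt (right_mem_Icc.2 h₂.lt.le)).symm

/-! ### Uniqueness of geodesics -/

/-- The extended geodesic vector field is `C¹`, hence Lipschitz, near the common state even if `γ r`
is a boundary point; uniqueness of solutions to the right applies. -/
theorem IsArc.state_eq_nhdsGT {g : Metric n M} {γ γ' : ℝ → M} {a b : ℝ} (h : IsArc g γ a b)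
    (h' : IsArc g γ' a b) {r : ℝ} (hr : r ∈ Ico a b) (hst : state (n := n) γ a b r = state γ' a b r) :
    ∀ᶠ t in 𝓝[>] r, state (n := n) γ a b t = state γ' a b t := by
  set x₀ := γ r with hx₀
  have hr' : r ∈ Icc a b := Ico_subset_Icc_self hr
  have hs : γ r ∈ (extChartAt (𝓡∂ n) x₀).source := mem_extChartAt_source _
  have hs' : γ' r ∈ (extChartAt (𝓡∂ n) x₀).source := by rw [← state_fst hst]; exact hs
  set z := chartState x₀ (state (n := n) γ a b r) with hz
  have hz' : z = chartState x₀ (state (n := n) γ' a b r) := by rw [hz, hst]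
  have hzt : z.1 ∈ (extChartAt (𝓡∂ n) x₀).target := (extChartAt (𝓡∂ n) x₀).map_source hs
  obtain ⟨A, hA, hA'⟩ := (isC1Family_const g).exists_acc_extension x₀ (s₀ := 0)
    ⟨by norm_num, by norm_num⟩ hzt z.2
  have hX : ContDiffAt ℝ 1 (fun y : V n × V n => (y.2, A (0, y))) z :=
    contDiff_snd.contDiffAt.prodMk (hA.comp z (contDiffAt_const.prodMk contDiffAt_id))
  obtain ⟨K, O, hO, hK⟩ := hX.exists_lipschitzOnWith
  have key : ∀ {γ : ℝ → M}, IsArc g γ a b → γ r ∈ (extChartAt (𝓡∂ n) x₀).source →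
      z = chartState x₀ (state (n := n) γ a b r) → ∃ d > r, d < b ∧ ∀ t ∈ Icc r d,
        γ t ∈ (extChartAt (𝓡∂ n) x₀).source ∧ chartState x₀ (state (n := n) γ a b t) ∈ O ∧
        HasDerivWithinAt (fun t => chartState x₀ (state (n := n) γ a b t))
          ((chartState x₀ (state (n := n) γ a b t)).2, A (0, chartState x₀ (state (n := n) γ a b t))) (Ici t) t ∧
        ContinuousWithinAt (fun t => chartState x₀ (state (n := n) γ a b t)) (Icc a b) t := by
    intro γ h hs hz
    have h1 := h.eventually_mem_source hr' hs
    have h2 := (h.continuousWithinAt_chartState hr' hs).eventually (p := (· ∈ O)) (by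
      change O ∈ 𝓝 (chartState x₀ (state (n := n) γ a b r)); rwa [← hz])
    obtain ⟨ρ, hρ, hρ'⟩ := Metric.mem_nhdsWithin_iff.1 (Filter.Eventually.and h1 h2)
    set d := min (r + ρ / 2) ((r + b) / 2) with hd
    have hdr : r < d := lt_min (by linarith) (by linarith [hr.2])
    have hdb : d < b := lt_of_le_of_lt (min_le_right _ _) (by linarith [hr.2])
    refine ⟨d, hdr, hdb, fun t ht => ?_⟩
    have htI : t ∈ Icc a b := ⟨hr.1.trans ht.1, ht.2.trans hdb.le⟩
    have hm := hρ' ⟨by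
      rw [Metric.mem_ball, Real.dist_eq, abs_of_nonneg (by linarith [ht.1])]
      linarith [ht.2, min_le_left (r + ρ / 2) ((r + b) / 2)], htI⟩
    refine ⟨hm.1, hm.2, ?_, h.continuousWithinAt_chartState htI hm.1⟩
    have hI : Icc a b ∈ 𝓝[Ici t] t :=
      mem_nhdsWithin.2 ⟨Iio b, isOpen_Iio, ht.2.trans_lt hdb, fun x hx => ⟨htI.1.trans hx.2, le_of_lt hx.1⟩⟩
    have hd := ((h.hasDerivWithinAt_fst htI hm.1).prodMk
      (h.hasDerivWithinAt_snd htI hm.1)).mono_of_mem_nhdsWithin hI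
    refine hd.congr_deriv ?_
    rw [show A (0, chartState x₀ (state (n := n) γ a b t)) = _ from hA' 0 _ _ (chart_coord_nonneg hm.1)]
    rfl
  obtain ⟨d, hdr, hdb, hd⟩ := key h hs hz
  obtain ⟨d', hdr', hdb', hd'⟩ := key h' hs' hz'
  have hmin : r < min d d' := lt_min hdr hdr'
  have hsub : Icc r (min d d') ⊆ Icc r d := Icc_subset_Icc_right (min_le_left _ _)
  have hsub' : Icc r (min d d') ⊆ Icc r d' := Icc_subset_Icc_right (min_le_right _ _)
  have hsubI : Icc r (min d d') ⊆ Icc a b := Icc_subset_Icc hr.1 ((min_le_left _ _).trans hdb.le)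
  have heq := ODE_solution_unique_of_mem_Icc_right (v := fun _ (y : V n × V n) => (y.2, A (0, y)))
    (s := fun _ => O) (K := K) (f := fun t => chartState x₀ (state (n := n) γ a b t))
    (g := fun t => chartState x₀ (state (n := n) γ' a b t)) (a := r) (b := min d d')
    (fun t _ => hK) (fun t ht => (hd t (hsub ht)).2.2.2.mono hsubI)
    (fun t ht => (hd t (hsub (Ico_subset_Icc_self ht))).2.2.1)
    (fun t ht => (hd t (hsub (Ico_subset_Icc_self ht))).2.1)
    (fun t ht => (hd' t (hsub' ht)).2.2.2.mono hsubI)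
    (fun t ht => (hd' t (hsub' (Ico_subset_Icc_self ht))).2.2.1)
    (fun t ht => (hd' t (hsub' (Ico_subset_Icc_self ht))).2.1) (by rw [← hz, ← hz'])
  filter_upwards [Ioo_mem_nhdsGT hmin] with t ht
  have ht' := Ioo_subset_Icc_self ht
  exact chartState_injOn (hd t (hsub ht')).1 (hd' t (hsub' ht')).1 (heq ht')

/-- Continuous induction: the set of times with equal states is open to the right by local
uniqueness and closed by continuity. The Hausdorff property makes the limits of the base points
agree. -/
theorem IsArc.state_eq [T2Space M] {g : Metric n M} {γ γ' : ℝ → M} {a b : ℝ} (h : IsArc g γ a b)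
    (h' : IsArc g γ' a b) (h0 : state (n := n) γ a b a = state γ' a b a) {t : ℝ} (ht : t ∈ Icc a b) :
    state (n := n) γ a b t = state γ' a b t := by
  set S : Set ℝ := {t | state (n := n) γ a b t = state γ' a b t} with hS
  refine IsClosed.Icc_subset_of_forall_mem_nhdsWithin (s := S) ?_ h0
    (fun x hx => h.state_eq_nhdsGT h' hx.2 hx.1) ht
  refine isClosed_of_closure_subset fun r hr => ?_
  have hrI : r ∈ Icc a b := closure_minimal inter_subset_right isClosed_Icc hr
  refine ⟨?_, hrI⟩
  have : (𝓝[S ∩ Icc a b] r).NeBot := mem_closure_iff_nhdsWithin_neBot.1 hr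
  have hsub : S ∩ Icc a b ⊆ Icc a b := inter_subset_right
  have hc : γ r = γ' r := by
    refine tendsto_nhds_unique_of_eventuallyEq (l := 𝓝[S ∩ Icc a b] r)
      ((h.contMDiffOn r hrI).continuousWithinAt.mono hsub)
      ((h'.contMDiffOn r hrI).continuousWithinAt.mono hsub) ?_
    filter_upwards [self_mem_nhdsWithin] with x hx
    exact state_fst hx.1
  have hs : γ r ∈ (extChartAt (𝓡∂ n) (γ r)).source := mem_extChartAt_source _
  have hs' : γ' r ∈ (extChartAt (𝓡∂ n) (γ r)).source := by rw [← hc]; exact hs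
  refine chartState_injOn (x₀ := γ r) hs hs' ?_
  refine tendsto_nhds_unique_of_eventuallyEq (l := 𝓝[S ∩ Icc a b] r)
    ((h.continuousWithinAt_chartState hrI hs).mono hsub)
    ((h'.continuousWithinAt_chartState hrI hs').mono hsub) ?_
  filter_upwards [self_mem_nhdsWithin] with x hx
  exact congrArg _ hx.1

end ArcUniqueness

/-! ### The momentum identity along the geodesic flow in one chart. -/

section Momentum

open Set Filter

variable {n : ℕ} [NeZero n] {M : Type*} [TopologicalSpace M]
  [ChartedSpace (EuclideanHalfSpace n) M] [IsManifold (𝓡∂ n) ∞ M]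

/-! ### The derivative of the metric with respect to the parameter -/

/-- The components of `d/ds g_s |_{s = 0}` in the chart at `x₀`. -/
def metricDot (g : ℝ → Metric n M) (x₀ : M) (y : V n) : V n →L[ℝ] V n →L[ℝ] ℝ :=
  deriv (fun s => coordMetric (g s) x₀ y) 0

variable {ε : ℝ} {g : ℝ → Metric n M}

theorem IsC1Family.hasFDerivWithinAt_coordMetric (hg : IsC1Family ε g) (hε : 0 < ε) {x₀ : M}
    {y : V n} (hy : y ∈ (extChartAt (𝓡∂ n) x₀).target) :
    HasFDerivWithinAt (fun p : ℝ × V n => coordMetric (g p.1) x₀ p.2)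
      ((ContinuousLinearMap.toSpanSingleton ℝ (metricDot g x₀ y)).comp
        (ContinuousLinearMap.fst ℝ ℝ (V n)) +
        (metricDer (g 0) x₀ y).comp (ContinuousLinearMap.snd ℝ ℝ (V n)))
      (Ioo (-ε) ε ×ˢ (extChartAt (𝓡∂ n) x₀).target) (0, y) := by
  have h0 : (0 : ℝ) ∈ Ioo (-ε) ε := ⟨by linarith, hε⟩
  have h := ((hg.contDiffOn_coordMetric x₀).differentiableOn one_ne_zero (0, y)
    ⟨h0, hy⟩).hasFDerivWithinAt
  set L := fderivWithin ℝ (fun p : ℝ × V n => coordMetric (g p.1) x₀ p.2)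
    (Ioo (-ε) ε ×ˢ (extChartAt (𝓡∂ n) x₀).target) (0, y) with hL
  have h1 : HasDerivAt (fun s => coordMetric (g s) x₀ y) (L (1, 0)) 0 := by
    have h2 : HasDerivAt (fun s : ℝ => (s, y)) (1, 0) 0 :=
      (hasDerivAt_id (0 : ℝ)).prodMk (hasDerivAt_const (0 : ℝ) y)
    exact h.comp_hasDerivAt 0 h2 (by
      filter_upwards [Ioo_mem_nhds h0.1 h0.2] with s hs using ⟨hs, hy⟩)
  have h3 : metricDer (g 0) x₀ y = L.comp (ContinuousLinearMap.inr ℝ ℝ (V n)) := by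
    refine HasFDerivWithinAt.fderivWithin ?_ (uniqueDiffOn_target x₀ y hy)
    exact h.comp y (hasFDerivAt_prodMk_right (0 : ℝ) y).hasFDerivWithinAt fun z hz => ⟨h0, hz⟩
  refine h.congr_fderiv (ContinuousLinearMap.ext fun p => ?_)
  have hp : p = p.1 • ((1 : ℝ), (0 : V n)) + (0, p.2) := by ext <;> simp
  rw [h3, metricDot, h1.deriv]
  conv_lhs => rw [hp, map_add, map_smul]
  rfl

theorem IsC1Family.hasDerivAt_coordMetric (hg : IsC1Family ε g) (hε : 0 < ε) {x₀ : M}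
    {y : V n} (hy : y ∈ (extChartAt (𝓡∂ n) x₀).target) :
    HasDerivAt (fun s => coordMetric (g s) x₀ y) (metricDot g x₀ y) 0 := by
  have h2 : HasDerivAt (fun s : ℝ => (s, y)) (1, 0) 0 :=
    (hasDerivAt_id (0 : ℝ)).prodMk (hasDerivAt_const (0 : ℝ) y)
  refine ((hg.hasFDerivWithinAt_coordMetric hε hy).comp_hasDerivAt 0 h2 (by
      filter_upwards [Ioo_mem_nhds (show -ε < 0 by linarith) hε] with s hs
      exact ⟨hs, hy⟩)).congr_deriv ?_
  simp

theorem IsC1Family.continuousOn_metricDot (hg : IsC1Family ε g) (hε : 0 < ε) (x₀ : M) :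
    ContinuousOn (metricDot g x₀) (extChartAt (𝓡∂ n) x₀).target := by
  have h0 : (0 : ℝ) ∈ Ioo (-ε) ε := ⟨by linarith, hε⟩
  have hud := isOpen_Ioo.uniqueDiffOn.prod (s := Ioo (-ε) ε) (uniqueDiffOn_target (n := n) x₀)
  have h := (hg.contDiffOn_coordMetric x₀).continuousOn_fderivWithin hud le_rfl
  have h1 := (h.clm_apply (continuousOn_const (c := ((1 : ℝ), (0 : V n))))).comp
    (f := fun y : V n => ((0 : ℝ), y)) (by fun_prop) fun y hy => ⟨h0, hy⟩
  refine h1.congr fun y hy => ?_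
  have := (hg.hasFDerivWithinAt_coordMetric hε hy).fderivWithin (hud (0, y) ⟨h0, hy⟩)
  change _ = fderivWithin ℝ _ _ (0, y) (1, 0)
  rw [this]
  simp

theorem IsC1Family.metricDeriv_eq (hg : IsC1Family ε g) (hε : 0 < ε) {x₀ p : M}
    (hp : p ∈ (extChartAt (𝓡∂ n) x₀).source) (v w : TangentSpace (𝓡∂ n) p) :
    metricDeriv g p v w = metricDot g x₀ (extChartAt (𝓡∂ n) x₀ p) (hat x₀ p v) (hat x₀ p w) := by
  have h := hg.hasDerivAt_coordMetric hε ((extChartAt (𝓡∂ n) x₀).map_source hp)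
  have h1 := (h.clm_apply (hasDerivAt_const (0 : ℝ) (hat x₀ p v))).clm_apply
    (hasDerivAt_const (0 : ℝ) (hat x₀ p w))
  simp only [map_zero, add_zero] at h1
  rw [metricDeriv, ← h1.deriv]
  exact congrArg (fun F : ℝ → ℝ => deriv F 0) (funext fun s => inner_eq_coordMetric (g s) hp v w)

/-- `d/ds` at `s = 0` of the energy of a family of tangent vectors. -/
theorem IsC1Family.hasDerivAt_energy (hg : IsC1Family ε g) (hε : 0 < ε) {x₀ : M}
    {c u : ℝ → V n} {w w' : V n} (hc : HasDerivAt c w 0) (hu : HasDerivAt u w' 0)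
    (hm : ∀ᶠ s in 𝓝 0, c s ∈ (extChartAt (𝓡∂ n) x₀).target) :
    HasDerivAt (fun s => coordMetric (g s) x₀ (c s) (u s) (u s))
      (metricDot g x₀ (c 0) (u 0) (u 0) + metricDer (g 0) x₀ (c 0) w (u 0) (u 0) +
        2 * coordMetric (g 0) x₀ (c 0) (u 0) w') 0 := by
  have hh := hg.hasFDerivWithinAt_coordMetric hε hm.self_of_nhds
  have h1 := hh.comp_hasDerivAt_of_eq (f := fun s => (s, c s)) 0 ((hasDerivAt_id (0 : ℝ)).prodMk hc)
    (by filter_upwards [Ioo_mem_nhds (show -ε < 0 by linarith) hε, hm] with s hs hs'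
        exact ⟨hs, hs'⟩) rfl
  have h2 := hasDerivWithinAt_bilin (B := fun s => coordMetric (g s) x₀ (c s))
    (hasDerivWithinAt_univ.2 h1) (hasDerivWithinAt_univ.2 hu) (hasDerivWithinAt_univ.2 hu)
  refine (hasDerivWithinAt_univ.1 h2).congr_deriv ?_
  rw [coordMetric_symm (g 0) x₀ (c 0) w' (u 0)]
  simp only [add_apply, ContinuousLinearMap.comp_apply, ContinuousLinearMap.coe_fst',
    ContinuousLinearMap.coe_snd', ContinuousLinearMap.toSpanSingleton_apply, one_smul]
  ring

/-! ### Families of unit vectors -/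

/-- A family of unit vectors for the metrics `g s` which is differentiable at `s = 0`. -/
structure IsUnitFamily (g : ℝ → Metric n M) (σ : ℝ → TangentBundle (𝓡∂ n) M) : Prop where
  mdifferentiableAt : MDifferentiableAt 𝓘(ℝ, ℝ) (𝓡∂ n).tangent σ 0
  unit : ∀ᶠ s in 𝓝 0, normSq (g s) (σ s) = 1

/-- The inner product of the vector `σ 0` with the velocity of the base point of `σ s`. -/
def momentum (g : Metric n M) (σ : ℝ → TangentBundle (𝓡∂ n) M) : ℝ :=
  g.inner (σ 0).proj (σ 0).snd (velocity (fun s => (σ s).proj) 0)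

theorem hat_velocity {q : ℝ → M} {t : ℝ} {x₀ : M} (hq : MDifferentiableAt 𝓘(ℝ, ℝ) (𝓡∂ n) q t)
    (h : q t ∈ (extChartAt (𝓡∂ n) x₀).source) :
    HasDerivAt (fun s => extChartAt (𝓡∂ n) x₀ (q s)) (hat x₀ (q t) (velocity q t)) t := by
  have h1 := hasDerivWithinAt_hat (x₀ := x₀) (mdifferentiableWithinAt_univ.2 hq) h
  rw [mfderivWithin_univ, hasDerivWithinAt_univ] at h1
  exact h1

theorem mdifferentiableAt_proj {σ : ℝ → TangentBundle (𝓡∂ n) M} {s : ℝ}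
    (h : MDifferentiableAt 𝓘(ℝ, ℝ) (𝓡∂ n).tangent σ s) :
    MDifferentiableAt 𝓘(ℝ, ℝ) (𝓡∂ n) (fun s => (σ s).proj) s := by
  have hs := mem_extChartAt_source (I := 𝓡∂ n) (σ s).proj
  obtain ⟨h1, h2⟩ := (mdifferentiableAt_iff_chartState hs).1 h
  rw [extChartAt_source] at hs
  have : IsManifold (𝓡∂ n) 1 M := IsManifold.of_le (n := ∞) (by simp)
  rw [mdifferentiableAt_iff_target_of_mem_source (f := fun s => (σ s).proj)
    (y := (σ s).proj) hs]
  exact ⟨h1, h2.fst.mdifferentiableAt⟩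

theorem momentum_eq {g : Metric n M} {σ : ℝ → TangentBundle (𝓡∂ n) M} {x₀ : M}
    (hs : (σ 0).proj ∈ (extChartAt (𝓡∂ n) x₀).source)
    (h : MDifferentiableAt 𝓘(ℝ, ℝ) (𝓡∂ n).tangent σ 0) {w : V n}
    (hw : HasDerivAt (fun s => (chartState x₀ (σ s)).1) w 0) :
    momentum g σ = coordMetric g x₀ (chartState x₀ (σ 0)).1 (chartState x₀ (σ 0)).2 w := by
  have h1 := hat_velocity (mdifferentiableAt_proj h) hs
  rw [momentum, inner_eq_coordMetric g hs, hw.unique h1]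
  rfl

/-! ### The derivative of the momentum along the geodesic flow -/

/-- Differentiating the constant energy in `s` expresses the time derivative of the momentum as `-½
metricDot`, which is then integrated. The half-space condition on nearby trajectories is required
only up to times `t < T`, because the end times `τ s` may fall short of `T`. -/
theorem IsGeodesicFlow.integral_metricDot (hg : IsC1Family ε g) (hε : 0 < ε) {x₀ : M}
    {η : ℝ} {N O : Set (ℝ × (V n × V n))} {a : ℝ × (V n × V n) → V n}
    {C U : ℝ × (V n × V n) → ℝ → V n} (hF : IsGeodesicFlow g x₀ η N O a C U)
    {z : ℝ → V n × V n} (hzN : (0, z 0) ∈ N) (hz : DifferentiableAt ℝ z 0) {T : ℝ} (hT : 0 < T)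
    (hTη : T < η) (h₁ : ∀ t ∈ Icc 0 T, C (0, z 0) t ∈ (extChartAt (𝓡∂ n) x₀).target)
    (h₂ : ∀ t ∈ Ioo 0 T, ∀ᶠ s in 𝓝 0, ∀ t' ∈ Icc 0 t,
      C (s, z s) t' ∈ (extChartAt (𝓡∂ n) x₀).target)
    (h₃ : ∀ᶠ s in 𝓝 0, coordMetric (g s) x₀ (z s).1 (z s).2 (z s).2 = 1) {τ : ℝ → ℝ}
    (hτ : DifferentiableAt ℝ τ 0) (hτ0 : τ 0 = T) :
    ∃ w w' : V n, HasDerivAt (fun s => C (s, z s) (τ s)) w 0 ∧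
      HasDerivAt (fun s => U (s, z s) (τ s)) w' 0 ∧
      ContinuousOn (fun t => metricDot g x₀ (C (0, z 0) t) (U (0, z 0) t) (U (0, z 0) t))
        (Icc 0 T) ∧
      1 / 2 * ∫ t in (0 : ℝ)..T, metricDot g x₀ (C (0, z 0) t) (U (0, z 0) t) (U (0, z 0) t) =
        deriv τ 0 - coordMetric (g 0) x₀ (C (0, z 0) T) (U (0, z 0) T) w +
          coordMetric (g 0) x₀ (z 0).1 (z 0).2 (deriv z 0).1 := by
  obtain ⟨wy, wv, hw, hC, hU⟩ := hF.variation z hzN hz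
  have hη := hF.pos
  set c := C (0, z 0) with hc
  set u := U (0, z 0) with hu
  have hpos : ∀ t ∈ Icc 0 T, t ∈ Icc (-η) η := fun t ht => ⟨by linarith [ht.1], ht.2.trans hTη.le⟩
  have hpos' : ∀ t ∈ Icc 0 T, t ∈ Ico 0 η := fun t ht => ⟨ht.1, ht.2.trans_lt hTη⟩
  have hzN' : ∀ᶠ s in 𝓝 0, (s, z s) ∈ N :=
    (continuousAt_id.prodMk hz.continuousAt).eventually_mem (hF.isOpen.mem_nhds hzN)
  have hs : ∀ t : ℝ, HasDerivAt (fun s : ℝ => (s, t)) (1, 0) 0 := fun t =>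
    (hasDerivAt_id (0 : ℝ)).prodMk (hasDerivAt_const (0 : ℝ) t)
  have hCs : ∀ t ∈ Icc 0 T, HasDerivAt (fun s => C (s, z s) t) (wy t) 0 := fun t ht =>
    (HasFDerivAt.comp_hasDerivAt (f := fun s : ℝ => (s, t)) 0 (hC t (hpos' t ht))
      (hs t)).congr_deriv (by simp)
  have hUs : ∀ t ∈ Icc 0 T, HasDerivAt (fun s => U (s, z s) t) (wv t) 0 := fun t ht =>
    (HasFDerivAt.comp_hasDerivAt (f := fun s : ℝ => (s, t)) 0 (hU t (hpos' t ht))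
      (hs t)).congr_deriv (by simp)
  have hTT : T ∈ Icc 0 T := ⟨hT.le, le_rfl⟩
  have h00 : (0 : ℝ) ∈ Icc 0 T := ⟨le_rfl, hT.le⟩
  have hτs : HasDerivAt (fun s : ℝ => (s, τ s)) (1, deriv τ 0) 0 :=
    (hasDerivAt_id (0 : ℝ)).prodMk hτ.hasDerivAt
  -- The end point moves by the variation field and, because the end time moves, also by `τ'` times
  -- the velocity.
  have hCτ := (hC T (hpos' T hTT)).comp_hasDerivAt_of_eq 0 hτs (by simp [hτ0])
  have hUτ := (hU T (hpos' T hTT)).comp_hasDerivAt_of_eq 0 hτs (by simp [hτ0])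
  have hwy0 : wy 0 = (deriv z 0).1 := by
    have he : (fun s => C (s, z s) 0) =ᶠ[𝓝 0] fun s => (z s).1 := by
      filter_upwards [hzN'] with s hs using (hF.initial _ hs).1
    have hz1 : HasDerivAt (fun s => (z s).1) (deriv z 0).1 0 := hz.hasDerivAt.fst
    exact (hCs 0 h00).unique (hz1.congr_of_eventuallyEq he)
  have hini : c 0 = (z 0).1 ∧ u 0 = (z 0).2 := hF.initial _ hzN
  have hc' : ∀ t ∈ Icc 0 T, HasDerivAt c (u t) t := fun t ht => hF.hasDerivAt_C _ hzN t (hpos t ht)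
  have hu' : ∀ t ∈ Icc 0 T, HasDerivAt u (geodesicAcc (g 0) x₀ (c t) (u t)) t := fun t ht => by
    rw [← hF.acc_eq 0 _ _ (mem_chart_target.1 (h₁ t ht)).2]
    exact hF.hasDerivAt_U _ hzN t (hpos t ht)
  have hcont : ContinuousOn (fun t => metricDot g x₀ (c t) (u t) (u t)) (Icc 0 T) := by
    have hcc : ContinuousOn c (Icc 0 T) := fun t ht => (hc' t ht).continuousAt.continuousWithinAt
    have huc : ContinuousOn u (Icc 0 T) := fun t ht => (hu' t ht).continuousAt.continuousWithinAt
    exact (((hg.continuousOn_metricDot hε x₀).comp hcc h₁).clm_apply huc).clm_apply huc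
  have hA : ∀ t ∈ Icc 0 T, HasDerivWithinAt (fun r => coordMetric (g 0) x₀ (c r) (u r) (wy r))
      (1 / 2 * metricDer (g 0) x₀ (c t) (wy t) (u t) (u t) +
        coordMetric (g 0) x₀ (c t) (u t) (wv t)) (Icc 0 T) t := fun t ht =>
    hasDerivWithinAt_momentum (g 0) x₀ (hc' t ht).hasDerivWithinAt (hu' t ht).hasDerivWithinAt
      ((hw t ⟨ht.1, (hpos t ht).2⟩).mono (Icc_subset_Icc_right hTη.le)) (h₁ t ht)
      (eventually_of_mem self_mem_nhdsWithin h₁)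
  -- For `s` near `0` the trajectory up to time `t` is a geodesic of `g s` with initial energy `1`;
  -- its energy at `t` is constant in `s`, and the left side is the `s`-derivative of that energy.
  have hE : ∀ t ∈ Ioo 0 T, metricDot g x₀ (c t) (u t) (u t) +
      metricDer (g 0) x₀ (c t) (wy t) (u t) (u t) +
      2 * coordMetric (g 0) x₀ (c t) (u t) (wv t) = 0 := by
    intro t ht
    have ht' := Ioo_subset_Icc_self ht
    have hd := hg.hasDerivAt_energy hε (hCs t ht') (hUs t ht')
      ((h₂ t ht).mono fun s hs => hs t ⟨ht.1.le, le_rfl⟩)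
    refine hd.unique ((hasDerivAt_const (0 : ℝ) (1 : ℝ)).congr_of_eventuallyEq ?_)
    filter_upwards [h₂ t ht, h₃, hzN'] with s hs hs3 hsN
    have htt : ∀ t' ∈ Icc 0 t, t' ∈ Icc (-η) η := fun t' h =>
      hpos t' ⟨h.1, h.2.trans ht.2.le⟩
    have key : ∀ t' ∈ Icc 0 t, HasDerivWithinAt (fun t => coordMetric (g s) x₀ (C (s, z s) t)
        (U (s, z s) t) (U (s, z s) t)) 0 (Icc 0 t) t' := fun t' h =>
      hasDerivWithinAt_energy (g s) x₀ (hF.hasDerivAt_C _ hsN t' (htt t' h)).hasDerivWithinAt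
        (by
          rw [← hF.acc_eq s _ _ (mem_chart_target.1 (hs t' h)).2]
          exact (hF.hasDerivAt_U _ hsN t' (htt t' h)).hasDerivWithinAt)
        (hs t' h) (eventually_of_mem self_mem_nhdsWithin hs)
    have := constant_of_derivWithin_zero (fun t' h => (key t' h).differentiableWithinAt)
      (fun t' h => (key t' (Ico_subset_Icc_self h)).derivWithin
        (uniqueDiffOn_Icc ht.1 t' (Ico_subset_Icc_self h))) t ⟨ht.1.le, le_rfl⟩
    rw [this, (hF.initial _ hsN).1, (hF.initial _ hsN).2, hs3]
  have hint := intervalIntegral.integral_eq_sub_of_hasDerivAt_of_le hT.le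
    (f := fun r => coordMetric (g 0) x₀ (c r) (u r) (wy r))
    (f' := fun t => -(1 / 2) * metricDot g x₀ (c t) (u t) (u t))
    (fun t ht => (hA t ht).continuousWithinAt)
    (fun t ht => ((hA t (Ioo_subset_Icc_self ht)).hasDerivAt
      (Icc_mem_nhds ht.1 ht.2)).congr_deriv (by linarith [hE t ht]))
    ((continuousOn_const.mul hcont).intervalIntegrable_of_Icc hT.le)
  rw [intervalIntegral.integral_const_mul] at hint
  refine ⟨_, _, hCτ, hUτ, hcont, ?_⟩
  -- Unit speed at the end turns the contribution of the moving end time to the momentum into `deriv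
  -- τ 0`.
  have huu : coordMetric (g 0) x₀ (c T) (u T) (u T) = 1 := by
    have key : ∀ t ∈ Icc 0 T, HasDerivWithinAt (fun t => coordMetric (g 0) x₀ (c t)
        (u t) (u t)) 0 (Icc 0 T) t := fun t ht =>
      hasDerivWithinAt_energy (g 0) x₀ (hc' t ht).hasDerivWithinAt (hu' t ht).hasDerivWithinAt
        (h₁ t ht) (eventually_of_mem self_mem_nhdsWithin h₁)
    rw [constant_of_derivWithin_zero (fun t' h => (key t' h).differentiableWithinAt)
      (fun t' h => (key t' (Ico_subset_Icc_self h)).derivWithin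
        (uniqueDiffOn_Icc hT t' (Ico_subset_Icc_self h))) T hTT, hini.1, hini.2]
    exact h₃.self_of_nhds
  rw [hini.1, hini.2, hwy0] at hint
  simp only [add_apply, ContinuousLinearMap.smulRight_apply, ContinuousLinearMap.coe_fst',
    ContinuousLinearMap.coe_snd', one_smul, map_add, map_smul, smul_eq_mul]
  rw [huu]
  linarith

end Momentum

/-! ### Propagating families of unit vectors along one flow box. -/

section Propagation

open Set Filter

variable {n : ℕ} [NeZero n] {M : Type*} [TopologicalSpace M]
  [ChartedSpace (EuclideanHalfSpace n) M] [IsManifold (𝓡∂ n) ∞ M]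

variable {ε : ℝ} {g : ℝ → Metric n M}

/-! ### Families of geodesics near a given geodesic -/

/-- The integrand `d/ds |γ'|²` along a curve. -/
def rayIntegrand (g : ℝ → Metric n M) (γ : ℝ → M) (r : ℝ) : ℝ :=
  metricDeriv g (γ r) (velocity γ r) (velocity γ r)

/-- The arcs `γ s` of `g s` over `[a s, b s]`, from `σ s` to `σ' s`, perturb the restriction of
`γ₀` to `[x, y]`. -/
structure IsPropagation (g : ℝ → Metric n M) (γ₀ : ℝ → M) (A B x y : ℝ) (a : ℝ → ℝ)
    (σ : ℝ → TangentBundle (𝓡∂ n) M) (b : ℝ → ℝ) (γ : ℝ → ℝ → M)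
    (σ' : ℝ → TangentBundle (𝓡∂ n) M) : Prop where
  differentiableAt : DifferentiableAt ℝ b 0
  end_eq : b 0 = y
  unitFamily : IsUnitFamily g σ'
  state_end : σ' 0 = state γ₀ A B y
  arcs : ∀ᶠ s in 𝓝 0, IsArc (g s) (γ s) (a s) (b s) ∧ state (γ s) (a s) (b s) (a s) = σ s ∧
    state (γ s) (a s) (b s) (b s) = σ' s
  boundary : γ₀ y ∈ (𝓡∂ n).boundary M → ∀ᶠ s in 𝓝 0, (σ' s).proj ∈ (𝓡∂ n).boundary M
  intervalIntegrable : IntervalIntegrable (rayIntegrand g γ₀) MeasureTheory.volume x y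
  integral_eq : 1 / 2 * ∫ r in x..y, rayIntegrand g γ₀ r =
    deriv b 0 - deriv a 0 - momentum (g 0) σ' + momentum (g 0) σ

/-- Families of unit vectors near the velocity of `γ₀` at `x` propagate along geodesics to time
`y`. -/
def Propagates (g : ℝ → Metric n M) (γ₀ : ℝ → M) (A B x y : ℝ) : Prop :=
  ∀ (a : ℝ → ℝ) (σ : ℝ → TangentBundle (𝓡∂ n) M), DifferentiableAt ℝ a 0 → a 0 = x →
    IsUnitFamily g σ → σ 0 = state γ₀ A B x → ∃ b γ σ', IsPropagation g γ₀ A B x y a σ b γ σ'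

theorem notMem_boundary {p : M} (h : p ∈ (𝓡∂ n).interior M) : p ∉ (𝓡∂ n).boundary M := by
  rw [← (𝓡∂ n).compl_interior]
  exact fun h' => h' h

theorem velocityOn_eq_velocity {γ : ℝ → M} {a b r : ℝ} (hr : r ∈ Ioo a b) :
    velocityOn (n := n) γ a b r = velocity γ r := by
  have := mfderivWithin_of_mem_nhds (I := 𝓘(ℝ, ℝ)) (I' := 𝓡∂ n) (f := γ)
    (Icc_mem_nhds hr.1 hr.2)
  unfold velocityOn velocity
  rw [this]

/-- The integrand in a chart. -/
theorem rayIntegrand_eq (hg : IsC1Family ε g) (hε : 0 < ε) {γ : ℝ → M}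
    {a b r : ℝ} (hr : r ∈ Ioo a b) {x₀ : M}
    (hs : γ r ∈ (extChartAt (𝓡∂ n) x₀).source) :
    rayIntegrand g γ r = metricDot g x₀ (chartState x₀ (state (n := n) γ a b r)).1
      (chartState x₀ (state γ a b r)).2 (chartState x₀ (state γ a b r)).2 := by
  rw [rayIntegrand, ← velocityOn_eq_velocity hr, hg.metricDeriv_eq hε hs]
  rfl

section Flow

variable {x₀ : M} {η : ℝ} {N O : Set (ℝ × (V n × V n))} {acl : ℝ × (V n × V n) → V n}
  {C U : ℝ × (V n × V n) → ℝ → V n}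

/-- Positive height at interior times suffices: by continuity the end points lie in the closed
half-space, where the extended acceleration is the true one. -/
theorem IsGeodesicFlow.isArc (hF : IsGeodesicFlow g x₀ η N O acl C U) {s : ℝ} {z : V n × V n}
    (hzN : (s, z) ∈ N) {α β : ℝ} (hαβ : α < β)
    (hη : β - α < η) (hpos : ∀ t ∈ Ioo 0 (β - α), 0 < C (s, z) t 0) :
    (∀ t ∈ Icc 0 (β - α), C (s, z) t ∈ (extChartAt (𝓡∂ n) x₀).target) ∧
    IsArc (g s) (fun r => (extChartAt (𝓡∂ n) x₀).symm (C (s, z) (r - α))) α β ∧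
    ∀ r ∈ Icc α β,
      state (n := n) (fun r => (extChartAt (𝓡∂ n) x₀).symm (C (s, z) (r - α))) α β r =
        ofChartState x₀ (C (s, z) (r - α), U (s, z) (r - α)) := by
  have hT : 0 < β - α := by linarith
  have hI : ∀ t ∈ Icc 0 (β - α), t ∈ Icc (-η) η := fun t ht =>
    ⟨by linarith [ht.1, hF.pos], by linarith [ht.2]⟩
  have htar : ∀ t ∈ Icc 0 (β - α), C (s, z) t ∈ (extChartAt (𝓡∂ n) x₀).target := by
    intro t ht
    refine mem_chart_target.2 ⟨hF.mem_chartOpen _ hzN t (hI t ht), ?_⟩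
    have hcl : t ∈ closure (Ioo 0 (β - α)) := by rwa [closure_Ioo hT.ne]
    have hc : ContinuousWithinAt (fun t => C (s, z) t 0) (Ioo 0 (β - α)) t :=
      ((coord₀ n).continuous.continuousAt.comp
        (hF.hasDerivAt_C _ hzN t (hI t ht)).continuousAt).continuousWithinAt
    exact closure_minimal (t := Ici (0 : ℝ))
      (by rintro _ ⟨t', ht', rfl⟩; exact (hpos t' ht').le) isClosed_Ici
      (hc.mem_closure_image hcl)
  have hsub : ∀ r ∈ Icc α β, r - α ∈ Icc 0 (β - α) := fun r hr =>
    ⟨by linarith [hr.1], by linarith [hr.2]⟩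
  refine ⟨htar, isArc_of_chart (c := fun r => C (s, z) (r - α)) (u := fun r => U (s, z) (r - α))
    hαβ (fun r hr => ?_) (fun r hr => ?_) (fun r hr => htar _ (hsub r hr)) (fun r hr => ?_)⟩
  · exact ((hF.hasDerivAt_C _ hzN _ (hI _ (hsub r hr))).comp_sub_const r α).hasDerivWithinAt
  · rw [← hF.acc_eq s _ _ (mem_chart_target.1 (htar _ (hsub r hr))).2]
    exact ((hF.hasDerivAt_U _ hzN _ (hI _ (hsub r hr))).comp_sub_const r α).hasDerivWithinAt
  · exact hpos _ ⟨by linarith [hr.1], by linarith [hr.2]⟩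

/-- Uniqueness of arcs identifies `γ₀` with the trajectory starting from its own state at `x`; in
particular `γ₀` stays in the chart on `[x, y]`. -/
theorem IsGeodesicFlow.state_eq [T2Space M] (hF : IsGeodesicFlow g x₀ η N O acl C U) {γ₀ : ℝ → M}
    {A B x y : ℝ} (h₀ : IsArc (g 0) γ₀ A B) (hAx : A ≤ x) (hxy : x < y) (hyB : y ≤ B)
    (hη : y - x < η) (hs : γ₀ x ∈ (extChartAt (𝓡∂ n) x₀).source) {z : V n × V n}
    (hz : z = chartState x₀ (state (n := n) γ₀ A B x)) (hN : (0, z) ∈ N)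
    (hpos : ∀ t ∈ Ioo 0 (y - x), 0 < C (0, z) t 0) {r : ℝ} (hr : r ∈ Icc x y) :
    C (0, z) (r - x) ∈ (extChartAt (𝓡∂ n) x₀).target ∧
    γ₀ r ∈ (extChartAt (𝓡∂ n) x₀).source ∧
      chartState x₀ (state (n := n) γ₀ A B r) = (C (0, z) (r - x), U (0, z) (r - x)) := by
  obtain ⟨htar, harc, hst⟩ := hF.isArc hN hxy hη hpos
  have hini := hF.initial _ hN
  have hx : x ∈ Icc x y := left_mem_Icc.2 hxy.le
  have h1 := harc.state_eq (h₀.mono hAx hyB hxy) (by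
    rw [hst x hx, h₀.state_mono hAx hyB hxy hx, sub_self, hini.1, hini.2, Prod.mk.eta, hz,
      ofChartState_chartState hs]) hr
  rw [hst r hr, h₀.state_mono hAx hyB hxy hr] at h1
  have ht := htar (r - x) ⟨by linarith [hr.1], by linarith [hr.2]⟩
  refine ⟨ht, ?_, ?_⟩
  · have h2 : (ofChartState x₀ (C (0, z) (r - x), U (0, z) (r - x))).proj = γ₀ r :=
      congrArg Bundle.TotalSpace.proj h1
    rw [← h2]
    exact (extChartAt (𝓡∂ n) x₀).map_target ht
  · rw [← h1, chartState_ofChartState ht]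

/-- Reduces propagation inside a flow box to the choice of the end time `b`: it must be
differentiable, the nearby trajectories must have positive height before it, and height zero at it
if `γ₀ y` is on the boundary. -/
theorem IsGeodesicFlow.exists_isPropagation [T2Space M] (hg : IsC1Family ε g) (hε : 0 < ε)
    (hF : IsGeodesicFlow g x₀ η N O acl C U) {γ₀ : ℝ → M}
    {A B x y : ℝ} (h₀ : IsArc (g 0) γ₀ A B) (hAx : A ≤ x) (hxy : x < y) (hyB : y ≤ B)
    (hη : y - x < η) (hs : γ₀ x ∈ (extChartAt (𝓡∂ n) x₀).source)
    {a b : ℝ → ℝ} {σ : ℝ → TangentBundle (𝓡∂ n) M} (ha : DifferentiableAt ℝ a 0) (ha0 : a 0 = x)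
    (hσ : IsUnitFamily g σ) (hσ0 : σ 0 = state γ₀ A B x)
    (hN : (0, chartState x₀ (σ 0)) ∈ N) (hb : DifferentiableAt ℝ b 0) (hb0 : b 0 = y)
    (hpos : ∀ᶠ s in 𝓝 0, ∀ t ∈ Ioo 0 (b s - a s), 0 < C (s, chartState x₀ (σ s)) t 0)
    (hbd : γ₀ y ∈ (𝓡∂ n).boundary M →
      ∀ᶠ s in 𝓝 0, C (s, chartState x₀ (σ s)) (b s - a s) 0 = 0) :
    ∃ γ σ', IsPropagation g γ₀ A B x y a σ b γ σ' := by
  set z : ℝ → V n × V n := fun s => chartState x₀ (σ s) with hz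
  have hσs : (σ 0).proj ∈ (extChartAt (𝓡∂ n) x₀).source := by rw [hσ0]; exact hs
  obtain ⟨hqc, hzd⟩ := (mdifferentiableAt_iff_chartState hσs).1 hσ.mdifferentiableAt
  have hsrc : ∀ᶠ s in 𝓝 0, (σ s).proj ∈ (extChartAt (𝓡∂ n) x₀).source :=
    hqc.eventually_mem ((isOpen_extChartAt_source x₀).mem_nhds hσs)
  have hzN : ∀ᶠ s in 𝓝 0, (s, z s) ∈ N :=
    (continuousAt_id.prodMk hzd.continuousAt).eventually_mem (hF.isOpen.mem_nhds hN)
  have hτd : DifferentiableAt ℝ (fun s => b s - a s) 0 := hb.sub ha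
  have hτ0 : b 0 - a 0 = y - x := by rw [ha0, hb0]
  have hτ : ∀ᶠ s in 𝓝 0, 0 < b s - a s ∧ b s - a s < η := by
    refine Filter.Eventually.and (hτd.continuousAt.eventually (lt_mem_nhds ?_))
      (hτd.continuousAt.eventually (gt_mem_nhds ?_))
    · change 0 < b 0 - a 0; rw [hτ0]; linarith
    · change b 0 - a 0 < η; rwa [hτ0]
  set T := y - x with hT
  have hT0 : 0 < T := by rw [hT]; linarith
  have good : ∀ᶠ s in 𝓝 0, (∀ t ∈ Icc 0 (b s - a s), C (s, z s) t ∈ (extChartAt (𝓡∂ n) x₀).target) ∧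
    IsArc (g s) (fun r => (extChartAt (𝓡∂ n) x₀).symm (C (s, z s) (r - a s))) (a s) (b s) ∧
    ∀ r ∈ Icc (a s) (b s),
      state (n := n) (fun r => (extChartAt (𝓡∂ n) x₀).symm (C (s, z s) (r - a s))) (a s) (b s) r =
        ofChartState x₀ (C (s, z s) (r - a s), U (s, z s) (r - a s)) := by
    filter_upwards [hzN, hτ, hpos] with s h2 h3 h4
    exact hF.isArc h2 (by linarith [h3.1]) h3.2 h4
  -- An eventual statement at `0` holds at `s = 0` itself, which provides the hypothesis for
  -- identifying the trajectory with `γ₀`.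
  have hpos0 : ∀ t ∈ Ioo 0 (y - x), 0 < C (0, z 0) t 0 := by
    have := hpos.self_of_nhds
    rwa [hτ0] at this
  have hst : ∀ r ∈ Icc x y, C (0, z 0) (r - x) ∈ (extChartAt (𝓡∂ n) x₀).target ∧
    γ₀ r ∈ (extChartAt (𝓡∂ n) x₀).source ∧
      chartState x₀ (state (n := n) γ₀ A B r) = (C (0, z 0) (r - x), U (0, z 0) (r - x)) :=
    fun r hr => hF.state_eq h₀ hAx hxy hyB hη hs (by rw [← hσ0]) hN hpos0 hr
  have htar0 : ∀ t ∈ Icc 0 T, C (0, z 0) t ∈ (extChartAt (𝓡∂ n) x₀).target := fun t ht => by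
    have := (hst (t + x) ⟨by linarith [ht.1], by rw [hT] at ht; linarith [ht.2]⟩).1
    rwa [add_sub_cancel_right] at this
  obtain ⟨w, w', hw, hw', hcont, hid⟩ := hF.integral_metricDot hg hε hN hzd hT0 hη htar0
    (fun t ht => by
      have : ∀ᶠ s in 𝓝 0, t < b s - a s :=
        hτd.continuousAt.eventually (lt_mem_nhds (show t < b 0 - a 0 by
          rw [hτ0]; exact ht.2))
      filter_upwards [this, good] with s h1 h2 t' ht'
      exact h2.1 t' ⟨ht'.1, ht'.2.trans h1.le⟩)
    (by
      filter_upwards [hsrc, hσ.unit] with s h1 h2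
      rw [← h2, normSq_eq _ h1]) hτd hτ0
  set σ' : ℝ → TangentBundle (𝓡∂ n) M := fun s =>
    ofChartState x₀ (C (s, z s) (b s - a s), U (s, z s) (b s - a s)) with hσ'
  have hyI : y ∈ Icc x y := right_mem_Icc.2 hxy.le
  have hend : ∀ᶠ s in 𝓝 0, C (s, z s) (b s - a s) ∈ (extChartAt (𝓡∂ n) x₀).target := by
    filter_upwards [good, hτ] with s h1 h2
    exact h1.1 _ ⟨h2.1.le, le_rfl⟩
  have hcs : (fun s => chartState x₀ (σ' s)) =ᶠ[𝓝 0]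
      fun s => (C (s, z s) (b s - a s), U (s, z s) (b s - a s)) := by
    filter_upwards [hend] with s h1 using chartState_ofChartState h1
  have hσ's : (σ' 0).proj ∈ (extChartAt (𝓡∂ n) x₀).source :=
    (extChartAt (𝓡∂ n) x₀).map_target hend.self_of_nhds
  have hσ'0 : σ' 0 = state γ₀ A B y := by
    refine chartState_injOn hσ's (hst y hyI).2.1 ?_
    have := hcs.self_of_nhds
    simp only [hτ0] at this
    rw [(hst y hyI).2.2, this]
  have hσ'd : MDifferentiableAt 𝓘(ℝ, ℝ) (𝓡∂ n).tangent σ' 0 := by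
    rw [mdifferentiableAt_iff_chartState hσ's]
    refine ⟨?_, (hw.differentiableAt.prodMk hw'.differentiableAt).congr_of_eventuallyEq hcs⟩
    exact ((continuousOn_extChartAt_symm x₀ _ hend.self_of_nhds).tendsto.comp
      (tendsto_nhdsWithin_iff.2 ⟨hw.continuousAt, hend⟩))
  set f : ℝ → ℝ := fun t => metricDot g x₀ (C (0, z 0) t) (U (0, z 0) t) (U (0, z 0) t) with hf
  have hEq : EqOn (rayIntegrand g γ₀) (fun r => f (r - x)) (Ioo x y) := fun r hr => by
    obtain ⟨-, h2, h3⟩ := hst r (Ioo_subset_Icc_self hr)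
    rw [rayIntegrand_eq hg hε (a := A) (b := B) ⟨hAx.trans_lt hr.1, hr.2.trans_le hyB⟩ h2, h3]
  have hcs0 : chartState x₀ (σ' 0) = (C (0, z 0) T, U (0, z 0) T) := by
    have := hcs.self_of_nhds
    simpa only [hτ0] using this
  have hfc : ContinuousOn (fun r => f (r - x)) (Icc x y) :=
    hcont.comp (by fun_prop) fun r hr => ⟨by linarith [hr.1], by rw [hT]; linarith [hr.2]⟩
  refine ⟨fun s r => (extChartAt (𝓡∂ n) x₀).symm (C (s, z s) (r - a s)), σ', hb, hb0,
    ⟨hσ'd, ?_⟩, hσ'0, ?_, fun h => ?_, ?_, ?_⟩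
  · filter_upwards [good, hσ.unit, hzN, hsrc, hτ] with s h1 h2 h3 h4 h5
    have hI1 : b s ∈ Icc (a s) (b s) := ⟨by linarith [h5.1], le_rfl⟩
    have hI2 : a s ∈ Icc (a s) (b s) := ⟨le_rfl, by linarith [h5.1]⟩
    rw [hσ']
    simp only
    rw [← h1.2.2 _ hI1, h1.2.1.normSq_const hI1, h1.2.2 _ hI2, sub_self,
      (hF.initial _ h3).1, (hF.initial _ h3).2, Prod.mk.eta, ofChartState_chartState h4, h2]
  · filter_upwards [good, hzN, hsrc, hτ] with s h1 h3 h4 h5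
    have hI1 : b s ∈ Icc (a s) (b s) := ⟨by linarith [h5.1], le_rfl⟩
    have hI2 : a s ∈ Icc (a s) (b s) := ⟨le_rfl, by linarith [h5.1]⟩
    refine ⟨h1.2.1, ?_, h1.2.2 _ hI1⟩
    rw [h1.2.2 _ hI2, sub_self, (hF.initial _ h3).1, (hF.initial _ h3).2, Prod.mk.eta,
      ofChartState_chartState h4]
  · filter_upwards [hend, hbd h] with s h1 h2
    have h3 := (extChartAt (𝓡∂ n) x₀).map_target h1
    refine (mem_boundary_iff_coord (x₀ := x₀) h3).2 ?_
    have h4 : extChartAt (𝓡∂ n) x₀ (σ' s).proj = C (s, z s) (b s - a s) :=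
      (extChartAt (𝓡∂ n) x₀).right_inv h1
    exact (congrArg (fun y : V n => y 0) h4).trans h2
  · exact (hfc.intervalIntegrable_of_Icc hxy.le).congr_uIoo (by
      rw [uIoo_of_le hxy.le]; exact hEq.symm)
  · rw [intervalIntegral.integral_congr_Ioo_of_le hxy.le hEq,
      intervalIntegral.integral_comp_sub_right, sub_self, ← hT, hid,
      momentum_eq hσ's hσ'd (hw.congr_of_eventuallyEq (hcs.mono fun s hs => congrArg Prod.fst hs)),
      momentum_eq hσs hσ.mdifferentiableAt hzd.hasDerivAt.fst, hcs0]
    have : deriv (fun s => b s - a s) 0 = deriv b 0 - deriv a 0 :=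
      (hb.hasDerivAt.sub ha.hasDerivAt).deriv
    rw [this]

end Flow

end Propagation

/-! ### Propagation along a whole arc and the hitting time of the boundary. -/

section Segments

open Set Filter

variable {n : ℕ} [NeZero n] {M : Type*} [TopologicalSpace M]
  [ChartedSpace (EuclideanHalfSpace n) M] [IsManifold (𝓡∂ n) ∞ M]

variable {ε : ℝ} {g : ℝ → Metric n M} {γ₀ : ℝ → M} {A B : ℝ}

/-- The final family of the first piece is the initial family of the second, so the derivatives of
the intermediate time and the momenta there cancel. The junction is interior, so the arcs unite to
one arc. -/
theorem Propagates.trans {x y z : ℝ} (hy : γ₀ y ∈ (𝓡∂ n).interior M)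
    (h₁ : Propagates g γ₀ A B x y) (h₂ : Propagates g γ₀ A B y z) :
    Propagates g γ₀ A B x z := by
  intro a σ ha ha0 hσ hσ0
  obtain ⟨b, γ₁, σ₁, P₁⟩ := h₁ a σ ha ha0 hσ hσ0
  obtain ⟨c, γ₂, σ₂, P₂⟩ := h₂ b σ₁ P₁.differentiableAt P₁.end_eq P₁.unitFamily P₁.state_end
  refine ⟨c, fun s => joinAt (b s) (γ₁ s) (γ₂ s), σ₂, P₂.differentiableAt, P₂.end_eq,
    P₂.unitFamily, P₂.state_end, ?_, P₂.boundary,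
    P₁.intervalIntegrable.trans P₂.intervalIntegrable, ?_⟩
  · have hint : ∀ᶠ s in 𝓝 0, (σ₁ s).proj ∈ (𝓡∂ n).interior M := by
      refine (mdifferentiableAt_proj P₁.unitFamily.mdifferentiableAt).continuousAt.eventually_mem
        (((𝓡∂ n).isOpen_interior (n := ∞) (by simp)).mem_nhds ?_)
      have : (σ₁ 0).proj = γ₀ y := congrArg Bundle.TotalSpace.proj P₁.state_end
      rwa [this]
    filter_upwards [hint, P₁.arcs, P₂.arcs] with s hi h1 h2
    have hb : γ₁ s (b s) = (σ₁ s).proj := congrArg Bundle.TotalSpace.proj h1.2.2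
    obtain ⟨h3, h4, h5⟩ := h1.1.joinAt h2.1 (h1.2.2.trans h2.2.1.symm) (by rwa [hb])
    exact ⟨h3, h4.trans h1.2.1, h5.trans h2.2.2⟩
  · rw [← intervalIntegral.integral_add_adjacent_intervals P₁.intervalIntegrable
      P₂.intervalIntegrable, mul_add, P₁.integral_eq, P₂.integral_eq]
    ring

theorem IsArc.exists_near (h₀ : IsArc (g 0) γ₀ A B) {r : ℝ} (hr : r ∈ Icc A B) {x₀ : M}
    (hs : γ₀ r ∈ (extChartAt (𝓡∂ n) x₀).source) {N : Set (ℝ × (V n × V n))}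
    (hN : N ∈ 𝓝 ((0 : ℝ), chartState x₀ (state γ₀ A B r))) {η : ℝ} (hη : 0 < η) :
    ∃ δ > 0, δ ≤ η ∧ ∀ x ∈ Icc A B, |x - r| < δ → γ₀ x ∈ (extChartAt (𝓡∂ n) x₀).source ∧
      (0, chartState x₀ (state γ₀ A B x)) ∈ N := by
  have h1 := h₀.eventually_mem_source hr hs
  have h2 : ∀ᶠ x in 𝓝[Icc A B] r, ((0 : ℝ), chartState x₀ (state γ₀ A B x)) ∈ N :=
    ((continuousWithinAt_const (b := (0 : ℝ))).prodMk
      (h₀.continuousWithinAt_chartState hr hs)).eventually_mem hN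
  obtain ⟨δ, hδ, h⟩ := Metric.mem_nhdsWithin_iff.1 (Filter.Eventually.and h1 h2)
  exact ⟨min δ η, lt_min hδ hη, min_le_right _ _, fun x hx hxr =>
    h ⟨by rw [Metric.mem_ball, Real.dist_eq]; exact hxr.trans_le (min_le_left _ _), hx⟩⟩

section Flow

variable [T2Space M] {x₀ : M} {η : ℝ} {N O : Set (ℝ × (V n × V n))} {acl : ℝ × (V n × V n) → V n}
  {C U : ℝ × (V n × V n) → ℝ → V n}

/-- Propagation where the flow stays in the interior for positive times. -/
theorem IsGeodesicFlow.propagates_of_pos (hg : IsC1Family ε g) (hε : 0 < ε)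
    (hF : IsGeodesicFlow g x₀ η N O acl C U) (h₀ : IsArc (g 0) γ₀ A B) {x y : ℝ} (hAx : A ≤ x)
    (hxy : x < y) (hyB : y ≤ B) (hη : y - x < η) (hs : γ₀ x ∈ (extChartAt (𝓡∂ n) x₀).source)
    (hN : (0, chartState x₀ (state γ₀ A B x)) ∈ N)
    (hpos : ∀ s z, (s, z) ∈ N → z.1 ∈ (extChartAt (𝓡∂ n) x₀).target → ∀ t ∈ Ioc 0 η,
      0 < C (s, z) t 0) : Propagates g γ₀ A B x y := by
  intro a σ ha ha0 hσ hσ0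
  have hσs : (σ 0).proj ∈ (extChartAt (𝓡∂ n) x₀).source := by rw [hσ0]; exact hs
  obtain ⟨hqc, hzd⟩ := (mdifferentiableAt_iff_chartState hσs).1 hσ.mdifferentiableAt
  rw [← hσ0] at hN
  have hpos' : ∀ᶠ s in 𝓝 0, ∀ t ∈ Ioc 0 η, 0 < C (s, chartState x₀ (σ s)) t 0 := by
    filter_upwards [hqc.eventually_mem ((isOpen_extChartAt_source x₀).mem_nhds hσs),
      (continuousAt_id.prodMk hzd.continuousAt).eventually_mem (hF.isOpen.mem_nhds hN)] with s h1 h2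
    exact hpos s _ h2 ((extChartAt (𝓡∂ n) x₀).map_source h1)
  have hT : ∀ s, a s + (y - x) - a s = y - x := fun s => by ring
  obtain ⟨γ, σ', h⟩ := hF.exists_isPropagation hg hε h₀ hAx hxy hyB hη hs ha ha0 hσ hσ0 hN
    (b := fun s => a s + (y - x)) (ha.add_const (y - x)) (by simp [ha0]) (by
      filter_upwards [hpos'] with s h1 t ht
      rw [hT] at ht
      exact h1 t ⟨ht.1, by linarith [ht.2]⟩) (fun hb => by
      refine absurd hb (notMem_boundary ?_)
      obtain ⟨-, h2, h3⟩ := hF.state_eq h₀ hAx hxy hyB hη hs (by rw [hσ0]) hN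
        (fun t ht => hpos'.self_of_nhds t ⟨ht.1, by linarith [ht.2]⟩) (right_mem_Icc.2 hxy.le)
      rw [mem_interior_iff_coord h2]
      have h4 := congrArg (fun z : V n × V n => z.1 0) h3
      exact lt_of_lt_of_eq (hpos'.self_of_nhds (y - x) ⟨by linarith, hη.le⟩) h4.symm)
  exact ⟨_, _, _, h⟩

/-- Propagation to a non-tangential hit of the boundary. -/
theorem IsGeodesicFlow.propagates_exit (hg : IsC1Family ε g) (hε : 0 < ε)
    (hF : IsGeodesicFlow g x₀ η N O acl C U) (h₀ : IsArc (g 0) γ₀ A B)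
    (hB : γ₀ B ∈ (𝓡∂ n).boundary M) {x y : ℝ} (hAx : A < x)
    (hxy : x < y) (hyB : y ≤ B) (hη : y - x < η) (hs : γ₀ x ∈ (extChartAt (𝓡∂ n) x₀).source)
    (hN : (0, chartState x₀ (state γ₀ A B x)) ∈ N)
    (hneg : ∀ z ∈ N, ∀ t ∈ Icc (-η) η, U z t 0 < 0) : Propagates g γ₀ A B x y := by
  intro a σ ha ha0 hσ hσ0
  have hσs : (σ 0).proj ∈ (extChartAt (𝓡∂ n) x₀).source := by rw [hσ0]; exact hs
  obtain ⟨-, hzd⟩ := (mdifferentiableAt_iff_chartState hσs).1 hσ.mdifferentiableAt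
  rw [← hσ0] at hN
  set z : ℝ → V n × V n := fun s => chartState x₀ (σ s) with hz
  have hzN : ∀ᶠ s in 𝓝 0, (s, z s) ∈ N :=
    (continuousAt_id.prodMk hzd.continuousAt).eventually_mem (hF.isOpen.mem_nhds hN)
  set h : ℝ → ℝ → ℝ := fun s t => C (s, z s) t 0 with hh
  have hsub : Icc 0 η ⊆ Icc (-η) η := Icc_subset_Icc_left (by linarith [hF.pos])
  have hder : ∀ s, (s, z s) ∈ N → ∀ t ∈ Icc 0 η, HasDerivAt (h s) (U (s, z s) t 0) t :=
    fun s hs t ht => (coord₀ n).hasFDerivAt.comp_hasDerivAt t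
      (hF.hasDerivAt_C _ hs t (hsub ht))
  -- The flow box was chosen with outward velocities, so every trajectory in it loses height
  -- strictly and crosses height zero at most once.
  have hanti : ∀ s, (s, z s) ∈ N → StrictAntiOn (h s) (Icc 0 η) := fun s hs =>
    strictAntiOn_of_deriv_neg (convex_Icc 0 η)
      (fun t ht => (hder s hs t ht).continuousAt.continuousWithinAt) (fun t ht => by
        rw [interior_Icc] at ht
        rw [(hder s hs t (Ioo_subset_Icc_self ht)).deriv]
        exact hneg _ hs t (hsub (Ioo_subset_Icc_self ht)))
  obtain ⟨wy, -, -, hC, -⟩ := hF.variation z hN hzd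
  have hhs : ∀ t ∈ Ico 0 η, ContinuousAt (fun s => h s t) 0 := fun t ht => by
    have h1 : ContinuousAt (fun s : ℝ => (s, t)) 0 := by fun_prop
    have h2 := ContinuousAt.comp (f := fun s : ℝ => (s, t)) (x := (0 : ℝ)) (hC t ht).continuousAt h1
    exact (coord₀ n).continuous.continuousAt.comp h2
  have hT0 : 0 < y - x := by linarith
  have hini : h 0 0 = (extChartAt (𝓡∂ n) x₀ (γ₀ x)) 0 := by
    have h1 := congrArg (fun v : V n => v 0) (hF.initial _ hN).1
    refine h1.trans ?_
    simp only [hσ0]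
    rfl
  have hh0 : 0 < h 0 0 := by
    rw [hini, ← mem_interior_iff_coord hs]
    exact h₀.mem_interior x ⟨hAx, hxy.trans_le hyB⟩
  -- Positivity is required only before `t`, so this applies to the first zero of the height, before
  -- positivity on the whole interval is known.
  have hcoord : ∀ t, 0 < t → t ≤ y - x → (∀ t' ∈ Ioo 0 t, 0 < h 0 t') →
      γ₀ (x + t) ∈ (extChartAt (𝓡∂ n) x₀).source ∧
        h 0 t = (extChartAt (𝓡∂ n) x₀ (γ₀ (x + t))) 0 := by
    intro t ht htT hp
    have hr : x + t ∈ Icc x (x + t) := ⟨by linarith, le_rfl⟩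
    obtain ⟨-, h2, h3⟩ := hF.state_eq h₀ hAx.le (y := x + t) (by linarith) (by linarith)
      (by linarith) hs (z := z 0) (by rw [hz, ← hσ0]) hN (by rwa [add_sub_cancel_left]) hr
    rw [add_sub_cancel_left] at h3
    exact ⟨h2, (congrArg (fun z : V n × V n => z.1 0) h3).symm⟩
  -- A zero of the height at an earlier time would put `γ₀` on the boundary before `B`, where it is
  -- interior.
  have hpos0 : ∀ t ∈ Ioo 0 (y - x), 0 < h 0 t := by
    intro t₁ ht₁
    by_contra hle
    rw [not_lt] at hle
    have hI : Icc 0 t₁ ⊆ Icc 0 η := Icc_subset_Icc_right (by linarith [ht₁.2])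
    obtain ⟨t, ht, ht0⟩ := intermediate_value_Icc' ht₁.1.le
      (fun t ht => (hder 0 hN t (hI ht)).continuousAt.continuousWithinAt) ⟨hle, hh0.le⟩
    have htpos : 0 < t := lt_of_le_of_ne ht.1 (by rintro rfl; exact hh0.ne' ht0)
    obtain ⟨h2, h3⟩ := hcoord t htpos (by linarith [ht.2, ht₁.2]) fun t' ht' =>
      lt_of_eq_of_lt ht0.symm
        (hanti 0 hN ⟨ht'.1.le, by linarith [ht'.2, ht.2, ht₁.2]⟩ (hI ht) ht'.2)
    rw [ht0] at h3
    refine notMem_boundary (h₀.mem_interior (x + t) ⟨by linarith, ?_⟩)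
      ((mem_boundary_iff_coord h2).2 h3.symm)
    linarith [ht.2, ht₁.2]
  obtain ⟨hys, hyC⟩ := hcoord (y - x) hT0 le_rfl hpos0
  rw [show x + (y - x) = y by ring] at hys hyC
  have hTI : y - x ∈ Ico 0 η := ⟨hT0.le, hη⟩
  -- Before `B` the duration can be kept fixed; at `B` it has to be the hitting time.
  by_cases hyB' : y < B
  · have hyi : γ₀ y ∈ (𝓡∂ n).interior M := h₀.mem_interior y ⟨by linarith, hyB'⟩
    have hTpos : 0 < h 0 (y - x) := by rwa [hyC, ← mem_interior_iff_coord hys]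
    obtain ⟨γ, σ', H⟩ := hF.exists_isPropagation hg hε h₀ hAx.le hxy hyB hη hs ha ha0 hσ hσ0 hN
      (b := fun s => a s + (y - x)) (ha.add_const (y - x)) (by simp [ha0]) (by
        filter_upwards [hzN, (hhs _ hTI).eventually (lt_mem_nhds hTpos)] with s h1 h2 t ht
        rw [add_sub_cancel_left] at ht
        exact h2.trans (hanti s h1 ⟨ht.1.le, by linarith [ht.2]⟩ ⟨hTI.1, hTI.2.le⟩ ht.2))
      (fun hb => absurd hb (notMem_boundary hyi))
    exact ⟨_, γ, σ', H⟩
  · obtain rfl : y = B := le_antisymm hyB (not_lt.1 hyB')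
    have hT : h 0 (y - x) = 0 := by rw [hyC, (mem_boundary_iff_coord hys).1 hB]
    set T := y - x with hTd
    -- The height at `s = 0` changes sign strictly around `T`, and continuity in `s` at the two
    -- fixed times preserves the signs. This yields a root close to `T`, hence continuity of the
    -- hitting time.
    have hbr : ∀ e > 0, T + e < η → T - e > 0 → ∀ᶠ s in 𝓝 0, 0 < h s (T - e) ∧ h s (T + e) < 0 := by
      intro e he h1 h2
      refine Filter.Eventually.and ((hhs _ ⟨h2.le, by linarith⟩).eventually (lt_mem_nhds ?_))
        ((hhs _ ⟨by linarith, h1⟩).eventually (gt_mem_nhds ?_))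
      · exact lt_of_eq_of_lt hT.symm
          (hanti 0 hN ⟨h2.le, by linarith⟩ ⟨hTI.1, hTI.2.le⟩ (by linarith))
      · exact lt_of_lt_of_eq
          (hanti 0 hN ⟨hTI.1, hTI.2.le⟩ ⟨by linarith, h1.le⟩ (by linarith)) hT
    have hroot : ∀ e > 0, T + e < η → T - e > 0 → ∀ᶠ s in 𝓝 0,
        ∃ t ∈ Ioo (T - e) (T + e), h s t = 0 := by
      intro e he h1 h2
      filter_upwards [hbr e he h1 h2, hzN] with s h3 h4
      obtain ⟨t, ht, ht0⟩ := intermediate_value_Icc' (show T - e ≤ T + e by linarith)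
        (fun t ht => (hder s h4 t ⟨by linarith [ht.1], by linarith [ht.2]⟩).continuousAt.continuousWithinAt)
        ⟨h3.2.le, h3.1.le⟩
      exact ⟨t, ⟨lt_of_le_of_ne ht.1 (by rintro rfl; exact h3.1.ne' ht0),
        lt_of_le_of_ne ht.2 (by rintro rfl; exact h3.2.ne ht0)⟩, ht0⟩
    obtain ⟨e₀, he₀, he1, he2⟩ : ∃ e > 0, T + e < η ∧ T - e > 0 :=
      ⟨min ((η - T) / 2) (T / 2), lt_min (by linarith) (by linarith),
        by linarith [min_le_left ((η - T) / 2) (T / 2)],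
        by linarith [min_le_right ((η - T) / 2) (T / 2)]⟩
    have hex : ∀ s, ∃ t, (∃ t ∈ Icc 0 η, h s t = 0) → t ∈ Icc 0 η ∧ h s t = 0 := fun s => by
      by_cases H : ∃ t ∈ Icc 0 η, h s t = 0
      · obtain ⟨t, ht⟩ := H; exact ⟨t, fun _ => ht⟩
      · exact ⟨0, fun H' => absurd H' H⟩
    choose τ hτ using hex
    have hτev : ∀ e > 0, T + e < η → T - e > 0 → ∀ᶠ s in 𝓝 0,
        τ s ∈ Ioo (T - e) (T + e) ∧ h s (τ s) = 0 := by
      intro e he h1 h2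
      filter_upwards [hroot e he h1 h2, hzN] with s ⟨t, ht, ht0⟩ h4
      have htI : t ∈ Icc 0 η := ⟨by linarith [ht.1], by linarith [ht.2]⟩
      obtain ⟨h5, h6⟩ := hτ s ⟨t, htI, ht0⟩
      have : τ s = t := (hanti s h4).injOn h5 htI (by rw [h6, ht0])
      exact ⟨by rwa [this], h6⟩
    have hτ0 : τ 0 = T := by
      obtain ⟨h5, h6⟩ := hτ 0 ⟨T, ⟨hTI.1, hTI.2.le⟩, hT⟩
      exact (hanti 0 hN).injOn h5 ⟨hTI.1, hTI.2.le⟩ (by rw [h6, hT])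
    have hτc : ContinuousAt τ 0 := by
      rw [Metric.continuousAt_iff']
      intro e he
      have hm := min_le_left e e₀
      have hm' := min_le_right e e₀
      filter_upwards [hτev (min e e₀) (lt_min he he₀) (by linarith) (by linarith)] with s hs
      rw [Real.dist_eq, hτ0, abs_lt]
      constructor <;> linarith [hs.1.1, hs.1.2]
    have hτd : DifferentiableAt ℝ τ 0 := by
      have hfd := (coord₀ n).hasFDerivAt.comp ((0 : ℝ), T) (hC T hTI)
      -- Non-tangentiality enters here: the time derivative of the height at the hit is the negative
      -- normal velocity.
      refine (hasDerivAt_of_zero hfd rfl rfl ?_ hτ0 hτc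
        ((hτev e₀ he₀ he1 he2).mono fun s hs => hs.2)).differentiableAt
      have := hneg _ hN T (hsub ⟨hTI.1, hTI.2.le⟩)
      simpa using this.ne
    obtain ⟨γ, σ', H⟩ := hF.exists_isPropagation hg hε h₀ hAx.le hxy hyB hη hs ha ha0 hσ hσ0 hN
      (b := fun s => a s + τ s) (ha.add hτd) (by simp [ha0, hτ0, hTd]) (by
        filter_upwards [hzN, hτev e₀ he₀ he1 he2] with s h1 h2 t ht
        rw [add_sub_cancel_left] at ht
        exact lt_of_eq_of_lt h2.2.symm (hanti s h1 ⟨ht.1.le, by linarith [ht.2, h2.1.2]⟩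
          ⟨by linarith [h2.1.1], by linarith [h2.1.2]⟩ ht.2))
      (fun _ => by
        filter_upwards [hτev e₀ he₀ he1 he2] with s h2
        rw [add_sub_cancel_left]
        exact h2.2)
    exact ⟨_, γ, σ', H⟩

end Flow

/-- Induction on intervals over flow boxes. At the start an inward velocity makes the height
increase at once, at interior times the height remains positive, and at the end the exit case
applies; the pieces compose at interior points. -/
theorem IsArc.propagates [T2Space M] (hg : IsC1Family ε g) (hε : 0 < ε)
    (h₀ : IsArc (g 0) γ₀ A B) (hA : γ₀ A ∈ (𝓡∂ n).boundary M)
    (hA' : 0 < normalCoord (velocityOn (n := n) γ₀ A B A)) (hB : γ₀ B ∈ (𝓡∂ n).boundary M)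
    (hB' : normalCoord (velocityOn (n := n) γ₀ A B B) < 0) : Propagates g γ₀ A B A B := by
  -- The guard `x < y` excludes degenerate arcs, which the induction on intervals would otherwise
  -- require.
  refine interval_induction (P := fun x y => x < y → Propagates g γ₀ A B x y) h₀.lt.le
    (fun x y z hx hxy hyz hz h1 h2 hxz => ?_) (fun r hr => ?_) h₀.lt
  · rcases eq_or_lt_of_le hxy with rfl | hxy
    · exact h2 hxz
    rcases eq_or_lt_of_le hyz with rfl | hyz
    · exact h1 hxz
    exact (h1 hxy).trans (h₀.mem_interior y ⟨hx.trans_lt hxy, hyz.trans_le hz⟩) (h2 hyz)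
  set x₀ := γ₀ r with hx₀
  have hs : γ₀ r ∈ (extChartAt (𝓡∂ n) x₀).source := mem_extChartAt_source _
  set z := chartState x₀ (state (n := n) γ₀ A B r) with hz
  have hzt : z.1 ∈ (extChartAt (𝓡∂ n) x₀).target := (extChartAt (𝓡∂ n) x₀).map_source hs
  have hc1 : Continuous fun p : ℝ × (V n × V n) => p.2.1 0 :=
    (coord₀ n).continuous.comp (continuous_fst.comp continuous_snd)
  have hc2 : Continuous fun p : ℝ × (V n × V n) => p.2.2 0 :=
    (coord₀ n).continuous.comp (continuous_snd.comp continuous_snd)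
  rcases eq_or_ne r B with rfl | hrB
  · have hv : z.2 0 < 0 := by
      obtain ⟨c, hc, hcv⟩ := hat_coord₀ hs hB
      rw [show z.2 0 = _ from hcv _]
      exact mul_neg_of_pos_of_neg hc hB'
    obtain ⟨η, N, hN, acl, C, U, hF⟩ := hg.exists_geodesicFlow hε x₀ hzt z.2
      (O := {p | p.2.2 0 < 0}) ((isOpen_lt hc2 continuous_const).mem_nhds hv)
    obtain ⟨δ, hδ, hδη, hnear⟩ := h₀.exists_near hr hs hN (half_pos hF.pos)
    -- The bound `r - A` keeps `x` away from `A`, so the exit piece begins in the interior; `δ ≤ η /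
    -- 2` keeps its length below `η`.
    refine ⟨min δ (r - A), lt_min hδ (sub_pos.2 h₀.lt), fun x y hx _ hy hxr hyr hxy => ?_⟩
    rw [lt_min_iff, abs_lt] at hxr
    obtain ⟨h1, h2⟩ := hnear x ⟨hx, by linarith⟩ (abs_lt.2 hxr.1)
    refine hF.propagates_exit hg hε h₀ hB ?_ hxy hy (by linarith) h1 h2
      fun p hp t ht => hF.mem p hp t ht
    have := hxr.2
    rw [abs_lt] at this
    linarith
  · have key : ∃ O ∈ 𝓝 ((0 : ℝ), z), ∀ {η N acl C U}, IsGeodesicFlow g x₀ η N O acl C U →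
        ∀ s z, (s, z) ∈ N → z.1 ∈ (extChartAt (𝓡∂ n) x₀).target → ∀ t ∈ Ioc 0 η,
          0 < C (s, z) t 0 := by
      rcases eq_or_ne r A with rfl | hrA
      · have hv : 0 < z.2 0 := by
          obtain ⟨c, hc, hcv⟩ := hat_coord₀ hs hA
          rw [show z.2 0 = _ from hcv _]
          exact mul_pos hc hA'
        refine ⟨{p | 0 < p.2.2 0}, (isOpen_lt continuous_const hc2).mem_nhds hv, ?_⟩
        intro η N acl C U hF s z hzN hz t ht
        have hsub : Icc 0 η ⊆ Icc (-η) η := Icc_subset_Icc_left (by linarith [hF.pos])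
        have hder : ∀ t ∈ Icc 0 η, HasDerivAt (fun t => C (s, z) t 0) (U (s, z) t 0) t :=
          fun t ht => (coord₀ n).hasFDerivAt.comp_hasDerivAt t
            (hF.hasDerivAt_C _ hzN t (hsub ht))
        have hmono : StrictMonoOn (fun t => C (s, z) t 0) (Icc 0 η) :=
          strictMonoOn_of_deriv_pos (convex_Icc 0 η)
            (fun t ht => (hder t ht).continuousAt.continuousWithinAt) (fun t ht => by
              rw [interior_Icc] at ht
              rw [(hder t (Ioo_subset_Icc_self ht)).deriv]
              exact hF.mem _ hzN t (hsub (Ioo_subset_Icc_self ht)))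
        have h1 := hmono ⟨le_rfl, hF.pos.le⟩ (Ioc_subset_Icc_self ht) ht.1
        have h2 : 0 ≤ C (s, z) 0 0 := by
          rw [(hF.initial _ hzN).1]
          exact (mem_chart_target.1 hz).2
        exact h2.trans_lt h1
      · have hi : 0 < z.1 0 := (mem_interior_iff_coord hs).1
          (h₀.mem_interior r ⟨lt_of_le_of_ne hr.1 hrA.symm, lt_of_le_of_ne hr.2 hrB⟩)
        refine ⟨{p | 0 < p.2.1 0}, (isOpen_lt continuous_const hc1).mem_nhds hi, ?_⟩
        intro η N acl C U hF s z hzN _ t ht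
        exact hF.mem _ hzN t ⟨by linarith [hF.pos, ht.1], ht.2⟩
    obtain ⟨O, hO, key⟩ := key
    obtain ⟨η, N, hN, acl, C, U, hF⟩ := hg.exists_geodesicFlow hε x₀ hzt z.2 hO
    obtain ⟨δ, hδ, hδη, hnear⟩ := h₀.exists_near hr hs hN (half_pos hF.pos)
    refine ⟨δ, hδ, fun x y hx _ hy hxr hyr hxy => ?_⟩
    obtain ⟨h1, h2⟩ := hnear x ⟨hx, by linarith⟩ hxr
    rw [abs_lt] at hxr hyr
    exact hF.propagates_of_pos hg hε h₀ hx hxy hy (by linarith) h1 h2 (key hF)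

end Segments

/-! ### The reflection law and its effect on families. -/

section Reflection

open Set Filter

variable {n : ℕ} [NeZero n] {M : Type*} [TopologicalSpace M]
  [ChartedSpace (EuclideanHalfSpace n) M] [IsManifold (𝓡∂ n) ∞ M]

/-! ### The reflection law -/

theorem normalCoord_sub {p : M} (v w : TangentSpace (𝓡∂ n) p) :
    normalCoord (v - w) = normalCoord v - normalCoord w :=
  map_sub (coord₀ n) (show V n from v) (show V n from w)

theorem normalCoord_smul {p : M} (k : ℝ) (v : TangentSpace (𝓡∂ n) p) :
    normalCoord (k • v) = k * normalCoord v :=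
  map_smul (coord₀ n) k (show V n from v)

theorem IsOuterUnitNormal.inner_eq {g : Metric n M} {p : M} {ν : TangentSpace (𝓡∂ n) p}
    (h : IsOuterUnitNormal g p ν) (w : TangentSpace (𝓡∂ n) p) :
    g.inner p ν w = normalCoord w / normalCoord ν := by
  have h0 := h.1.ne
  have h1 := h.2.2 (w - (normalCoord w / normalCoord ν) • ν) (by
    rw [normalCoord_sub, normalCoord_smul, div_mul_cancel₀ _ h0, sub_self])
  rw [map_sub, map_smul, h.2.1, smul_eq_mul, mul_one, sub_eq_zero] at h1
  exact h1

theorem inner_sub_smul (g : Metric n M) {p : M} (v ν w : TangentSpace (𝓡∂ n) p) (k : ℝ) :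
    g.inner p (v - k • ν) w = g.inner p v w - k * g.inner p ν w := by
  rw [g.symm, map_sub, map_smul, g.symm p w v, g.symm p w ν]
  rfl

/-- With `k` the ratio of the normal coordinates, `ν - k • ν'` is tangential, hence orthogonal to
both normals and so to itself; unit length and the common sign force `k = 1`. -/
theorem IsOuterUnitNormal.unique {g : Metric n M} {p : M} {ν ν' : TangentSpace (𝓡∂ n) p}
    (h : IsOuterUnitNormal g p ν) (h' : IsOuterUnitNormal g p ν') : ν = ν' := by
  set k := normalCoord ν / normalCoord ν' with hk
  have hk0 : 0 < k := div_pos_of_neg_of_neg h.1 h'.1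
  set w := ν - k • ν' with hw
  have hw0 : normalCoord w = 0 := by
    rw [hw, normalCoord_sub, normalCoord_smul, hk, div_mul_cancel₀ _ h'.1.ne, sub_self]
  have hww : g.inner p w w = 0 := by
    have h1 : g.inner p w w = g.inner p ν w - k * g.inner p ν' w := by
      conv_lhs => rw [hw, inner_sub_smul, ← hw]
    rw [h1, h.2.2 w hw0, h'.2.2 w hw0]
    ring
  have hwz : w = 0 := by
    by_contra hne
    exact (g.pos p w hne).ne' hww
  have hν : ν = k • ν' := sub_eq_zero.1 hwz
  have hk1 : k * k = 1 := by
    have h1 := h.2.1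
    have h2 : g.inner p (k • ν') (k • ν') = k * (k * g.inner p ν' ν') := by
      rw [map_smul, map_smul]
      rfl
    rw [hν, h2, h'.2.1] at h1
    linarith
  have : k = 1 := by nlinarith
  rw [hν, this, one_smul]

theorem IsReflection.unique {g : Metric n M} {p : M} {v w w' : TangentSpace (𝓡∂ n) p}
    (h : IsReflection g p v w) (h' : IsReflection g p v w') : w = w' := by
  obtain ⟨ν, hν, rfl⟩ := h
  obtain ⟨ν', hν', rfl⟩ := h'
  rw [hν.unique hν']

theorem IsReflection.normalCoord_eq {g : Metric n M} {p : M} {v w : TangentSpace (𝓡∂ n) p}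
    (h : IsReflection g p v w) : normalCoord w = -normalCoord v := by
  obtain ⟨ν, hν, rfl⟩ := h
  rw [normalCoord_sub, normalCoord_smul, g.symm, hν.inner_eq]
  have := hν.1.ne
  field_simp
  ring

theorem IsReflection.inner_self {g : Metric n M} {p : M} {v w : TangentSpace (𝓡∂ n) p}
    (h : IsReflection g p v w) : g.inner p w w = g.inner p v v := by
  obtain ⟨ν, hν, rfl⟩ := h
  set k := 2 * g.inner p v ν with hk
  have h1 : g.inner p (v - k • ν) (v - k • ν) =
      g.inner p v v - k * g.inner p v ν - k * (g.inner p ν v - k * g.inner p ν ν) := by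
    rw [inner_sub_smul, g.symm p v (v - k • ν), g.symm p ν (v - k • ν), inner_sub_smul,
      inner_sub_smul, g.symm p ν v]
  rw [h1, hν.2.1, g.symm p ν v, hk]
  ring

/-- The reflection law in coordinates. -/
def reflectChart (G : V n →L[ℝ] V n →L[ℝ] ℝ) (v : V n) : V n :=
  v - (2 * v 0 / G.inverse (coord₀ n) 0) • G.inverse (coord₀ n)

/-- `G.inverse (coord₀ n)` is the metric gradient of the height, orthogonal to the boundary; its
zeroth coordinate is its squared length. -/
theorem inverse_coord₀_pos {G : V n →L[ℝ] V n →L[ℝ] ℝ} (hG : ∀ v, v ≠ 0 → 0 < G v v) :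
    0 < G.inverse (coord₀ n) 0 := by
  have h := apply_inverse_of_pos hG (coord₀ n)
  have h1 : G (G.inverse (coord₀ n)) (G.inverse (coord₀ n)) = G.inverse (coord₀ n) 0 := by
    rw [h]; rfl
  rw [← h1]
  refine hG _ fun h0 => ?_
  rw [h0, map_zero] at h
  exact coord₀_pos.ne (DFunLike.congr_fun h _)

/-- The outer unit normal is the gradient `m` of the height divided by `-√(m 0)`. In the reflection
law the square root cancels, which leaves a formula differentiable in the metric and in the vector.
-/
theorem exists_isReflection (g : Metric n M) {x₀ p : M}
    (hp : p ∈ (extChartAt (𝓡∂ n) x₀).source) (hb : p ∈ (𝓡∂ n).boundary M)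
    (v : TangentSpace (𝓡∂ n) p) :
    IsReflection g p v (unhat x₀ p
      (reflectChart (coordMetric g x₀ (extChartAt (𝓡∂ n) x₀ p)) (hat x₀ p v))) := by
  set G := coordMetric g x₀ (extChartAt (𝓡∂ n) x₀ p) with hG
  have hpos : ∀ v, v ≠ 0 → 0 < G v v := fun v hv =>
    coordMetric_pos g ((extChartAt (𝓡∂ n) x₀).map_source hp) hv
  set m := G.inverse (coord₀ n) with hm
  have hm0 : 0 < m 0 := inverse_coord₀_pos hpos
  have hmw : ∀ w, G m w = w 0 := fun w => by rw [hm, apply_inverse_of_pos hpos]; rfl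
  set k := √(m 0) with hk
  have hk0 : 0 < k := Real.sqrt_pos.2 hm0
  have hkk : k * k = m 0 := Real.mul_self_sqrt hm0.le
  set ν : TangentSpace (𝓡∂ n) p := unhat x₀ p (-(k⁻¹ • m)) with hν
  have hνh : hat x₀ p ν = -(k⁻¹ • m) := hat_unhat hp _
  have hνw : ∀ w, g.inner p ν w = -(k⁻¹ * (hat x₀ p w) 0) := fun w => by
    rw [inner_eq_coordMetric g hp, hνh, ← hG, map_neg, map_smul, neg_apply, smul_apply, hmw]
    rfl
  obtain ⟨c, hc, hcv⟩ := hat_coord₀ hp hb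
  refine ⟨ν, ⟨?_, ?_, fun w hw => ?_⟩, ?_⟩
  · have h1 := hcv ν
    rw [hνh] at h1
    have h2 : (-(k⁻¹ • m)) 0 = -(k⁻¹ * m 0) := by simp
    rw [h2] at h1
    have h3 : 0 < k⁻¹ * m 0 := mul_pos (inv_pos.2 hk0) hm0
    nlinarith
  · rw [hνw, hνh]
    have h2 : (-(k⁻¹ • m)) 0 = -(k⁻¹ * m 0) := by simp
    rw [h2, ← hkk]
    field_simp
  · rw [hνw, hcv, hw]
    simp
  · refine hat_injective hp ?_
    rw [hat_unhat hp, map_sub, map_smul, hνh, g.symm, hνw, reflectChart, ← hm, smul_neg, smul_smul,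
      ← hkk]
    rw [sub_eq_sub_iff_add_eq_add, add_right_inj, ← neg_smul]
    congr 1
    field_simp

/-- Differentiable families of unit vectors at the boundary can be reflected. -/
theorem IsUnitFamily.exists_reflection {ε : ℝ} {g : ℝ → Metric n M} (hg : IsC1Family ε g)
    (hε : 0 < ε) {σ : ℝ → TangentBundle (𝓡∂ n) M} (hσ : IsUnitFamily g σ)
    (hb : ∀ᶠ s in 𝓝 0, (σ s).proj ∈ (𝓡∂ n).boundary M) :
    ∃ σ', IsUnitFamily g σ' ∧ momentum (g 0) σ' = momentum (g 0) σ ∧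
      ∀ᶠ s in 𝓝 0, ∃ w : TangentSpace (𝓡∂ n) (σ s).proj, σ' s = ⟨(σ s).proj, w⟩ ∧
        IsReflection (g s) (σ s).proj (σ s).snd w := by
  set x₀ := (σ 0).proj with hx₀
  have hs0 : (σ 0).proj ∈ (extChartAt (𝓡∂ n) x₀).source := mem_extChartAt_source _
  obtain ⟨hc, hd⟩ := (mdifferentiableAt_iff_chartState hs0).1 hσ.mdifferentiableAt
  have hsrc := hc.eventually_mem ((isOpen_extChartAt_source x₀).mem_nhds hs0)
  set y : ℝ → V n := fun s => (chartState x₀ (σ s)).1 with hy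
  set v : ℝ → V n := fun s => (chartState x₀ (σ s)).2 with hv
  have hyt : ∀ᶠ s in 𝓝 0, y s ∈ (extChartAt (𝓡∂ n) x₀).target :=
    hsrc.mono fun s hs => (extChartAt (𝓡∂ n) x₀).map_source hs
  have hyd : HasDerivAt y (deriv y 0) 0 := (show DifferentiableAt ℝ y 0 from hd.fst).hasDerivAt
  have hvd : DifferentiableAt ℝ v 0 := hd.snd
  set I : ℝ → (V n →L[ℝ] ℝ) →L[ℝ] V n := fun s => (coordMetric (g s) x₀ (y s)).inverse with hI
  have hId : DifferentiableAt ℝ I 0 := by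
    have h1 := ((hg.contDiffOn_inverse x₀).differentiableOn one_ne_zero (0, y 0)
      ⟨⟨by linarith, hε⟩, hyt.self_of_nhds⟩).hasFDerivWithinAt
    exact (h1.comp_hasDerivAt_of_eq (f := fun s => (s, y s)) 0
      ((hasDerivAt_id (0 : ℝ)).prodMk hyd) (by
        filter_upwards [Ioo_mem_nhds (show -ε < 0 by linarith) hε, hyt] with s h1 h2
        exact ⟨h1, h2⟩) rfl).differentiableAt
  have hpos : ∀ᶠ s in 𝓝 0, ∀ v, v ≠ 0 → 0 < coordMetric (g s) x₀ (y s) v v := by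
    filter_upwards [hyt] with s h v hv using coordMetric_pos (g s) h hv
  set r : ℝ → V n := fun s => reflectChart (coordMetric (g s) x₀ (y s)) (v s) with hr
  have hrd : DifferentiableAt ℝ r 0 := by
    have h1 : DifferentiableAt ℝ (fun s => I s (coord₀ n)) 0 :=
      hId.clm_apply (differentiableAt_const _)
    have h2 : DifferentiableAt ℝ (fun s => I s (coord₀ n) 0) 0 :=
      (coord₀ n).differentiableAt.comp 0 h1
    have h3 : DifferentiableAt ℝ (fun s => v s 0) 0 := (coord₀ n).differentiableAt.comp 0 hvd
    exact hvd.sub (((h3.const_mul 2).div h2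
      (inverse_coord₀_pos hpos.self_of_nhds).ne').smul h1)
  set σ' : ℝ → TangentBundle (𝓡∂ n) M := fun s =>
    ⟨(σ s).proj, unhat x₀ (σ s).proj (r s)⟩ with hσ'
  have hcs : (fun s => chartState x₀ (σ' s)) =ᶠ[𝓝 0] fun s => (y s, r s) := by
    filter_upwards [hsrc] with s hs
    exact Prod.ext rfl (hat_unhat hs _)
  have hσ'd : MDifferentiableAt 𝓘(ℝ, ℝ) (𝓡∂ n).tangent σ' 0 :=
    (mdifferentiableAt_iff_chartState (σ := σ') hs0).2
      ⟨hc, (hyd.differentiableAt.prodMk hrd).congr_of_eventuallyEq hcs⟩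
  have hrefl : ∀ᶠ s in 𝓝 0, IsReflection (g s) (σ s).proj (σ s).snd
      (unhat x₀ (σ s).proj (r s)) := by
    filter_upwards [hsrc, hb] with s h1 h2
    exact exists_isReflection (g s) h1 h2 _
  refine ⟨σ', ⟨hσ'd, ?_⟩, ?_, ?_⟩
  · filter_upwards [hrefl, hσ.unit] with s h1 h2
    rw [← h2]
    exact h1.inner_self
  -- The base points have height zero for all small `s`, so their derivative is tangential.
  · have h1 : (deriv y 0) 0 = 0 := by
      have h2 : HasDerivAt (fun s => y s 0) ((deriv y 0) 0) 0 :=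
        (coord₀ n).hasFDerivAt.comp_hasDerivAt 0 hyd
      refine h2.unique ((hasDerivAt_const (0 : ℝ) (0 : ℝ)).congr_of_eventuallyEq ?_)
      filter_upwards [hsrc, hb] with s h3 h4
      exact (mem_boundary_iff_coord h3).1 h4
    rw [momentum_eq (σ := σ') hs0 hσ'd (w := deriv y 0) hyd, momentum_eq hs0 hσ.mdifferentiableAt hyd]
    rw [show chartState x₀ (σ' 0) = (y 0, r 0) from hcs.self_of_nhds]
    change coordMetric (g 0) x₀ (y 0) (r 0) (deriv y 0) =
      coordMetric (g 0) x₀ (y 0) (v 0) (deriv y 0)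
    -- The reflected vector differs by a multiple of the normal, which is orthogonal to the
    -- tangential derivative of the base point; so the momentum does not change.
    have h5 : coordMetric (g 0) x₀ (y 0) ((coordMetric (g 0) x₀ (y 0)).inverse (coord₀ n))
        (deriv y 0) = 0 := by
      rw [apply_inverse_of_pos hpos.self_of_nhds]
      exact h1
    rw [hr]
    simp only [reflectChart]
    rw [map_sub, map_smul, sub_apply, smul_apply, h5]
    simp
  · filter_upwards [hrefl] with s h1
    exact ⟨_, rfl, h1⟩

end Reflection

/-! ### Broken rays as chains of arcs: uniqueness and extension. -/

section Rays

open Set Filter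

variable {n : ℕ} [NeZero n] {M : Type*} [TopologicalSpace M]
  [ChartedSpace (EuclideanHalfSpace n) M] [IsManifold (𝓡∂ n) ∞ M]

/-! ### Broken rays as sequences of arcs -/

/-- The reflection law for points of the tangent bundle. -/
def Reflects (g : Metric n M) (p q : TangentBundle (𝓡∂ n) M) : Prop :=
  ∃ w : TangentSpace (𝓡∂ n) p.proj, q = ⟨p.proj, w⟩ ∧ IsReflection g p.proj p.snd w

theorem Reflects.unique {g : Metric n M} {p q q' : TangentBundle (𝓡∂ n) M} (h : Reflects g p q)
    (h' : Reflects g p q') : q = q' := by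
  obtain ⟨w, rfl, hw⟩ := h
  obtain ⟨w', rfl, hw'⟩ := h'
  rw [hw.unique hw']

theorem Reflects.normSq_eq {g : Metric n M} {p q : TangentBundle (𝓡∂ n) M} (h : Reflects g p q) :
    normSq g q = normSq g p := by
  obtain ⟨w, rfl, hw⟩ := h
  exact hw.inner_self

theorem Reflects.isReflection {g : Metric n M} {γ : ℝ → M} {a b c : ℝ}
    (h : Reflects g (state γ a b b) (state γ b c b)) :
    IsReflection g (γ b) (velocityOn γ a b b) (velocityOn γ b c b) := by
  obtain ⟨w, hw, h⟩ := h
  have h1 : velocityOn γ b c b = w := eq_of_heq (Bundle.TotalSpace.mk.inj hw).2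
  rw [h1]
  exact h

variable {g : Metric n M} {E R : Set M} {x : M} {v : TangentSpace (𝓡∂ n) x} {N : ℕ} {t : ℕ → ℝ}
  {γ : ℝ → M}

theorem isBrokenRay_of_arcs (h0 : t 0 = 0) (harc : ∀ i ≤ N, IsArc g γ (t i) (t (i + 1)))
    (hunit : ∀ i ≤ N, normSq g (state γ (t i) (t (i + 1)) (t i)) = 1)
    (hstart : state γ (t 0) (t 1) (t 0) = ⟨x, v⟩) (hmem : ∀ i < N, γ (t (i + 1)) ∈ R)
    (hrefl : ∀ i < N, Reflects g (state γ (t i) (t (i + 1)) (t (i + 1)))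
      (state γ (t (i + 1)) (t (i + 2)) (t (i + 1)))) (hexit : γ (t (N + 1)) ∈ E) :
    IsBrokenRay g E R x v N t γ where
  time_zero := h0
  time_lt i hi := (harc i hi).lt
  contMDiffOn i hi := (harc i hi).contMDiffOn
  mem_interior i hi := (harc i hi).mem_interior
  geodesic i hi := (harc i hi).geodesic
  unit_speed i hi r hr := ((harc i hi).normSq_const hr).trans (hunit i hi)
  start := by rw [← hstart, h0]; rfl
  reflect_mem := hmem
  reflect_law i hi := (hrefl i hi).isReflection
  exit_mem := hexit

namespace IsBrokenRay

theorem isArc (h : IsBrokenRay g E R x v N t γ) {i : ℕ} (hi : i ≤ N) :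
    IsArc g γ (t i) (t (i + 1)) :=
  ⟨h.time_lt i hi, h.contMDiffOn i hi, h.mem_interior i hi, h.geodesic i hi⟩

theorem normSq_state (h : IsBrokenRay g E R x v N t γ) {i : ℕ} (hi : i ≤ N) {r : ℝ}
    (hr : r ∈ Icc (t i) (t (i + 1))) : normSq g (state γ (t i) (t (i + 1)) r) = 1 :=
  h.unit_speed i hi r hr

theorem start_state (h : IsBrokenRay g E R x v N t γ) :
    state γ (t 0) (t 1) (t 0) = ⟨x, v⟩ := by
  have := h.start
  rw [state, ← this, h.time_zero]

theorem reflects (h : IsBrokenRay g E R x v N t γ) {i : ℕ} (hi : i < N) :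
    Reflects g (state γ (t i) (t (i + 1)) (t (i + 1)))
      (state γ (t (i + 1)) (t (i + 2)) (t (i + 1))) := ⟨_, rfl, h.reflect_law i hi⟩

theorem time_mono (h : IsBrokenRay g E R x v N t γ) {i j : ℕ} (hij : i ≤ j) (hj : j ≤ N + 1) :
    t i ≤ t j := by
  induction j, hij using Nat.le_induction with
  | base => exact le_rfl
  | succ k hk ih => exact (ih (by omega)).trans (h.time_lt k (by omega)).le

theorem exists_mem_Icc (h : IsBrokenRay g E R x v N t γ) {r : ℝ} (hr : r ∈ Icc 0 (t (N + 1))) :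
    ∃ i ≤ N, r ∈ Icc (t i) (t (i + 1)) := by
  have key : ∀ k ≤ N, r ≤ t (k + 1) → ∃ i ≤ k, r ∈ Icc (t i) (t (i + 1)) := by
    intro k
    induction k with
    | zero => exact fun _ hr' => ⟨0, le_rfl, by rw [h.time_zero]; exact hr.1, hr'⟩
    | succ k ih =>
      intro hk hr'
      rcases le_total r (t (k + 1)) with h1 | h1
      · obtain ⟨i, hi, hi'⟩ := ih (by omega) h1
        exact ⟨i, by omega, hi'⟩
      · exact ⟨k + 1, le_rfl, h1, hr'⟩
  obtain ⟨i, hi, hi'⟩ := key N le_rfl hr.2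
  exact ⟨i, hi, hi'⟩

theorem mem_boundary (h : IsBrokenRay g E R x v N t γ) (hE : E ⊆ (𝓡∂ n).boundary M)
    (hR : R ⊆ (𝓡∂ n).boundary M) {i : ℕ} (hi : i ≤ N) :
    γ (t (i + 1)) ∈ (𝓡∂ n).boundary M := by
  rcases eq_or_lt_of_le hi with rfl | hi
  · exact hE h.exit_mem
  · exact hR (h.reflect_mem i hi)

end IsBrokenRay

/-! ### Uniqueness of broken rays -/

/-- If one arc were shorter, its boundary end point would be an interior-time point of the longer
one, which lies in the interior of `M`. -/
theorem IsArc.eq_of_boundary [T2Space M] {γ' : ℝ → M} {a b b' : ℝ} (h : IsArc g γ a b)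
    (h' : IsArc g γ' a b') (h0 : state (n := n) γ a b a = state γ' a b' a)
    (hb : γ b ∈ (𝓡∂ n).boundary M) (hb' : γ' b' ∈ (𝓡∂ n).boundary M) :
    b = b' ∧ ∀ r ∈ Icc a b, state (n := n) γ a b r = state γ' a b' r := by
  have key : ∀ {γ γ' : ℝ → M} {b b' : ℝ}, IsArc g γ a b → IsArc g γ' a b' →
      state (n := n) γ a b a = state γ' a b' a → γ b ∈ (𝓡∂ n).boundary M → ¬ b < b' := by
    intro γ γ' b b' h h' h0 hb hlt
    have h1 := h.state_eq (h'.mono le_rfl hlt.le h.lt) (by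
      rw [h0, h'.state_mono le_rfl hlt.le h.lt (left_mem_Icc.2 h.lt.le)]) (right_mem_Icc.2 h.lt.le)
    rw [state_fst h1] at hb
    exact notMem_boundary (h'.mem_interior b ⟨h.lt, hlt⟩) hb
  obtain rfl : b = b' :=
    le_antisymm (not_lt.1 (key h' h h0.symm hb')) (not_lt.1 (key h h' h0 hb))
  exact ⟨rfl, fun r hr => h.state_eq h' h0 hr⟩

theorem IsBrokenRay.unique [T2Space M] (hER : Disjoint E R)
    (hbd : E ∪ R = (𝓡∂ n).boundary M) {N' : ℕ} {t' : ℕ → ℝ} {γ' : ℝ → M}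
    (h : IsBrokenRay g E R x v N t γ) (h' : IsBrokenRay g E R x v N' t' γ') :
    N = N' ∧ (∀ i ≤ N + 1, t i = t' i) ∧ ∀ i ≤ N, ∀ r ∈ Icc (t i) (t (i + 1)),
      state (n := n) γ (t i) (t (i + 1)) r = state γ' (t' i) (t' (i + 1)) r := by
  have hE : E ⊆ (𝓡∂ n).boundary M := hbd ▸ subset_union_left
  have hR : R ⊆ (𝓡∂ n).boundary M := hbd ▸ subset_union_right
  have step : ∀ i, i ≤ N → i ≤ N' → t i = t' i →
      state (n := n) γ (t i) (t (i + 1)) (t i) = state γ' (t' i) (t' (i + 1)) (t' i) →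
      t (i + 1) = t' (i + 1) ∧ ∀ r ∈ Icc (t i) (t (i + 1)),
        state (n := n) γ (t i) (t (i + 1)) r = state γ' (t' i) (t' (i + 1)) r := by
    intro i hi hi' hti hst
    have h1 := h'.isArc hi'
    rw [← hti] at h1 hst ⊢
    exact (h.isArc hi).eq_of_boundary h1 hst (h.mem_boundary hE hR hi) (h'.mem_boundary hE hR hi')
  have main : ∀ i, i ≤ N → i ≤ N' → t i = t' i ∧
      state (n := n) γ (t i) (t (i + 1)) (t i) = state γ' (t' i) (t' (i + 1)) (t' i) := by
    intro i
    induction i with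
    | zero =>
      intro _ _
      exact ⟨by rw [h.time_zero, h'.time_zero], h.start_state.trans h'.start_state.symm⟩
    | succ i ih =>
      intro hi hi'
      obtain ⟨h1, h2⟩ := ih (by omega) (by omega)
      obtain ⟨h3, h4⟩ := step i (by omega) (by omega) h1 h2
      refine ⟨h3, ?_⟩
      have h5 := h.reflects (i := i) (by omega)
      rw [h4 _ (right_mem_Icc.2 (h.time_lt i (by omega)).le)] at h5
      have h6 := h'.reflects (i := i) (by omega)
      rw [← h3] at h6
      have h7 := h5.unique (g := g) (q' := state γ' (t' (i + 1)) (t' (i + 2)) (t' (i + 1))) (by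
        rw [← h3]; exact h6)
      exact h7
  -- The ray with fewer reflections exits in `E` at a point where the other reflects on `R`;
  -- disjointness forbids this.
  have hN : ∀ {N N' : ℕ} {t t' : ℕ → ℝ} {γ γ' : ℝ → M}, IsBrokenRay g E R x v N t γ →
      IsBrokenRay g E R x v N' t' γ' → γ (t (N + 1)) = γ' (t' (N + 1)) → ¬ N < N' := by
    intro N N' t t' γ γ' h h' he hlt
    exact hER.notMem_of_mem_left h.exit_mem (he ▸ h'.reflect_mem N hlt)
  have hend : ∀ i, i ≤ N → i ≤ N' → γ (t (i + 1)) = γ' (t' (i + 1)) := by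
    intro i hi hi'
    obtain ⟨h1, h2⟩ := main i hi hi'
    obtain ⟨h3, h4⟩ := step i hi hi' h1 h2
    have := state_fst (h4 _ (right_mem_Icc.2 (h.time_lt i hi).le))
    rw [this, h3]
  have hNN : N = N' := by
    rcases lt_trichotomy N N' with h1 | h1 | h1
    · exact absurd h1 (hN h h' (hend N le_rfl h1.le))
    · exact h1
    · exact absurd h1 (hN h' h (hend N' h1.le le_rfl).symm)
  subst hNN
  refine ⟨rfl, fun i hi => ?_, fun i hi => ?_⟩
  · rcases Nat.eq_zero_or_pos i with rfl | hpos
    · rw [h.time_zero, h'.time_zero]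
    · obtain ⟨j, rfl⟩ : ∃ j, i = j + 1 := ⟨i - 1, by omega⟩
      obtain ⟨h1, h2⟩ := main j (by omega) (by omega)
      exact (step j (by omega) (by omega) h1 h2).1
  · obtain ⟨h1, h2⟩ := main i hi hi
    exact (step i hi hi h1 h2).2

/-! ### Extension of a broken ray by one arc -/

/-- The times of a broken ray with one more arc. -/
def extendTimes (N : ℕ) (t : ℕ → ℝ) (b : ℝ) (i : ℕ) : ℝ := if i ≤ N + 1 then t i else b

theorem extendTimes_of_le {b : ℝ} {i : ℕ} (h : i ≤ N + 1) : extendTimes N t b i = t i := if_pos h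

theorem extendTimes_last {b : ℝ} : extendTimes N t b (N + 2) = b := if_neg (by omega)

theorem IsBrokenRay.state_extend_of_le (h : IsBrokenRay g E R x v N t γ) {b : ℝ} {γ' : ℝ → M}
    {i : ℕ} (hi : i ≤ N) {r : ℝ} (hr : r ∈ Icc (t i) (t (i + 1))) :
    state (n := n) (joinAt (t (N + 1)) γ γ') (extendTimes N t b i) (extendTimes N t b (i + 1)) r =
      state γ (t i) (t (i + 1)) r := by
  rw [extendTimes_of_le (by omega), extendTimes_of_le (by omega)]
  exact velocityOn_congr (fun r hr => joinAt_left _ _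
    (hr.2.trans (h.time_mono (by omega) (by omega)))) hr

theorem state_extend_last {b : ℝ} {γ' : ℝ → M} (hγ : γ (t (N + 1)) = γ' (t (N + 1))) {r : ℝ}
    (hr : r ∈ Icc (t (N + 1)) b) :
    state (n := n) (joinAt (t (N + 1)) γ γ') (extendTimes N t b (N + 1))
      (extendTimes N t b (N + 2)) r = state γ' (t (N + 1)) b r := by
  rw [extendTimes_of_le le_rfl, extendTimes_last]
  exact velocityOn_congr (fun r hr => joinAt_right hγ hr.1) hr

/-- The old exit point turns into a reflection point, so only its membership in `R` matters; the old
exit set `B` is arbitrary and may differ from the new one. -/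
theorem IsBrokenRay.extend {B : Set M} (h : IsBrokenRay g B R x v N t γ) (hR : γ (t (N + 1)) ∈ R)
    {b : ℝ} {γ' : ℝ → M} (harc : IsArc g γ' (t (N + 1)) b)
    (hrefl : Reflects g (state γ (t N) (t (N + 1)) (t (N + 1)))
      (state γ' (t (N + 1)) b (t (N + 1)))) (hb : γ' b ∈ E) :
    IsBrokenRay g E R x v (N + 1) (extendTimes N t b) (joinAt (t (N + 1)) γ γ') := by
  have hγ : γ (t (N + 1)) = γ' (t (N + 1)) := by
    obtain ⟨w, hw, -⟩ := hrefl
    exact (congrArg Bundle.TotalSpace.proj hw).symm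
  have hl : t (N + 1) ∈ Icc (t (N + 1)) b := left_mem_Icc.2 harc.lt.le
  have hlast : ∀ i ≤ N, t (i + 1) ≤ t (N + 1) := fun i hi => h.time_mono (by omega) (by omega)
  refine isBrokenRay_of_arcs ?_ (fun i hi => ?_) (fun i hi => ?_) ?_ (fun i hi => ?_)
    (fun i hi => ?_) ?_
  · rw [extendTimes_of_le (by omega), h.time_zero]
  · rcases Nat.lt_or_ge i (N + 1) with h1 | h1
    · rw [extendTimes_of_le (by omega), extendTimes_of_le (by omega)]
      exact (h.isArc (by omega)).congr fun r hr => joinAt_left _ _ (hr.2.trans (hlast i (by omega)))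
    · obtain rfl : i = N + 1 := by omega
      rw [extendTimes_of_le le_rfl, extendTimes_last]
      exact harc.congr fun r hr => joinAt_right hγ hr.1
  · rcases Nat.lt_or_ge i (N + 1) with h1 | h1
    · have hi' : i ≤ N := by omega
      have hm := left_mem_Icc.2 (h.time_lt i hi').le
      nth_rewrite 3 [extendTimes_of_le (by omega)]
      rw [h.state_extend_of_le hi' hm]
      exact h.normSq_state hi' hm
    · obtain rfl : i = N + 1 := by omega
      -- The time is generalized separately, so that it can be substituted without rewriting the
      -- interval end points on which the velocity depends.
      have h2 : ∀ τ, τ = t (N + 1) → normSq g (state (joinAt (t (N + 1)) γ γ')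
          (extendTimes N t b (N + 1)) (extendTimes N t b (N + 2)) τ) = 1 := by
        rintro τ rfl
        rw [state_extend_last hγ hl, hrefl.normSq_eq]
        exact h.normSq_state le_rfl (right_mem_Icc.2 (h.time_lt N le_rfl).le)
      exact h2 _ (extendTimes_of_le le_rfl)
  · have hm := left_mem_Icc.2 (h.time_lt 0 (by omega)).le
    nth_rewrite 3 [extendTimes_of_le (by omega)]
    exact (h.state_extend_of_le (i := 0) (by omega) hm).trans h.start_state
  · rw [extendTimes_of_le (by omega), joinAt_left _ _ (hlast i (by omega))]
    rcases Nat.lt_or_ge i N with h1 | h1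
    · exact h.reflect_mem i h1
    · obtain rfl : i = N := by omega
      exact hR
  · have hi' : i ≤ N := by omega
    have hm := right_mem_Icc.2 (h.time_lt i hi').le
    have e3 : extendTimes N t b (i + 1) = t (i + 1) := extendTimes_of_le (by omega)
    have h1 := h.state_extend_of_le (b := b) (γ' := γ') hi' hm
    have h2 : state (n := n) (joinAt (t (N + 1)) γ γ') (extendTimes N t b (i + 1))
        (extendTimes N t b (i + 2)) (t (i + 1)) = if i < N then
          state γ (t (i + 1)) (t (i + 2)) (t (i + 1)) else state γ' (t (N + 1)) b (t (N + 1)) := by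
      rcases Nat.lt_or_ge i N with h1 | h1
      · rw [if_pos h1]
        exact h.state_extend_of_le (i := i + 1) (by omega)
          (left_mem_Icc.2 (h.time_lt (i + 1) (by omega)).le)
      · obtain rfl : i = N := by omega
        rw [if_neg (lt_irrefl _)]
        exact state_extend_last hγ hl
    have h3 : ∀ τ, τ = t (i + 1) → Reflects g
        (state (joinAt (t (N + 1)) γ γ') (extendTimes N t b i) (extendTimes N t b (i + 1)) τ)
        (state (joinAt (t (N + 1)) γ γ') (extendTimes N t b (i + 1)) (extendTimes N t b (i + 2)) τ) := by
      rintro τ rfl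
      rw [h1, h2]
      split_ifs with h4
      · exact h.reflects h4
      · obtain rfl : i = N := by omega
        exact hrefl
    exact h3 _ e3
  · rw [extendTimes_last, joinAt_right hγ harc.lt.le]
    exact hb

end Rays

/-! ### Stability of transversality, and the initial family. -/

section RayFamilies

open Set Filter

variable {n : ℕ} [NeZero n] {M : Type*} [TopologicalSpace M]
  [ChartedSpace (EuclideanHalfSpace n) M] [IsManifold (𝓡∂ n) ∞ M]

/-! ### Families of broken rays -/

/-- A tangent vector that is transversal to the boundary, at a point outside
`closure R ∩ closure E`. -/
def IsTransversal (E R : Set M) (p : TangentBundle (𝓡∂ n) M) : Prop :=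
  p.proj ∉ closure R ∩ closure E ∧ normalCoord p.snd ≠ 0

variable {ε : ℝ} {g : ℝ → Metric n M} {E R : Set M}

theorem isNontangential_iff {N : ℕ} {t : ℕ → ℝ} {γ : ℝ → M} :
    IsNontangential n E R N t γ ↔
      ∀ i ≤ N, IsTransversal (n := n) E R (state γ (t i) (t (i + 1)) (t (i + 1))) := Iff.rfl

/-- The height is nonnegative before `b` and zero at `b`, so the velocity on arrival cannot point
inward; being non-tangential, it points strictly outward. -/
theorem IsArc.normalCoord_neg {g : Metric n M} {γ : ℝ → M} {a b : ℝ} (h : IsArc g γ a b)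
    (hb : γ b ∈ (𝓡∂ n).boundary M) (h0 : normalCoord (velocityOn (n := n) γ a b b) ≠ 0) :
    normalCoord (velocityOn (n := n) γ a b b) < 0 := by
  have hm : b ∈ Icc a b := right_mem_Icc.2 h.lt.le
  have hs : γ b ∈ (extChartAt (𝓡∂ n) (γ b)).source := mem_extChartAt_source _
  obtain ⟨k, hk, hk'⟩ := hat_coord₀ hs hb
  have h1 := (coord₀ n).hasFDerivAt.comp_hasDerivWithinAt b (h.hasDerivWithinAt_fst hm hs)
  have h2 : (coord₀ n) (chartState (γ b) (state (n := n) γ a b b)).2 ≤ 0 := by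
    rw [hasDerivWithinAt_iff_tendsto_slope, Icc_sdiff_right] at h1
    have : (𝓝[Ico a b] b).NeBot := by
      rw [nhdsWithin_Ico_eq_nhdsLT h.lt]; infer_instance
    refine le_of_tendsto h1 ?_
    filter_upwards [self_mem_nhdsWithin, (h.eventually_mem_source hm hs).filter_mono
      (nhdsWithin_mono _ Ico_subset_Icc_self)] with r hr hr'
    have h3 : (coord₀ n) (extChartAt (𝓡∂ n) (γ b) (γ b)) = 0 := (mem_boundary_iff_coord hs).1 hb
    have h4 : 0 ≤ (coord₀ n) (extChartAt (𝓡∂ n) (γ b) (γ r)) :=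
      (mem_chart_target.1 ((extChartAt (𝓡∂ n) (γ b)).map_source hr')).2
    rw [slope_def_field]
    refine div_nonpos_of_nonneg_of_nonpos ?_ (by linarith [hr.2])
    change 0 ≤ (coord₀ n) (extChartAt (𝓡∂ n) (γ b) (γ r)) -
      (coord₀ n) (extChartAt (𝓡∂ n) (γ b) (γ b))
    rwa [h3, sub_zero]
  have h3 : k * normalCoord (velocityOn (n := n) γ a b b) ≤ 0 := by
    rw [← hk']; exact h2
  exact lt_of_le_of_ne (nonpos_of_mul_nonpos_right h3 hk) h0

/-- `normalCoord` uses the preferred chart at a moving point and need not vary continuously. In one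
fixed chart the zeroth velocity coordinate is continuous, and by `hat_coord₀` it vanishes exactly
when `normalCoord` does. -/
theorem IsUnitFamily.eventually_isTransversal {σ : ℝ → TangentBundle (𝓡∂ n) M}
    (hσ : IsUnitFamily g σ) (hb : ∀ᶠ s in 𝓝 0, (σ s).proj ∈ (𝓡∂ n).boundary M)
    (h0 : IsTransversal E R (σ 0)) : ∀ᶠ s in 𝓝 0, IsTransversal E R (σ s) := by
  set x := (σ 0).proj with hx
  have hs : (σ 0).proj ∈ (extChartAt (𝓡∂ n) x).source := mem_extChartAt_source _
  obtain ⟨hc, hd⟩ := (mdifferentiableAt_iff_chartState hs).1 hσ.mdifferentiableAt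
  obtain ⟨k, hk, hk'⟩ := hat_coord₀ hs hb.self_of_nhds
  have h1 : ContinuousAt (fun s => (coord₀ n) (chartState x (σ s)).2) 0 :=
    (coord₀ n).continuous.continuousAt.comp hd.snd.continuousAt
  have h2 : (coord₀ n) (chartState x (σ 0)).2 ≠ 0 := by
    change (hat x (σ 0).proj (σ 0).snd) 0 ≠ 0
    rw [hk']
    exact mul_ne_zero hk.ne' h0.2
  filter_upwards [hb, h1.eventually_ne h2,
    hc.eventually_mem ((isClosed_closure.inter isClosed_closure).isOpen_compl.mem_nhds h0.1),
    hc.eventually_mem ((isOpen_extChartAt_source x).mem_nhds hs)] with s h3 h4 h5 h6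
  refine ⟨h5, fun h7 => h4 ?_⟩
  obtain ⟨k', -, hk'⟩ := hat_coord₀ h6 h3
  change (hat x (σ s).proj (σ s).snd) 0 = 0
  rw [hk', h7, mul_zero]

theorem momentum_congr {g : Metric n M} {σ σ' : ℝ → TangentBundle (𝓡∂ n) M} (h : σ =ᶠ[𝓝 0] σ')
    (hσ : MDifferentiableAt 𝓘(ℝ, ℝ) (𝓡∂ n).tangent σ 0) : momentum g σ = momentum g σ' := by
  have hs : (σ 0).proj ∈ (extChartAt (𝓡∂ n) (σ 0).proj).source := mem_extChartAt_source _
  obtain ⟨-, hd⟩ := (mdifferentiableAt_iff_chartState hs).1 hσ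
  have h1 := (show DifferentiableAt ℝ (fun s => (chartState (σ 0).proj (σ s)).1) 0
    from hd.fst).hasDerivAt
  have h2 := h1.congr_of_eventuallyEq (f₁ := fun s => (chartState (σ 0).proj (σ' s)).1)
    (h.symm.mono fun s hs => by simp only [hs])
  have h0 : σ 0 = σ' 0 := h.self_of_nhds
  rw [momentum_eq hs hσ h1, momentum_eq (by rw [← h0]; exact hs) (hσ.congr_of_eventuallyEq h.symm)
    h2, h0]

/-- The family of unit vectors positively proportional to a given vector. -/
theorem isUnitFamily_unitVector (hg : IsC1Family ε g) (hε : 0 < ε) {x : M}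
    {v : TangentSpace (𝓡∂ n) x} (hv : (g 0).inner x v v = 1) :
    IsUnitFamily g (fun s => (⟨x, unitVector (g s) v⟩ : TangentBundle (𝓡∂ n) M)) ∧
      unitVector (g 0) v = v ∧
      momentum (g 0) (fun s => (⟨x, unitVector (g s) v⟩ : TangentBundle (𝓡∂ n) M)) = 0 := by
  have hs : x ∈ (extChartAt (𝓡∂ n) x).source := mem_extChartAt_source _
  have hv0 : v ≠ 0 := fun h => by simp [h] at hv
  have h1 : DifferentiableAt ℝ (fun s => (g s).inner x v v) 0 := by
    have h := hg.hasDerivAt_coordMetric hε ((extChartAt (𝓡∂ n) x).map_source hs)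
    have h1 := ((h.clm_apply (hasDerivAt_const (0 : ℝ) (hat x x v))).clm_apply
      (hasDerivAt_const (0 : ℝ) (hat x x v))).differentiableAt
    exact h1.congr_of_eventuallyEq (.of_forall fun s => inner_eq_coordMetric (g s) hs v v)
  have hM : MDifferentiableAt 𝓘(ℝ, ℝ) (𝓡∂ n).tangent
      (fun s => (⟨x, unitVector (g s) v⟩ : TangentBundle (𝓡∂ n) M)) 0 := by
    refine (mdifferentiableAt_iff_chartState (x₀ := x)
      (σ := fun s => (⟨x, unitVector (g s) v⟩ : TangentBundle (𝓡∂ n) M)) hs).2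
      ⟨continuousAt_const (y := x), ?_⟩
    refine (differentiableAt_const (extChartAt (𝓡∂ n) x x)).prodMk
      (f₂ := fun s => hat x x (unitVector (g s) v)) ?_
    have h2 : (fun s => hat x x (unitVector (g s) v)) =
        fun s => (√((g s).inner x v v))⁻¹ • hat x x v := by
      funext s
      exact map_smul (hat x x) _ v
    rw [h2]
    exact ((h1.sqrt (by rw [hv]; exact one_ne_zero)).inv (by rw [hv]; simp)).smul_const _
  refine ⟨⟨hM, .of_forall fun s => ?_⟩, by simp [unitVector, hv], ?_⟩
  · have hp := (g s).pos x v hv0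
    change (g s).inner x (unitVector (g s) v) (unitVector (g s) v) = 1
    have h2 : (g s).inner x (unitVector (g s) v) (unitVector (g s) v) =
        (√((g s).inner x v v))⁻¹ * ((√((g s).inner x v v))⁻¹ * (g s).inner x v v) := by
      rw [unitVector, map_smul, map_smul]
      rfl
    rw [h2, ← mul_assoc, ← mul_inv, Real.mul_self_sqrt hp.le, inv_mul_cancel₀ hp.ne']
  · rw [momentum_eq (x₀ := x) hs hM (w := 0)
      (hasDerivAt_const (0 : ℝ) (extChartAt (𝓡∂ n) x x)), map_zero]

end RayFamilies

/-! ### Induction over the reflections. -/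

section RayInduction

open Set Filter

variable {n : ℕ} [NeZero n] {M : Type*} [TopologicalSpace M]
  [ChartedSpace (EuclideanHalfSpace n) M] [IsManifold (𝓡∂ n) ∞ M]

variable {ε : ℝ} {g : ℝ → Metric n M} {E R : Set M} {x₀ : M} {v₀ : TangentSpace (𝓡∂ n) x₀}

/-! ### Existence of the family of broken rays -/

/-- The broken rays `γ' s` of `g s`, with exit set `X` and end state `σ s`, perturb the broken ray
`γ` of `g 0`. -/
structure IsRayFamily (g : ℝ → Metric n M) (E R X : Set M) {x₀ : M}
    (v₀ : TangentSpace (𝓡∂ n) x₀) (N : ℕ) (t : ℕ → ℝ) (γ : ℝ → M) (t' : ℝ → ℕ → ℝ)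
    (γ' : ℝ → ℝ → M) (σ : ℝ → TangentBundle (𝓡∂ n) M) : Prop where
  rays : ∀ᶠ s in 𝓝 0, IsBrokenRay (g s) X R x₀ (unitVector (g s) v₀) N (t' s) (γ' s)
  nontangential : ∀ᶠ s in 𝓝 0, IsNontangential n E R N (t' s) (γ' s)
  exitState_eq : ∀ᶠ s in 𝓝 0, exitState n N (t' s) (γ' s) = σ s
  boundary : ∀ᶠ s in 𝓝 0, (σ s).proj ∈ (𝓡∂ n).boundary M
  differentiableAt : DifferentiableAt ℝ (fun s => t' s (N + 1)) 0
  time_eq : t' 0 (N + 1) = t (N + 1)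
  unitFamily : IsUnitFamily g σ
  state_eq : σ 0 = exitState n N t γ
  intervalIntegrable : IntervalIntegrable (rayIntegrand g γ) MeasureTheory.volume 0 (t (N + 1))
  integral_eq : 1 / 2 * ∫ r in (0 : ℝ)..t (N + 1), rayIntegrand g γ r =
    deriv (fun s => t' s (N + 1)) 0 - momentum (g 0) σ

/-- A point of `S` outside the intersection of the closures has a neighbourhood missing `S'`, and
boundary points in it must lie in `S`. -/
theorem IsUnitFamily.eventually_mem_of_transversal {σ : ℝ → TangentBundle (𝓡∂ n) M} {S S' : Set M}
    (hSS : S ∪ S' = (𝓡∂ n).boundary M)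
    (hσ : IsUnitFamily g σ) (hb : ∀ᶠ s in 𝓝 0, (σ s).proj ∈ (𝓡∂ n).boundary M)
    (h : (σ 0).proj ∈ S) (h0 : (σ 0).proj ∉ closure S ∩ closure S') :
    ∀ᶠ s in 𝓝 0, (σ s).proj ∈ S := by
  have h1 : (σ 0).proj ∈ (closure S')ᶜ := fun h' => h0 ⟨subset_closure h, h'⟩
  filter_upwards [hb, (mdifferentiableAt_proj hσ.mdifferentiableAt).continuousAt.eventually_mem
    (isClosed_closure.isOpen_compl.mem_nhds h1)] with s h2 h3
  rw [← hSS] at h2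
  exact h2.resolve_right fun h4 => h3 (subset_closure h4)

theorem exists_isRayFamily_zero [T2Space M] (hg : IsC1Family ε g) (hε : 0 < ε)
    (hx₀ : x₀ ∈ (𝓡∂ n).boundary M) (hinward : 0 < normalCoord v₀)
    (hunit : (g 0).inner x₀ v₀ v₀ = 1) {t : ℕ → ℝ} {γ : ℝ → M}
    (h : IsBrokenRay (g 0) ((𝓡∂ n).boundary M) R x₀ v₀ 0 t γ) (hn : IsNontangential n E R 0 t γ) :
    ∃ t' γ' σ, IsRayFamily g E R ((𝓡∂ n).boundary M) v₀ 0 t γ t' γ' σ := by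
  obtain ⟨hσ, hσ0, hm⟩ := isUnitFamily_unitVector hg hε hunit
  have harc := h.isArc le_rfl
  have hst := h.start_state
  have hA : γ (t 0) = x₀ := congrArg Bundle.TotalSpace.proj hst
  have hA' : 0 < normalCoord (velocityOn (n := n) γ (t 0) (t 1) (t 0)) := by
    have : ∀ p : TangentBundle (𝓡∂ n) M, p = ⟨x₀, v₀⟩ → 0 < normalCoord p.snd := by
      rintro _ rfl; exact hinward
    exact this _ hst
  have htr := isNontangential_iff.1 hn 0 le_rfl
  have hP := harc.propagates hg hε (by rw [hA]; exact hx₀) hA' h.exit_mem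
    (harc.normalCoord_neg h.exit_mem htr.2)
  obtain ⟨b, γ', σ', P⟩ := hP (fun _ => t 0) _ (differentiableAt_const _) rfl hσ (by
    rw [hσ0]; exact hst.symm)
  have hb := P.boundary h.exit_mem
  have htr' := P.unitFamily.eventually_isTransversal hb (E := E) (R := R) (by
    rw [P.state_end]; exact htr)
  refine ⟨fun s i => if i = 0 then t 0 else b s, γ', σ', ?_, ?_, ?_, hb, ?_, ?_, P.unitFamily,
    P.state_end, ?_, ?_⟩
  · filter_upwards [hb, P.arcs, hσ.unit] with s h1 ⟨h2, h3, h4⟩ h5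
    refine isBrokenRay_of_arcs (by simpa using h.time_zero) (fun i hi => ?_) (fun i hi => ?_) ?_
      (fun i hi => absurd hi (by omega)) (fun i hi => absurd hi (by omega)) ?_
    · obtain rfl : i = 0 := by omega
      simpa using h2
    · obtain rfl : i = 0 := by omega
      simp only [↓reduceIte, zero_add, one_ne_zero]
      rw [h3]
      exact h5
    · simpa using h3
    · have h6 : γ' s (b s) = (σ' s).proj := congrArg Bundle.TotalSpace.proj h4
      simpa [h6] using h1
  · filter_upwards [htr', P.arcs] with s h1 ⟨h2, h3, h4⟩
    refine isNontangential_iff.2 fun i hi => ?_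
    obtain rfl : i = 0 := by omega
    simp only [↓reduceIte, zero_add, one_ne_zero]
    rw [h4]
    exact h1
  · filter_upwards [P.arcs] with s ⟨h2, h3, h4⟩
    simpa [exitState, state] using h4
  · simpa using P.differentiableAt
  · simpa using P.end_eq
  · rw [← h.time_zero]; exact P.intervalIntegrable
  · have := P.integral_eq
    rw [hm, deriv_const, sub_zero, add_zero, h.time_zero] at this
    simpa using this

/-- The end family is reflected without changing its momentum and then propagated along the next
arc, so the integral identities of the two pieces add up with the middle terms cancelling. -/
theorem IsRayFamily.extend [T2Space M] (hg : IsC1Family ε g) (hε : 0 < ε)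
    (hER : E ∪ R = (𝓡∂ n).boundary M) {N : ℕ} {t : ℕ → ℝ} {γ : ℝ → M} {t' : ℝ → ℕ → ℝ}
    {γ' : ℝ → ℝ → M} {σ : ℝ → TangentBundle (𝓡∂ n) M}
    (F : IsRayFamily g E R ((𝓡∂ n).boundary M) v₀ N t γ t' γ' σ)
    (h : IsBrokenRay (g 0) ((𝓡∂ n).boundary M) R x₀ v₀ (N + 1) t γ)
    (hn : IsNontangential n E R (N + 1) t γ) :
    ∃ t' γ' σ, IsRayFamily g E R ((𝓡∂ n).boundary M) v₀ (N + 1) t γ t' γ' σ := by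
  have harc := h.isArc (i := N + 1) le_rfl
  have harcN := h.isArc (i := N) (by omega)
  have hRb : R ⊆ (𝓡∂ n).boundary M := hER ▸ subset_union_right
  have htr := isNontangential_iff.1 hn
  have hrefl := h.reflects (i := N) (by omega)
  have hmemR : γ (t (N + 1)) ∈ R := h.reflect_mem N (by omega)
  have hA : γ (t (N + 1)) ∈ (𝓡∂ n).boundary M := hRb hmemR
  have hneg := harcN.normalCoord_neg hA (htr N (by omega)).2
  have hA' : 0 < normalCoord (velocityOn (n := n) γ (t (N + 1)) (t (N + 2)) (t (N + 1))) := by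
    rw [hrefl.isReflection.normalCoord_eq]
    linarith
  have hP := harc.propagates hg hε hA hA' h.exit_mem
    (harc.normalCoord_neg h.exit_mem (htr (N + 1) le_rfl).2)
  obtain ⟨σ₁, hσ₁, hm, hσσ₁⟩ := F.unitFamily.exists_reflection hg hε F.boundary
  have hσ0 : σ 0 = state (n := n) γ (t N) (t (N + 1)) (t (N + 1)) := F.state_eq
  obtain ⟨b, γ₁, σ', P⟩ := hP (fun s => t' s (N + 1)) σ₁ F.differentiableAt F.time_eq hσ₁ (by
    have h1 : Reflects (g 0) (σ 0) (σ₁ 0) := hσσ₁.self_of_nhds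
    rw [hσ0] at h1
    exact h1.unique hrefl)
  have hb := P.boundary h.exit_mem
  have htr' := P.unitFamily.eventually_isTransversal hb (E := E) (R := R) (by
    rw [P.state_end]; exact htr (N + 1) le_rfl)
  -- The former exit points were only known to be boundary points; to serve as reflection points
  -- they have to be in `R`.
  have hmem := F.unitFamily.eventually_mem_of_transversal (S := R) (S' := E)
    (by rw [union_comm]; exact hER) F.boundary (by rw [hσ0]; exact hmemR)
    (by rw [hσ0]; exact (htr N (by omega)).1)
  have key : ∀ᶠ s in 𝓝 0,
      IsBrokenRay (g s) ((𝓡∂ n).boundary M) R x₀ (unitVector (g s) v₀) (N + 1)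
        (extendTimes N (t' s) (b s)) (joinAt (t' s (N + 1)) (γ' s) (γ₁ s)) ∧
      γ' s (t' s (N + 1)) = γ₁ s (t' s (N + 1)) := by
    filter_upwards [F.rays, F.exitState_eq, hσσ₁, P.arcs, hb, hmem] with s h1 h2 h3 ⟨h4, h5, h6⟩ h7 h8
    have h9 : state (n := n) (γ' s) (t' s N) (t' s (N + 1)) (t' s (N + 1)) = σ s := h2
    have h10 : Reflects (g s) (state (γ' s) (t' s N) (t' s (N + 1)) (t' s (N + 1)))
        (state (γ₁ s) (t' s (N + 1)) (b s) (t' s (N + 1))) := by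
      rw [h9, h5]; exact h3
    have h11 : γ' s (t' s (N + 1)) = (σ s).proj := congrArg Bundle.TotalSpace.proj h9
    refine ⟨h1.extend (by rw [h11]; exact h8) h4 h10 ?_, ?_⟩
    · have : γ₁ s (b s) = (σ' s).proj := congrArg Bundle.TotalSpace.proj h6
      rwa [this]
    · obtain ⟨w, hw, -⟩ := h10
      exact (congrArg Bundle.TotalSpace.proj hw).symm
  refine ⟨fun s => extendTimes N (t' s) (b s), fun s => joinAt (t' s (N + 1)) (γ' s) (γ₁ s), σ',
    key.mono fun s hs => hs.1, ?_, ?_, hb, ?_, ?_, P.unitFamily, P.state_end,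
    F.intervalIntegrable.trans P.intervalIntegrable, ?_⟩
  · filter_upwards [key, F.rays, F.nontangential, P.arcs, htr'] with s ⟨_, h1⟩ h2 h3 ⟨h4, h5, h6⟩ h7
    refine isNontangential_iff.2 fun i hi => ?_
    have h8 : ∀ τ, τ = extendTimes N (t' s) (b s) (i + 1) → IsTransversal E R
        (state (n := n) (joinAt (t' s (N + 1)) (γ' s) (γ₁ s)) (extendTimes N (t' s) (b s) i)
          (extendTimes N (t' s) (b s) (i + 1)) τ) := by
      rintro τ hτ
      rcases Nat.lt_or_ge i (N + 1) with hi' | hi'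
      · rw [extendTimes_of_le (by omega)] at hτ
        rw [hτ, h2.state_extend_of_le (by omega) (right_mem_Icc.2 (h2.time_lt i (by omega)).le)]
        exact isNontangential_iff.1 h3 i (by omega)
      · obtain rfl : i = N + 1 := by omega
        rw [extendTimes_last] at hτ
        rw [hτ, state_extend_last h1 (right_mem_Icc.2 h4.lt.le), h6]
        exact h7
    exact h8 _ rfl
  · filter_upwards [key, P.arcs] with s ⟨_, h1⟩ ⟨h4, h5, h6⟩
    have h8 : ∀ τ, τ = b s → (state (n := n) (joinAt (t' s (N + 1)) (γ' s) (γ₁ s))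
        (extendTimes N (t' s) (b s) (N + 1)) (extendTimes N (t' s) (b s) (N + 2)) τ) = σ' s := by
      rintro τ rfl
      rw [state_extend_last h1 (right_mem_Icc.2 h4.lt.le), h6]
    exact h8 _ extendTimes_last
  · simpa only [extendTimes_last] using P.differentiableAt
  · simpa only [extendTimes_last] using P.end_eq
  · simp only [extendTimes_last]
    rw [← intervalIntegral.integral_add_adjacent_intervals F.intervalIntegrable
      P.intervalIntegrable, mul_add, F.integral_eq, P.integral_eq, hm]
    change _ = deriv b 0 - _
    ring

/-- With the whole boundary as exit set, a broken ray cut off at a reflection point is again a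
broken ray, which makes induction on the number of reflections possible. -/
theorem exists_isRayFamily_boundary [T2Space M] (hg : IsC1Family ε g) (hε : 0 < ε)
    (hER : E ∪ R = (𝓡∂ n).boundary M) (hx₀ : x₀ ∈ (𝓡∂ n).boundary M)
    (hinward : 0 < normalCoord v₀) (hunit : (g 0).inner x₀ v₀ v₀ = 1) {N : ℕ} {t : ℕ → ℝ}
    {γ : ℝ → M} (h : IsBrokenRay (g 0) ((𝓡∂ n).boundary M) R x₀ v₀ N t γ)
    (hn : IsNontangential n E R N t γ) :
    ∃ t' γ' σ, IsRayFamily g E R ((𝓡∂ n).boundary M) v₀ N t γ t' γ' σ := by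
  induction N with
  | zero => exact exists_isRayFamily_zero hg hε hx₀ hinward hunit h hn
  | succ N ih =>
    obtain ⟨t', γ', σ, F⟩ := ih
      { time_zero := h.time_zero
        time_lt := fun i hi => h.time_lt i (by omega)
        contMDiffOn := fun i hi => h.contMDiffOn i (by omega)
        mem_interior := fun i hi => h.mem_interior i (by omega)
        geodesic := fun i hi => h.geodesic i (by omega)
        unit_speed := fun i hi => h.unit_speed i (by omega)
        start := h.start
        reflect_mem := fun i hi => h.reflect_mem i (by omega)
        reflect_law := fun i hi => h.reflect_law i (by omega)
        exit_mem := (hER ▸ subset_union_right : R ⊆ (𝓡∂ n).boundary M) (h.reflect_mem N (by omega)) }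
      fun i hi => hn i (by omega)
    exact F.extend hg hε hER h hn

/-- Once the family is built with exits anywhere on the boundary, the exit points are in `E` for
small `s` because the exit point of `γ` is not in the closure of `R`. -/
theorem IsBrokenRay.exists_isRayFamily [T2Space M] (hg : IsC1Family ε g) (hε : 0 < ε)
    (hER : E ∪ R = (𝓡∂ n).boundary M) (hx₀ : x₀ ∈ E)
    (hinward : 0 < normalCoord v₀) (hunit : (g 0).inner x₀ v₀ v₀ = 1) {N : ℕ} {t : ℕ → ℝ}
    {γ : ℝ → M} (h : IsBrokenRay (g 0) E R x₀ v₀ N t γ) (hn : IsNontangential n E R N t γ) :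
    ∃ t' γ' σ, IsRayFamily g E R E v₀ N t γ t' γ' σ := by
  have hE : E ⊆ (𝓡∂ n).boundary M := hER ▸ subset_union_left
  obtain ⟨t', γ', σ, F⟩ := exists_isRayFamily_boundary hg hε hER (hE hx₀) hinward hunit
    { h with exit_mem := hE h.exit_mem } hn
  have hmem := F.unitFamily.eventually_mem_of_transversal (S := E) (S' := R) hER F.boundary
    (by rw [F.state_eq]; exact h.exit_mem)
    (by rw [F.state_eq, inter_comm]; exact (isNontangential_iff.1 hn N le_rfl).1)
  refine ⟨t', γ', σ, { F with rays := ?_ }⟩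
  filter_upwards [F.rays, F.exitState_eq, hmem] with s h1 h2 h3
  refine { h1 with exit_mem := ?_ }
  rw [← h2] at h3
  exact h3

end RayInduction

/-! ### Existence, uniqueness and the derivative formula for the scattering relation. -/

section Scattering

open Set Filter

variable {n : ℕ} [NeZero n] {M : Type*} [TopologicalSpace M]
  [ChartedSpace (EuclideanHalfSpace n) M] [IsManifold (𝓡∂ n) ∞ M]

variable {ε : ℝ} {g : ℝ → Metric n M} {E R : Set M} {x₀ : M} {v₀ : TangentSpace (𝓡∂ n) x₀}

/-! ### Travel times and the scattering relation -/

theorem exists_mem_Ioo_of_notMem {N : ℕ} {t : ℕ → ℝ} {r : ℝ} (hr : r ∈ Ioo (t 0) (t (N + 1)))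
    (h : ∀ i ≤ N, r ≠ t i) : ∃ i ≤ N, r ∈ Ioo (t i) (t (i + 1)) := by
  have key : ∀ k ≤ N, r < t (k + 1) → ∃ i ≤ k, r ∈ Ioo (t i) (t (i + 1)) := by
    intro k
    induction k with
    | zero => exact fun _ hr' => ⟨0, le_rfl, hr.1, hr'⟩
    | succ k ih =>
      intro hk hr'
      rcases lt_or_gt_of_ne (h (k + 1) hk) with h1 | h1
      · obtain ⟨i, hi, hi'⟩ := ih (by omega) h1
        exact ⟨i, by omega, hi'⟩
      · exact ⟨k + 1, le_rfl, h1, hr'⟩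
  exact key N le_rfl hr.2

/-- Curves that agree segment by segment have equal two-sided velocities except possibly at the
break times, a finite and therefore negligible set. -/
theorem rayTransform_congr
    (f : ∀ x : M, TangentSpace (𝓡∂ n) x → TangentSpace (𝓡∂ n) x → ℝ) {N : ℕ} {t : ℕ → ℝ}
    {γ γ' : ℝ → M} (h0 : t 0 = 0) (hlt : ∀ i ≤ N, t i < t (i + 1))
    (h : ∀ i ≤ N, ∀ r ∈ Icc (t i) (t (i + 1)),
      state (n := n) γ (t i) (t (i + 1)) r = state γ' (t i) (t (i + 1)) r) :
    rayTransform f γ (t (N + 1)) = rayTransform f γ' (t (N + 1)) := by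
  have hmono : ∀ k ≤ N + 1, 0 ≤ t k := by
    intro k
    induction k with
    | zero => exact fun _ => h0.ge
    | succ k ih => exact fun hk => (ih (by omega)).trans (hlt k (by omega)).le
  have hfin : (t '' Iic (N + 1)).Finite := (finite_Iic _).image t
  refine intervalIntegral.integral_congr_ae ?_
  filter_upwards [hfin.countable.ae_notMem MeasureTheory.volume] with r hr hr'
  rw [uIoc_of_le (hmono _ le_rfl)] at hr'
  have hne : ∀ i ≤ N + 1, r ≠ t i := fun i hi hri => hr ⟨i, hi, hri.symm⟩
  obtain ⟨i, hi, hi'⟩ := exists_mem_Ioo_of_notMem (N := N) (t := t)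
    ⟨by rw [h0]; exact hr'.1, lt_of_le_of_ne hr'.2 (hne _ le_rfl)⟩ fun i hi => hne i (by omega)
  have h1 := h i hi r ⟨hi'.1.le, hi'.2.le⟩
  rw [state, state, velocityOn_eq_velocity hi', velocityOn_eq_velocity hi'] at h1
  exact congrArg (fun p : TangentBundle (𝓡∂ n) M => f p.proj p.snd p.snd) h1

/-- Allows results about the constructed family to be transferred to any choice of broken rays with
the same initial vectors. -/
theorem IsBrokenRay.exit_eq [T2Space M] {g : Metric n M} (hER : Disjoint E R)
    (hbd : E ∪ R = (𝓡∂ n).boundary M) {N N' : ℕ} {t t' : ℕ → ℝ} {γ γ' : ℝ → M}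
    (h : IsBrokenRay g E R x₀ v₀ N t γ) (h' : IsBrokenRay g E R x₀ v₀ N' t' γ') :
    t (N + 1) = t' (N' + 1) ∧ exitState n N t γ = exitState n N' t' γ' ∧
      (IsNontangential n E R N t γ → IsNontangential n E R N' t' γ') ∧
      ∀ f, rayTransform (n := n) f γ (t (N + 1)) = rayTransform f γ' (t' (N' + 1)) := by
  obtain ⟨rfl, h1, h2⟩ := h.unique hER hbd h'
  have h3 : ∀ i ≤ N, ∀ r ∈ Icc (t i) (t (i + 1)),
      state (n := n) γ (t i) (t (i + 1)) r = state γ' (t i) (t (i + 1)) r := by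
    intro i hi r hr
    rw [h2 i hi r hr, h1 i (by omega), h1 (i + 1) (by omega)]
  refine ⟨h1 _ le_rfl, ?_, fun h4 => isNontangential_iff.2 fun i hi => ?_, fun f => ?_⟩
  · have := h2 N le_rfl (t (N + 1)) (right_mem_Icc.2 (h.time_lt N le_rfl).le)
    rw [h1 (N + 1) le_rfl] at this
    rw [← h1 (N + 1) le_rfl] at this
    exact this.trans (by rw [h1 (N + 1) le_rfl]; rfl)
  · have h5 := isNontangential_iff.1 h4 i hi
    rw [h2 i hi _ (right_mem_Icc.2 (h.time_lt i hi).le)] at h5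
    exact (h1 (i + 1) (by omega)) ▸ h5
  · rw [rayTransform_congr f h.time_zero h.time_lt h3, h1 _ le_rfl]

theorem momentum_congr_of_velocity {g : Metric n M} {σ σ' : ℝ → TangentBundle (𝓡∂ n) M}
    (h : σ 0 = σ' 0)
    (hv : (⟨(σ 0).proj, velocity (fun s => (σ s).proj) 0⟩ : TangentBundle (𝓡∂ n) M) =
      ⟨(σ' 0).proj, velocity (fun s => (σ' s).proj) 0⟩) : momentum g σ = momentum g σ' := by
  have hs : (σ 0).proj ∈ (extChartAt (𝓡∂ n) (σ 0).proj).source := mem_extChartAt_source _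
  have hs' : (σ' 0).proj ∈ (extChartAt (𝓡∂ n) (σ 0).proj).source := by rw [← h]; exact hs
  have h1 := congrArg (fun p : TangentBundle (𝓡∂ n) M => (chartState (σ 0).proj p).2) hv
  have h2 := congrArg (fun p : TangentBundle (𝓡∂ n) M => chartState (σ 0).proj p) h
  have e1 : momentum g σ = coordMetric g (σ 0).proj (chartState (σ 0).proj (σ 0)).1
    (chartState (σ 0).proj (σ 0)).2 (chartState (σ 0).proj
      (⟨(σ 0).proj, velocity (fun s => (σ s).proj) 0⟩ : TangentBundle (𝓡∂ n) M)).2 :=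
    inner_eq_coordMetric g hs _ _
  have e2 : momentum g σ' = coordMetric g (σ 0).proj (chartState (σ 0).proj (σ' 0)).1
    (chartState (σ 0).proj (σ' 0)).2 (chartState (σ 0).proj
      (⟨(σ' 0).proj, velocity (fun s => (σ' s).proj) 0⟩ : TangentBundle (𝓡∂ n) M)).2 :=
    inner_eq_coordMetric g hs' _ _
  rw [e1, e2, h1, h2]

/-- Broken rays near a non-tangential broken ray: existence and uniqueness. -/
theorem eventually_exists_unique_brokenRay [T2Space M] (hdisj : Disjoint E R)
    (hER : E ∪ R = (𝓡∂ n).boundary M) (hg : IsC1Family ε g) (hε : 0 < ε) (hx₀ : x₀ ∈ E)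
    (hinward : 0 < normalCoord v₀) (hunit : (g 0).inner x₀ v₀ v₀ = 1) {N : ℕ} {t : ℕ → ℝ}
    {γ : ℝ → M} (h : IsBrokenRay (g 0) E R x₀ v₀ N t γ) (hn : IsNontangential n E R N t γ) :
    ∀ᶠ s in 𝓝 (0 : ℝ), ∃ (t' : ℕ → ℝ) (γ' : ℝ → M),
      IsBrokenRay (g s) E R x₀ (unitVector (g s) v₀) N t' γ' ∧ IsNontangential n E R N t' γ' ∧
      ∀ (N₁ : ℕ) (t₁ : ℕ → ℝ) (γ₁ : ℝ → M),
        IsBrokenRay (g s) E R x₀ (unitVector (g s) v₀) N₁ t₁ γ₁ →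
        N₁ = N ∧ (∀ i ≤ N + 1, t₁ i = t' i) ∧ EqOn γ₁ γ' (Icc 0 (t' (N + 1))) := by
  obtain ⟨t', γ', σ, F⟩ := h.exists_isRayFamily hg hε hER hx₀ hinward hunit hn
  filter_upwards [F.rays, F.nontangential] with s h1 h2
  refine ⟨t' s, γ' s, h1, h2, fun N₁ t₁ γ₁ h3 => ?_⟩
  obtain ⟨h4, h5, h6⟩ := h1.unique hdisj hER h3
  refine ⟨h4.symm, fun i hi => (h5 i hi).symm, fun r hr => ?_⟩
  obtain ⟨i, hi, hir⟩ := h1.exists_mem_Icc hr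
  exact (state_fst (h6 i hi r hir)).symm

/-- The derivative formula for the travel time and the scattering relation. -/
theorem scattering_derivative [T2Space M] (hdisj : Disjoint E R)
    (hER : E ∪ R = (𝓡∂ n).boundary M) (hg : IsC1Family ε g) (hε : 0 < ε) (hx₀ : x₀ ∈ E)
    (hinward : 0 < normalCoord v₀) (hunit : (g 0).inner x₀ v₀ v₀ = 1) {N : ℝ → ℕ}
    {t : ℝ → ℕ → ℝ} {γ : ℝ → ℝ → M}
    (h : ∀ᶠ s in 𝓝 (0 : ℝ), IsBrokenRay (g s) E R x₀ (unitVector (g s) v₀) (N s) (t s) (γ s))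
    (hn : IsNontangential n E R (N 0) (t 0) (γ 0)) :
    IntervalIntegrable (rayIntegrand g (γ 0)) MeasureTheory.volume 0 (t 0 (N 0 + 1)) ∧
      DifferentiableAt ℝ (fun s => t s (N s + 1)) 0 ∧
      MDifferentiableAt 𝓘(ℝ, ℝ) (𝓡∂ n).tangent (fun s => exitState n (N s) (t s) (γ s)) 0 ∧
      1 / 2 * rayTransform (metricDeriv g) (γ 0) (t 0 (N 0 + 1)) =
        deriv (fun s => t s (N s + 1)) 0 -
          momentum (g 0) (fun s => exitState n (N s) (t s) (γ s)) := by
  have h0 := h.self_of_nhds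
  rw [(isUnitFamily_unitVector hg hε hunit).2.1] at h0
  obtain ⟨t', γ', σ, F⟩ := h0.exists_isRayFamily hg hε hER hx₀ hinward hunit hn
  have key : ∀ᶠ s in 𝓝 0, t' s (N 0 + 1) = t s (N s + 1) ∧
      σ s = exitState n (N s) (t s) (γ s) := by
    filter_upwards [h, F.rays, F.exitState_eq] with s h1 h2 h3
    obtain ⟨h4, h5, -⟩ := h2.exit_eq hdisj hER h1
    exact ⟨h4, h3.symm.trans h5⟩
  have hτ : (fun s => t' s (N 0 + 1)) =ᶠ[𝓝 0] fun s => t s (N s + 1) := key.mono fun s hs => hs.1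
  have hσ : σ =ᶠ[𝓝 0] fun s => exitState n (N s) (t s) (γ s) := key.mono fun s hs => hs.2
  refine ⟨F.intervalIntegrable, hτ.differentiableAt_iff.1 F.differentiableAt,
    F.unitFamily.mdifferentiableAt.congr_of_eventuallyEq hσ.symm, ?_⟩
  rw [← momentum_congr hσ F.unitFamily.mdifferentiableAt, ← hτ.deriv_eq]
  exact F.integral_eq

/-- The derivatives of the travel time and of the exit point determine the ray transform of the
derivative of the metric. -/
theorem rayTransform_eq_of_scattering [T2Space M] (hdisj : Disjoint E R)
    (hER : E ∪ R = (𝓡∂ n).boundary M) (hg : IsC1Family ε g) (hε : 0 < ε) (hx₀ : x₀ ∈ E)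
    (hinward : 0 < normalCoord v₀) (hunit : (g 0).inner x₀ v₀ v₀ = 1)
    {h : ℝ → Metric n M} (hh : IsC1Family ε h) (h0 : h 0 = g 0) {N N' : ℝ → ℕ}
    {t t' : ℝ → ℕ → ℝ} {γ γ' : ℝ → ℝ → M}
    (hγ : ∀ᶠ s in 𝓝 (0 : ℝ), IsBrokenRay (g s) E R x₀ (unitVector (g s) v₀) (N s) (t s) (γ s))
    (hγ' : ∀ᶠ s in 𝓝 (0 : ℝ),
      IsBrokenRay (h s) E R x₀ (unitVector (h s) v₀) (N' s) (t' s) (γ' s))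
    (hn : IsNontangential n E R (N 0) (t 0) (γ 0))
    (hτ : deriv (fun s => t s (N s + 1)) 0 = deriv (fun s => t' s (N' s + 1)) 0)
    (hexit : (⟨(exitState n (N 0) (t 0) (γ 0)).proj,
        velocity (fun s => (exitState n (N s) (t s) (γ s)).proj) 0⟩ : TangentBundle (𝓡∂ n) M) =
      ⟨(exitState n (N' 0) (t' 0) (γ' 0)).proj,
        velocity (fun s => (exitState n (N' s) (t' s) (γ' s)).proj) 0⟩) :
    rayTransform (metricDeriv g) (γ 0) (t 0 (N 0 + 1)) =
      rayTransform (metricDeriv h) (γ 0) (t 0 (N 0 + 1)) := by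
  have e1 := hγ.self_of_nhds
  have e2 := hγ'.self_of_nhds
  rw [h0] at e2
  -- Both families start from the same metric, so the two rays at `s = 0` coincide; the two
  -- derivative formulas then share their right sides.
  obtain ⟨-, h2, h3, h4⟩ := e1.exit_eq hdisj hER e2
  have f1 := (scattering_derivative hdisj hER hg hε hx₀ hinward hunit hγ hn).2.2.2
  have f2 := (scattering_derivative hdisj hER hh hε hx₀ hinward (by rw [h0]; exact hunit) hγ'
    (h3 hn)).2.2.2
  rw [← hτ, h0, ← momentum_congr_of_velocity (σ := fun s => exitState n (N s) (t s) (γ s)) h2 hexit,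
    ← f1, ← h4] at f2
  linarith

end Scattering

/-! ### Differentiation under the integral and mixed derivatives. -/

section ParametricIntegrals

open Set Filter

/-! ### Integrals depending on a parameter -/

variable {F : Type*} [NormedAddCommGroup F] [NormedSpace ℝ F]

theorem ContinuousOn.slice {X : Type*} [TopologicalSpace X] {φ : ℝ → ℝ → X} {S : Set ℝ} {K : Set ℝ}
    (h : ContinuousOn (fun p : ℝ × ℝ => φ p.1 p.2) (S ×ˢ K)) {s : ℝ} (hs : s ∈ S) :
    ContinuousOn (φ s) K :=
  h.comp (f := fun r : ℝ => (s, r)) (by fun_prop) fun _ hr => ⟨hs, hr⟩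

theorem hasDerivAt_integral_of_continuousOn {φ φ' : ℝ → ℝ → F} {x y η : ℝ} (hη : 0 < η)
    (hxy : x ≤ y)
    (hc : ContinuousOn (fun p : ℝ × ℝ => φ p.1 p.2) (Ioo (-η) η ×ˢ Icc x y))
    (hc' : ContinuousOn (fun p : ℝ × ℝ => φ' p.1 p.2) (Ioo (-η) η ×ˢ Icc x y))
    (hd : ∀ s ∈ Ioo (-η) η, ∀ r ∈ Icc x y, HasDerivAt (fun s => φ s r) (φ' s r) s) :
    HasDerivAt (fun s => ∫ r in x..y, φ s r) (∫ r in x..y, φ' 0 r) 0 := by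
  have h0 : (0 : ℝ) ∈ Ioo (-η) η := ⟨by linarith, hη⟩
  have hsub : Icc (-(η / 2)) (η / 2) ⊆ Ioo (-η) η := fun s hs =>
    ⟨by linarith [hs.1], by linarith [hs.2]⟩
  obtain ⟨C, hC⟩ := (isCompact_Icc.prod isCompact_Icc).exists_bound_of_continuousOn
    (hc'.mono (prod_mono hsub (subset_refl (Icc x y))))
  have hu : uIoc x y ⊆ Icc x y := by rw [uIoc_of_le hxy]; exact Ioc_subset_Icc_self
  have hmeas : ∀ {ψ : ℝ → F}, ContinuousOn ψ (Icc x y) → MeasureTheory.AEStronglyMeasurable ψ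
      (MeasureTheory.volume.restrict (uIoc x y)) := fun h =>
    (h.mono hu).aestronglyMeasurable measurableSet_uIoc
  refine (intervalIntegral.hasDerivAt_integral_of_dominated_loc_of_deriv_le (bound := fun _ => C)
    (s := Icc (-(η / 2)) (η / 2)) (Icc_mem_nhds (by linarith) (by linarith)) ?_
    ((ContinuousOn.slice hc h0).intervalIntegrable_of_Icc hxy)
    (hmeas (ContinuousOn.slice hc' h0)) ?_ intervalIntegrable_const ?_).2
  · filter_upwards [isOpen_Ioo.mem_nhds h0] with s hs
    exact hmeas (ContinuousOn.slice hc hs)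
  · exact .of_forall fun r hr s hs => hC (s, r) ⟨hs, hu hr⟩
  · exact .of_forall fun r hr s hs => hd s (hsub hs) r (hu hr)

/-- Symmetry of mixed derivatives. -/
theorem hasDerivWithinAt_of_mixed [CompleteSpace F] {f ft fst : ℝ → ℝ → F} {W : ℝ → F}
    {x y η : ℝ} (hη : 0 < η)
    (hf : ∀ s ∈ Ioo (-η) η, ∀ r ∈ Icc x y, HasDerivWithinAt (f s) (ft s r) (Icc x y) r)
    (hW : ∀ r ∈ Icc x y, HasDerivAt (fun s => f s r) (W r) 0)
    (hc : ContinuousOn (fun p : ℝ × ℝ => ft p.1 p.2) (Ioo (-η) η ×ˢ Icc x y))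
    (hc' : ContinuousOn (fun p : ℝ × ℝ => fst p.1 p.2) (Ioo (-η) η ×ˢ Icc x y))
    (hd : ∀ s ∈ Ioo (-η) η, ∀ r ∈ Icc x y, HasDerivAt (fun s => ft s r) (fst s r) s) {r : ℝ}
    (hr : r ∈ Icc x y) : HasDerivWithinAt W (fst 0 r) (Icc x y) r := by
  have h0 : (0 : ℝ) ∈ Ioo (-η) η := ⟨by linarith, hη⟩
  have hx : x ∈ Icc x y := ⟨le_rfl, hr.1.trans hr.2⟩
  -- Differentiating `f s r - f s x = ∫ ft s` under the integral exhibits `W` as a primitive of the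
  -- mixed derivative; no `C²` regularity is needed.
  have key : ∀ r ∈ Icc x y, W r = W x + ∫ ρ in x..r, fst 0 ρ := by
    intro r hr
    have hsub : Icc x r ⊆ Icc x y := Icc_subset_Icc_right hr.2
    have h1 := hasDerivAt_integral_of_continuousOn hη hr.1 (hc.mono (prod_mono_right hsub))
      (hc'.mono (prod_mono_right hsub)) fun s hs ρ hρ => hd s hs ρ (hsub hρ)
    have h2 : (fun s => ∫ ρ in x..r, ft s ρ) =ᶠ[𝓝 0] fun s => f s r - f s x := by
      filter_upwards [isOpen_Ioo.mem_nhds h0] with s hs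
      refine intervalIntegral.integral_eq_sub_of_hasDerivAt_of_le hr.1
        (fun ρ hρ => ((hf s hs ρ (hsub hρ)).mono hsub).continuousWithinAt)
        (fun ρ hρ => ?_)
        (((ContinuousOn.slice hc hs).mono hsub).intervalIntegrable_of_Icc hr.1)
      exact (hf s hs ρ ⟨hρ.1.le, hρ.2.le.trans hr.2⟩).hasDerivAt
        (Icc_mem_nhds hρ.1 (hρ.2.trans_le hr.2))
    have h3 := (h1.congr_of_eventuallyEq h2.symm).unique ((hW r hr).sub (hW x hx))
    rw [h3]
    abel
  have hcont : ContinuousOn (fst 0) (Icc x y) := ContinuousOn.slice hc' h0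
  have hint : IntervalIntegrable (fst 0) MeasureTheory.volume x r :=
    (hcont.mono (Icc_subset_Icc_right hr.2)).intervalIntegrable_of_Icc hr.1
  have h4 : HasDerivWithinAt (fun r => W x + ∫ ρ in x..r, fst 0 ρ) (fst 0 r) (Icc x y) r := by
    have : Fact (r ∈ Icc x y) := ⟨hr⟩
    exact (intervalIntegral.integral_hasDerivWithinAt_right hint
      (hcont.stronglyMeasurableAtFilter_nhdsWithin measurableSet_Icc r) (hcont r hr)).const_add _
  exact h4.congr key (key r hr)

end ParametricIntegrals

/-! ### First variation of length in a chart. -/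

section Variation

open Set Filter

variable {n : ℕ} [NeZero n] {M : Type*} [TopologicalSpace M]
  [ChartedSpace (EuclideanHalfSpace n) M] [IsManifold (𝓡∂ n) ∞ M]

variable {ε : ℝ} {g : ℝ → Metric n M}

/-! ### The first variation of length in a chart -/

/-- Only the central curve is a geodesic, so the energy `h` varies with `s`. Since `h = 1` at `s =
0`, the derivative of the speed is `½ ∂_s h`, and the momentum identity writes this as `½ metricDot`
plus the time derivative of the momentum. -/
theorem IsC1Family.hasDerivAt_length (hg : IsC1Family ε g) {x₀ : M}
    {f ft fs fst : ℝ → ℝ → V n} {x y η : ℝ} (hη : 0 < η) (hηε : η ≤ ε) (hxy : x < y)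
    (hm : ∀ s ∈ Ioo (-η) η, ∀ r ∈ Icc x y, f s r ∈ (extChartAt (𝓡∂ n) x₀).target)
    (hf : ∀ s ∈ Ioo (-η) η, ∀ r ∈ Icc x y, HasDerivWithinAt (f s) (ft s r) (Icc x y) r)
    (hfs : ∀ s ∈ Ioo (-η) η, ∀ r ∈ Icc x y, HasDerivAt (fun s => f s r) (fs s r) s)
    (hfst : ∀ s ∈ Ioo (-η) η, ∀ r ∈ Icc x y, HasDerivAt (fun s => ft s r) (fst s r) s)
    (cf : ContinuousOn (fun p : ℝ × ℝ => f p.1 p.2) (Ioo (-η) η ×ˢ Icc x y))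
    (cft : ContinuousOn (fun p : ℝ × ℝ => ft p.1 p.2) (Ioo (-η) η ×ˢ Icc x y))
    (cfs : ContinuousOn (fun p : ℝ × ℝ => fs p.1 p.2) (Ioo (-η) η ×ˢ Icc x y))
    (cfst : ContinuousOn (fun p : ℝ × ℝ => fst p.1 p.2) (Ioo (-η) η ×ˢ Icc x y))
    (hgeo : ∀ r ∈ Icc x y,
      HasDerivWithinAt (ft 0) (geodesicAcc (g 0) x₀ (f 0 r) (ft 0 r)) (Icc x y) r)
    (hunit : ∀ r ∈ Icc x y, coordMetric (g 0) x₀ (f 0 r) (ft 0 r) (ft 0 r) = 1) :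
    ContinuousOn (fun r => metricDot g x₀ (f 0 r) (ft 0 r) (ft 0 r)) (Icc x y) ∧
    (∀ᶠ s in 𝓝 0, ContinuousOn (fun r => √(coordMetric (g s) x₀ (f s r) (ft s r) (ft s r)))
      (Icc x y)) ∧
    HasDerivAt (fun s => ∫ r in x..y, √(coordMetric (g s) x₀ (f s r) (ft s r) (ft s r)))
      (1 / 2 * (∫ r in x..y, metricDot g x₀ (f 0 r) (ft 0 r) (ft 0 r)) +
        coordMetric (g 0) x₀ (f 0 y) (ft 0 y) (fs 0 y) -
        coordMetric (g 0) x₀ (f 0 x) (ft 0 x) (fs 0 x)) 0 := by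
  have hε : 0 < ε := hη.trans_le hηε
  have h0 : (0 : ℝ) ∈ Ioo (-η) η := ⟨by linarith, hη⟩
  set U := (extChartAt (𝓡∂ n) x₀).target with hU
  set S := Ioo (-η) η ×ˢ Icc x y with hS
  set Q : Set (ℝ × V n) := Ioo (-ε) ε ×ˢ U with hQ
  have hηsub : Ioo (-η) η ⊆ Ioo (-ε) ε := Ioo_subset_Ioo (by linarith) hηε
  have hmaps : ∀ p ∈ S, (p.1, f p.1 p.2) ∈ Q := fun p hp => ⟨hηsub hp.1, hm _ hp.1 _ hp.2⟩
  have hud : UniqueDiffOn ℝ Q := isOpen_Ioo.uniqueDiffOn.prod (uniqueDiffOn_target (n := n) x₀)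
  set G : ℝ × V n → V n →L[ℝ] V n →L[ℝ] ℝ := fun p => coordMetric (g p.1) x₀ p.2 with hG
  have hGC := hg.contDiffOn_coordMetric x₀
  have cpair : ContinuousOn (fun p : ℝ × ℝ => (p.1, f p.1 p.2)) S := continuousOn_fst.prodMk cf
  have cG : ContinuousOn (fun p : ℝ × ℝ => G (p.1, f p.1 p.2)) S :=
    hGC.continuousOn.comp cpair hmaps
  have cD : ContinuousOn (fun p : ℝ × ℝ => fderivWithin ℝ G Q (p.1, f p.1 p.2)) S :=
    (hGC.continuousOn_fderivWithin hud le_rfl).comp cpair hmaps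
  set h : ℝ → ℝ → ℝ := fun s r => G (s, f s r) (ft s r) (ft s r) with hh
  set h' : ℝ → ℝ → ℝ := fun s r => fderivWithin ℝ G Q (s, f s r) (1, fs s r) (ft s r) (ft s r) +
    G (s, f s r) (fst s r) (ft s r) + G (s, f s r) (ft s r) (fst s r) with hh'
  have ch : ContinuousOn (fun p : ℝ × ℝ => h p.1 p.2) S := (cG.clm_apply cft).clm_apply cft
  have ch' : ContinuousOn (fun p : ℝ × ℝ => h' p.1 p.2) S :=
    ((((cD.clm_apply ((continuousOn_const (c := (1 : ℝ))).prodMk cfs)).clm_apply cft).clm_apply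
      cft).add ((cG.clm_apply cfst).clm_apply cft)).add ((cG.clm_apply cft).clm_apply cfst)
  have hdh : ∀ s ∈ Ioo (-η) η, ∀ r ∈ Icc x y, HasDerivAt (fun s => h s r) (h' s r) s := by
    intro s hs r hr
    have h1 := ((hGC.differentiableOn one_ne_zero _ (hmaps (s, r) ⟨hs, hr⟩)).hasFDerivWithinAt
      ).comp_hasDerivAt_of_eq (f := fun s => (s, f s r)) s
      ((hasDerivAt_id s).prodMk (hfs s hs r hr))
      (by filter_upwards [isOpen_Ioo.mem_nhds hs] with s' hs'
          exact hmaps (s', r) ⟨hs', hr⟩) rfl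
    exact hasDerivWithinAt_univ.1 (hasDerivWithinAt_bilin (B := fun s => G (s, f s r))
      (hasDerivWithinAt_univ.2 h1) (hasDerivWithinAt_univ.2 (hfst s hs r hr))
      (hasDerivWithinAt_univ.2 (hfst s hs r hr)))
  -- Compactness of the time interval keeps the energy positive for all small `s`, so the square
  -- root can be differentiated.
  have hpos : ∀ᶠ s in 𝓝 (0 : ℝ), ∀ r ∈ Icc x y, r ∈ Icc x y → 0 < h s r := by
    refine isCompact_Icc.eventually_forall_of_forall_eventually fun r hr => ?_
    have h1 : ∀ᶠ p : ℝ × ℝ in 𝓝[S] (0, r), 0 < h p.1 p.2 :=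
      (ch (0, r) ⟨h0, hr⟩).eventually_mem (isOpen_Ioi.mem_nhds
        (show 0 < h 0 r by rw [show h 0 r = 1 from hunit r hr]; exact one_pos))
    filter_upwards [eventually_nhdsWithin_iff.1 h1, continuous_fst.continuousAt.eventually_mem
      (isOpen_Ioo.mem_nhds (show (((0 : ℝ), r) : ℝ × ℝ).1 ∈ Ioo (-η) η from h0))] with p h2 h3 h4
    exact h2 ⟨h3, h4⟩
  obtain ⟨ρ, hρ, hρ'⟩ := Metric.eventually_nhds_iff.1 hpos
  set θ := min ρ η with hθ
  have hθ0 : 0 < θ := lt_min hρ hη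
  have hsub : Ioo (-θ) θ ⊆ Ioo (-η) η := Ioo_subset_Ioo (neg_le_neg (min_le_right _ _))
    (min_le_right _ _)
  have hpos' : ∀ s ∈ Ioo (-θ) θ, ∀ r ∈ Icc x y, 0 < h s r := fun s hs r hr =>
    hρ' (by rw [Real.dist_eq, sub_zero]
            exact (abs_lt.2 hs).trans_le (min_le_left _ _)) r hr hr
  have hsq : ∀ p ∈ Ioo (-θ) θ ×ˢ Icc x y, 2 * √(h p.1 p.2) ≠ 0 := fun p hp =>
    mul_ne_zero two_ne_zero (Real.sqrt_pos.2 (hpos' _ hp.1 _ hp.2)).ne'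
  have cS := prod_mono hsub (subset_refl (Icc x y))
  have csq : ContinuousOn (fun p : ℝ × ℝ => √(h p.1 p.2)) (Ioo (-θ) θ ×ˢ Icc x y) :=
    (ch.mono cS).sqrt
  have hD := hasDerivAt_integral_of_continuousOn (φ := fun s r => √(h s r))
    (φ' := fun s r => h' s r / (2 * √(h s r))) hθ0 hxy.le csq
    ((ch'.mono cS).div (continuousOn_const.mul csq) hsq)
    (fun s hs r hr => (hdh s (hsub hs) r hr).sqrt (hpos' s hs r hr).ne')
  have cf0 : ContinuousOn (f 0) (Icc x y) := ContinuousOn.slice cf h0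
  have cu : ContinuousOn (ft 0) (Icc x y) := ContinuousOn.slice cft h0
  have cdot : ContinuousOn (fun r => metricDot g x₀ (f 0 r) (ft 0 r) (ft 0 r)) (Icc x y) :=
    (((hg.continuousOn_metricDot hε x₀).comp cf0 fun r hr => hm 0 h0 r hr).clm_apply cu).clm_apply cu
  refine ⟨cdot, ?_, hD.congr_deriv ?_⟩
  · filter_upwards [isOpen_Ioo.mem_nhds (show (0 : ℝ) ∈ Ioo (-η) η from h0)] with s hs
    exact (ContinuousOn.slice ch hs).sqrt
  -- The momentum identity needs the time derivative of the variation field, whereas the hypotheses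
  -- supply the mixed derivative in the other order.
  have hW : ∀ r ∈ Icc x y, HasDerivWithinAt (fs 0) (fst 0 r) (Icc x y) r := fun r hr =>
    hasDerivWithinAt_of_mixed hη hf (fun r hr => hfs 0 h0 r hr) cft cfst hfst hr
  have hmom : ∀ r ∈ Icc x y, HasDerivWithinAt
      (fun r => coordMetric (g 0) x₀ (f 0 r) (ft 0 r) (fs 0 r))
      (h' 0 r / (2 * √(h 0 r)) - 1 / 2 * metricDot g x₀ (f 0 r) (ft 0 r) (ft 0 r)) (Icc x y) r := by
    intro r hr
    refine (hasDerivWithinAt_momentum (g 0) x₀ (hf 0 h0 r hr) (hgeo r hr) (hW r hr) (hm 0 h0 r hr)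
      (eventually_of_mem self_mem_nhdsWithin (hm 0 h0))).congr_deriv ?_
    have h1 := hg.hasDerivAt_energy hε (hfs 0 h0 r hr) (hfst 0 h0 r hr) (by
      filter_upwards [isOpen_Ioo.mem_nhds h0] with s hs using hm s hs r hr)
    rw [(hdh 0 h0 r hr).unique h1, show h 0 r = 1 from hunit r hr, Real.sqrt_one]
    ring
  have cder : ContinuousOn (fun r => h' 0 r / (2 * √(h 0 r))) (Icc x y) := by
    have hθ0' : (0 : ℝ) ∈ Ioo (-θ) θ := ⟨by linarith, hθ0⟩
    exact ContinuousOn.slice (φ := fun s r => h' s r / (2 * √(h s r)))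
      ((ch'.mono cS).div (continuousOn_const.mul csq) hsq) hθ0'
  have cdot' : ContinuousOn (fun r => 1 / 2 * metricDot g x₀ (f 0 r) (ft 0 r) (ft 0 r))
      (Icc x y) := continuousOn_const.mul cdot
  have hint := intervalIntegral.integral_eq_sub_of_hasDerivAt_of_le hxy.le
    (fun r hr => (hmom r hr).continuousWithinAt)
    (fun r hr => (hmom r (Ioo_subset_Icc_self hr)).hasDerivAt (Icc_mem_nhds hr.1 hr.2))
    ((cder.sub cdot').intervalIntegrable_of_Icc hxy.le)
  rw [intervalIntegral.integral_sub (cder.intervalIntegrable_of_Icc hxy.le)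
    (cdot'.intervalIntegrable_of_Icc hxy.le),
    intervalIntegral.integral_const_mul] at hint
  linarith

end Variation

/-! ### First variation of length for broken rays. -/

section VariationOfRays

open Set Filter

variable {n : ℕ} [NeZero n] {M : Type*} [TopologicalSpace M]
  [ChartedSpace (EuclideanHalfSpace n) M] [IsManifold (𝓡∂ n) ∞ M]

variable {ε : ℝ} {g : ℝ → Metric n M} {Γ : ℝ → ℝ → M} {A B δ : ℝ}

/-! ### The first variation of length on a manifold -/

variable (n) in
/-- The conditions of `IsC1Variation` on one interval. -/
def IsC1VariationOn (δ A B : ℝ) (Γ : ℝ → ℝ → M) : Prop :=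
  let J : Set ℝ := Icc A B
  let Q : Set (ℝ × ℝ) := Ioo (-δ) δ ×ˢ J
  ContinuousOn (fun p : ℝ × ℝ => Γ p.1 p.2) Q ∧
  ∀ x₀ : M,
    let U : Set (ℝ × ℝ) :=
      {p | p ∈ Q ∧ Γ p.1 p.2 ∈ (chartAt (EuclideanHalfSpace n) x₀).source}
    let F : ℝ → ℝ → V n := fun s r => extChartAt (𝓡∂ n) x₀ (Γ s r)
    (∀ p ∈ U, DifferentiableWithinAt ℝ (F p.1) J p.2 ∧
      DifferentiableAt ℝ (fun s => F s p.2) p.1 ∧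
      DifferentiableAt ℝ (fun s => derivWithin (F s) J p.2) p.1) ∧
    ContinuousOn (fun p : ℝ × ℝ => derivWithin (F p.1) J p.2) U ∧
    ContinuousOn (fun p : ℝ × ℝ => deriv (fun s => F s p.2) p.1) U ∧
    ContinuousOn (fun p : ℝ × ℝ => deriv (fun s => derivWithin (F s) J p.2) p.1) U

theorem isC1Variation_iff {N : ℕ} {t : ℕ → ℝ} :
    IsC1Variation n δ N t Γ ↔ ∀ i ≤ N, IsC1VariationOn n δ (t i) (t (i + 1)) Γ := Iff.rfl

/-- The speed of the curve `Γ s` for the metric `g s`. -/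
def speed (g : ℝ → Metric n M) (Γ : ℝ → ℝ → M) (s r : ℝ) : ℝ :=
  √((g s).inner (Γ s r) (velocity (Γ s) r) (velocity (Γ s) r))

theorem speed_eq_normSq {s r : ℝ} (hr : r ∈ Ioo A B) :
    speed g Γ s r = √(normSq (g s) (state (Γ s) A B r)) := by
  rw [speed, ← velocityOn_eq_velocity hr]
  rfl

/-- The first variation formula on the interval `[x, y]`. -/
structure HasFirstVariation (g : ℝ → Metric n M) (Γ : ℝ → ℝ → M) (A B x y : ℝ) : Prop where
  intervalIntegrable : IntervalIntegrable (rayIntegrand g (Γ 0)) MeasureTheory.volume x y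
  speed : ∀ᶠ s in 𝓝 0, IntervalIntegrable (speed g Γ s) MeasureTheory.volume x y
  hasDerivAt : HasDerivAt (fun s => ∫ r in x..y, BrokenRay.speed g Γ s r)
    (1 / 2 * (∫ r in x..y, rayIntegrand g (Γ 0) r) + momentum (g 0) (fun s => state (Γ s) A B y) -
      momentum (g 0) (fun s => state (Γ s) A B x)) 0

theorem HasFirstVariation.refl (x : ℝ) : HasFirstVariation g Γ A B x x where
  intervalIntegrable := IntervalIntegrable.refl
  speed := .of_forall fun _ => IntervalIntegrable.refl
  hasDerivAt := by
    simp only [intervalIntegral.integral_same, mul_zero, zero_add, sub_self]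
    exact hasDerivAt_const _ _

theorem HasFirstVariation.trans {x y z : ℝ} (h₁ : HasFirstVariation g Γ A B x y)
    (h₂ : HasFirstVariation g Γ A B y z) : HasFirstVariation g Γ A B x z where
  intervalIntegrable := h₁.intervalIntegrable.trans h₂.intervalIntegrable
  speed := (h₁.speed.and h₂.speed).mono fun _ hs => hs.1.trans hs.2
  hasDerivAt := by
    have h : (fun s => ∫ r in x..z, BrokenRay.speed g Γ s r) =ᶠ[𝓝 0] fun s =>
        (∫ r in x..y, BrokenRay.speed g Γ s r) + ∫ r in y..z, BrokenRay.speed g Γ s r :=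
      (h₁.speed.and h₂.speed).mono fun s hs =>
        (intervalIntegral.integral_add_adjacent_intervals hs.1 hs.2).symm
    have h3 := (h₁.hasDerivAt.add h₂.hasDerivAt).congr_of_eventuallyEq h
    refine h3.congr_deriv ?_
    rw [← intervalIntegral.integral_add_adjacent_intervals h₁.intervalIntegrable
      h₂.intervalIntegrable]
    ring

theorem IsC1VariationOn.velocity_param (h : IsC1VariationOn n δ A B Γ) (hδ : 0 < δ) {r : ℝ}
    (hr : r ∈ Icc A B) {x₀ : M} (hs : Γ 0 r ∈ (extChartAt (𝓡∂ n) x₀).source) :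
    MDifferentiableAt 𝓘(ℝ, ℝ) (𝓡∂ n) (fun s => Γ s r) 0 ∧
      hat x₀ (Γ 0 r) (velocity (fun s => Γ s r) 0) =
        deriv (fun s => extChartAt (𝓡∂ n) x₀ (Γ s r)) 0 := by
  have h0 : (0 : ℝ) ∈ Ioo (-δ) δ := ⟨by linarith, hδ⟩
  have hc : ContinuousAt (fun s => Γ s r) 0 := by
    have := h.1.comp (f := fun s : ℝ => (s, r)) (s := Ioo (-δ) δ) (by fun_prop)
      fun s hs => ⟨hs, hr⟩
    exact this.continuousAt (isOpen_Ioo.mem_nhds h0)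
  rw [extChartAt_source] at hs
  have hd := ((h.2 x₀).1 (0, r) ⟨⟨h0, hr⟩, hs⟩).2.1
  rw [← extChartAt_source (𝓡∂ n)] at hs
  have := hat_mfderivWithin (γ := fun s => Γ s r) hc.continuousWithinAt hs
    (hasDerivWithinAt_univ.2 hd.hasDerivAt) uniqueDiffWithinAt_univ
  rw [mdifferentiableWithinAt_univ, mfderivWithin_univ] at this
  exact this

/-- The chart formula holds on short intervals around each time and is additive. All momenta are
formed with velocities relative to the same interval `[A, B]`, so those at intermediate times
cancel. -/
theorem IsC1VariationOn.hasFirstVariation (h : IsC1VariationOn n δ A B Γ) (hδ : 0 < δ)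
    (hg : IsC1Family ε g) (hε : 0 < ε) (hA : IsArc (g 0) (Γ 0) A B)
    (hu : ∀ r ∈ Icc A B, normSq (g 0) (state (Γ 0) A B r) = 1) :
    HasFirstVariation g Γ A B A B := by
  refine interval_induction hA.lt.le (fun x y z _ _ _ _ h1 h2 => h1.trans h2) fun r₀ hr₀ => ?_
  have h0δ : (0 : ℝ) ∈ Ioo (-δ) δ := ⟨by linarith, hδ⟩
  set x₀ := Γ 0 r₀ with hx₀
  obtain ⟨hc, hch⟩ := h
  have hv := fun r hr => IsC1VariationOn.velocity_param (n := n) (r := r) (x₀ := x₀) ⟨hc, hch⟩ hδ hr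
  obtain ⟨hd, cft, cfs, cfst⟩ := hch x₀
  rw [← extChartAt_source (𝓡∂ n)] at hd cft cfs cfst
  obtain ⟨ρ, hρ, hρ'⟩ := Metric.mem_nhdsWithin_iff.1 ((hc (0, r₀) ⟨h0δ, hr₀⟩).eventually_mem
    ((isOpen_extChartAt_source x₀).mem_nhds (mem_extChartAt_source (I := 𝓡∂ n) x₀)))
  -- A square around `(0, r₀)` on which the curves stay in one chart and both the variation and the
  -- metrics are controlled.
  set η := min ρ (min δ ε) with hη
  have hη0 : 0 < η := lt_min hρ (lt_min hδ hε)
  have hηδ : η ≤ δ := (min_le_right _ _).trans (min_le_left _ _)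
  refine ⟨η, hη0, fun x y hAx hxy hyB hx hy => ?_⟩
  rcases eq_or_lt_of_le hxy with rfl | hxy
  · exact .refl x
  have h0 : (0 : ℝ) ∈ Ioo (-η) η := ⟨by linarith, hη0⟩
  have hsub : Icc x y ⊆ Icc A B := Icc_subset_Icc hAx hyB
  have hsrc : ∀ s ∈ Ioo (-η) η, ∀ r ∈ Icc x y, (s, r) ∈ Ioo (-δ) δ ×ˢ Icc A B ∧
      Γ s r ∈ (extChartAt (𝓡∂ n) x₀).source := by
    intro s hs r hr
    have h1 : (s, r) ∈ Ioo (-δ) δ ×ˢ Icc A B :=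
      ⟨⟨(neg_le_neg hηδ).trans_lt hs.1, hs.2.trans_le hηδ⟩, hsub hr⟩
    refine ⟨h1, hρ' ⟨?_, h1⟩⟩
    rw [Metric.mem_ball, Prod.dist_eq, max_lt_iff, Real.dist_eq, Real.dist_eq, sub_zero]
    have hηρ : η ≤ ρ := min_le_left _ _
    rw [abs_lt] at hx hy
    exact ⟨(abs_lt.2 hs).trans_le hηρ,
      (abs_lt.2 ⟨by linarith [hr.1], by linarith [hr.2]⟩).trans_le hηρ⟩
  have hS : Ioo (-η) η ×ˢ Icc x y ⊆ {p : ℝ × ℝ | p ∈ Ioo (-δ) δ ×ˢ Icc A B ∧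
      Γ p.1 p.2 ∈ (extChartAt (𝓡∂ n) x₀).source} := fun p hp => hsrc p.1 hp.1 p.2 hp.2
  set f : ℝ → ℝ → V n := fun s r => extChartAt (𝓡∂ n) x₀ (Γ s r) with hf
  set ft : ℝ → ℝ → V n := fun s r => derivWithin (f s) (Icc A B) r with hft
  have hfd : ∀ s ∈ Ioo (-η) η, ∀ r ∈ Icc x y, HasDerivWithinAt (f s) (ft s r) (Icc A B) r :=
    fun s hs r hr => (hd (s, r) (hsrc s hs r hr)).1.hasDerivWithinAt
  have hst : ∀ s ∈ Ioo (-η) η, ∀ r ∈ Icc x y, chartState x₀ (state (n := n) (Γ s) A B r) =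
      (f s r, ft s r) := by
    intro s hs r hr
    have hcw : ContinuousWithinAt (Γ s) (Icc A B) r :=
      ContinuousOn.slice hc (hsrc s hs r hr).1.1 r (hsub hr)
    have := (hat_mfderivWithin hcw (hsrc s hs r hr).2 (hfd s hs r hr)
      (uniqueDiffOn_Icc hA.lt r (hsub hr))).2
    exact Prod.ext rfl this
  have hst0 := fun r hr => hst 0 h0 r hr
  have hgeo : ∀ r ∈ Icc x y,
      HasDerivWithinAt (ft 0) (geodesicAcc (g 0) x₀ (f 0 r) (ft 0 r)) (Icc x y) r := by
    intro r hr
    have h1 := (hA.hasDerivWithinAt_snd (hsub hr) (hsrc 0 h0 r hr).2).mono hsub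
    rw [hst0 r hr] at h1
    exact h1.congr (fun r hr => by rw [hst0 r hr]) (by rw [hst0 r hr])
  have hnorm : ∀ s ∈ Ioo (-η) η, ∀ r ∈ Icc x y, normSq (g s) (state (Γ s) A B r) =
      coordMetric (g s) x₀ (f s r) (ft s r) (ft s r) := by
    intro s hs r hr
    rw [normSq_eq (x₀ := x₀) (g s) (hsrc s hs r hr).2, hst s hs r hr]
  obtain ⟨k1, k2, k3⟩ := hg.hasDerivAt_length (f := f) (ft := ft)
    (fs := fun s r => deriv (fun s => f s r) s) (fst := fun s r => deriv (fun s => ft s r) s)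
    hη0 ((min_le_right _ _).trans (min_le_right _ _)) hxy
    (fun s hs r hr => (extChartAt (𝓡∂ n) x₀).map_source (hsrc s hs r hr).2)
    (fun s hs r hr => (hfd s hs r hr).mono hsub)
    (fun s hs r hr => (hd (s, r) (hsrc s hs r hr)).2.1.hasDerivAt)
    (fun s hs r hr => (hd (s, r) (hsrc s hs r hr)).2.2.hasDerivAt)
    ((continuousOn_extChartAt x₀).comp (hc.mono fun p hp => (hS hp).1) fun p hp => (hS hp).2)
    (cft.mono hS) (cfs.mono hS) (cfst.mono hS) hgeo
    (fun r hr => by rw [← hnorm 0 h0 r hr]; exact hu r (hsub hr))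
  have hIoo : ∀ r ∈ Ioo x y, r ∈ Ioo A B := fun r hr => ⟨hAx.trans_lt hr.1, hr.2.trans_le hyB⟩
  have hray : ∀ r ∈ Ioo x y, metricDot g x₀ (f 0 r) (ft 0 r) (ft 0 r) =
      rayIntegrand g (Γ 0) r := by
    intro r hr
    have hr' := Ioo_subset_Icc_self hr
    rw [rayIntegrand_eq hg hε (hIoo r hr) (hsrc 0 h0 r hr').2, hst0 r hr']
  have hspeed : ∀ s ∈ Ioo (-η) η, ∀ r ∈ Ioo x y,
      √(coordMetric (g s) x₀ (f s r) (ft s r) (ft s r)) = speed g Γ s r := by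
    intro s hs r hr
    rw [speed_eq_normSq (hIoo r hr), hnorm s hs r (Ioo_subset_Icc_self hr)]
  have hmom : ∀ r ∈ Icc x y, momentum (g 0) (fun s => state (n := n) (Γ s) A B r) =
      coordMetric (g 0) x₀ (f 0 r) (ft 0 r) (deriv (fun s => f s r) 0) := by
    intro r hr
    have h1 := inner_eq_coordMetric (g 0) (hsrc 0 h0 r hr).2 (velocityOn (n := n) (Γ 0) A B r)
      (velocity (fun s => Γ s r) 0)
    have h2 : hat x₀ (Γ 0 r) (velocityOn (n := n) (Γ 0) A B r) = ft 0 r :=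
      congrArg Prod.snd (hst0 r hr)
    rw [(hv r (hsub hr) (hsrc 0 h0 r hr).2).2, h2] at h1
    exact h1
  have hnhds : ∀ᶠ s in 𝓝 (0 : ℝ), s ∈ Ioo (-η) η := isOpen_Ioo.mem_nhds h0
  refine ⟨(k1.intervalIntegrable_of_Icc hxy.le).congr_uIoo ?_, ?_, ?_⟩
  · rw [uIoo_of_le hxy.le]
    exact hray
  · filter_upwards [k2, hnhds] with s h1 h2
    refine (h1.intervalIntegrable_of_Icc hxy.le).congr_uIoo ?_
    rw [uIoo_of_le hxy.le]
    exact hspeed s h2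
  · rw [hmom y (right_mem_Icc.2 hxy.le), hmom x (left_mem_Icc.2 hxy.le),
      ← intervalIntegral.integral_congr_Ioo_of_le hxy.le hray]
    refine k3.congr_of_eventuallyEq (hnhds.mono fun s hs => ?_)
    exact (intervalIntegral.integral_congr_Ioo_of_le hxy.le (hspeed s hs)).symm

/-- A base point that does not move has zero velocity; this removes the term at `x₀` and, for fixed
endpoints, the term at the exit. -/
theorem momentum_eq_zero {g : Metric n M} {σ : ℝ → TangentBundle (𝓡∂ n) M}
    (h : ∀ᶠ s in 𝓝 0, (σ s).proj = (σ 0).proj) : momentum g σ = 0 := by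
  have h1 : mfderiv 𝓘(ℝ, ℝ) (𝓡∂ n) (fun s => (σ s).proj) 0 =
      mfderiv 𝓘(ℝ, ℝ) (𝓡∂ n) (fun _ : ℝ => (σ 0).proj) 0 := Filter.EventuallyEq.mfderiv_eq h
  have h2 : velocity (n := n) (fun s => (σ s).proj) 0 = 0 := by
    rw [velocity, h1, mfderiv_const]
    rfl
  rw [momentum, h2, map_zero]

/-- A curve in the boundary has tangential velocity. -/
theorem normalCoord_velocity_eq_zero {q : ℝ → M}
    (hq : MDifferentiableAt 𝓘(ℝ, ℝ) (𝓡∂ n) q 0)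
    (hb : ∀ᶠ s in 𝓝 0, q s ∈ (𝓡∂ n).boundary M) : normalCoord (velocity (n := n) q 0) = 0 := by
  have hs : q 0 ∈ (extChartAt (𝓡∂ n) (q 0)).source := mem_extChartAt_source _
  obtain ⟨k, hk, hk'⟩ := hat_coord₀ hs hb.self_of_nhds
  have h1 := (coord₀ n).hasFDerivAt.comp_hasDerivAt 0 (hat_velocity hq hs)
  have h2 : (coord₀ n) (hat (q 0) (q 0) (velocity (n := n) q 0)) = 0 := by
    refine h1.unique ((hasDerivAt_const (0 : ℝ) (0 : ℝ)).congr_of_eventuallyEq ?_)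
    filter_upwards [hb, hq.continuousAt.eventually_mem
      ((isOpen_extChartAt_source (q 0)).mem_nhds hs)] with s h3 h4
    exact (mem_boundary_iff_coord h4).1 h3
  rw [coord₀_apply, hk'] at h2
  exact (mul_eq_zero.1 h2).resolve_left hk.ne'

theorem IsReflection.inner_eq_of_tangential {g : Metric n M} {p : M}
    {v w u : TangentSpace (𝓡∂ n) p} (h : IsReflection g p v w) (hu : normalCoord u = 0) :
    g.inner p w u = g.inner p v u := by
  obtain ⟨ν, hν, rfl⟩ := h
  rw [inner_sub_smul, hν.2.2 u hu, mul_zero, sub_zero]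

/-- The first variation formula for variations of broken rays. -/
theorem hasDerivAt_curveLength {E R : Set M} {x₀ : M} {v₀ : TangentSpace (𝓡∂ n) x₀}
    (hER : E ∪ R = (𝓡∂ n).boundary M) (hg : IsC1Family ε g) (hε : 0 < ε) (hδ : 0 < δ) {N : ℕ}
    {t : ℕ → ℝ} (hray : IsBrokenRay (g 0) E R x₀ v₀ N t (Γ 0)) (h : IsC1Variation n δ N t Γ)
    (hΓ : ∀ s ∈ Ioo (-δ) δ, Γ s 0 = x₀ ∧ ∀ i < N, Γ s (t (i + 1)) ∈ R) :
    IntervalIntegrable (rayIntegrand g (Γ 0)) MeasureTheory.volume 0 (t (N + 1)) ∧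
    HasDerivAt (fun s => curveLength (g s) (Γ s) (t (N + 1)))
      (1 / 2 * rayTransform (metricDeriv g) (Γ 0) (t (N + 1)) +
        momentum (g 0) (fun s => exitState n N t (Γ s))) 0 ∧
    MDifferentiableAt 𝓘(ℝ, ℝ) (𝓡∂ n) (fun s => Γ s (t (N + 1))) 0 := by
  have hvar := isC1Variation_iff.1 h
  have hnhds : ∀ᶠ s in 𝓝 (0 : ℝ), s ∈ Ioo (-δ) δ := Ioo_mem_nhds (by linarith) hδ
  have hseg : ∀ i ≤ N, HasFirstVariation g Γ (t i) (t (i + 1)) (t i) (t (i + 1)) := fun i hi =>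
    (hvar i hi).hasFirstVariation hδ hg hε (hray.isArc hi) fun r hr => hray.normSq_state hi hr
  have key : ∀ k ≤ N, IntervalIntegrable (rayIntegrand g (Γ 0)) MeasureTheory.volume 0 (t (k + 1)) ∧
      (∀ᶠ s in 𝓝 0, IntervalIntegrable (speed g Γ s) MeasureTheory.volume 0 (t (k + 1))) ∧
      HasDerivAt (fun s => ∫ r in (0 : ℝ)..t (k + 1), speed g Γ s r)
        (1 / 2 * (∫ r in (0 : ℝ)..t (k + 1), rayIntegrand g (Γ 0) r) +
          momentum (g 0) (fun s => state (n := n) (Γ s) (t k) (t (k + 1)) (t (k + 1)))) 0 := by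
    intro k
    induction k with
    | zero =>
      intro _
      obtain ⟨h1, h2, h3⟩ := hseg 0 (by omega)
      have h4 : momentum (g 0) (fun s => state (n := n) (Γ s) (t 0) (t (0 + 1)) (t 0)) = 0 := by
        refine momentum_eq_zero (hnhds.mono fun s hs => ?_)
        change Γ s (t 0) = Γ 0 (t 0)
        rw [hray.time_zero, (hΓ s hs).1, (hΓ 0 ⟨by linarith, hδ⟩).1]
      rw [h4, sub_zero] at h3
      rw [hray.time_zero] at h1 h2 h3 ⊢
      exact ⟨h1, h2, h3⟩
    | succ k ih =>
      intro hk
      obtain ⟨h1, h2, h3⟩ := hseg (k + 1) hk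
      obtain ⟨e1, e2, e3⟩ := ih (by omega)
      refine ⟨e1.trans h1, (e2.and h2).mono fun _ hs => hs.1.trans hs.2, ?_⟩
      have h4 : (fun s => ∫ r in (0 : ℝ)..t (k + 2), speed g Γ s r) =ᶠ[𝓝 0] fun s =>
          (∫ r in (0 : ℝ)..t (k + 1), speed g Γ s r) +
            ∫ r in t (k + 1)..t (k + 2), speed g Γ s r := (e2.and h2).mono fun s hs =>
        (intervalIntegral.integral_add_adjacent_intervals hs.1 hs.2).symm
      refine ((e3.add h3).congr_of_eventuallyEq h4).congr_deriv ?_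
      have hm := right_mem_Icc.2 (hray.time_lt k (by omega)).le
      have hq := ((hvar k (by omega)).velocity_param hδ hm
        (mem_extChartAt_source (I := 𝓡∂ n) _)).1
      -- The break points remain on the boundary, so the variation field is tangential and does not
      -- see the normal jump of the velocity. Transversality of the reflection plays no role here.
      have h5 : momentum (g 0) (fun s => state (n := n) (Γ s) (t (k + 1)) (t (k + 2)) (t (k + 1))) =
          momentum (g 0) (fun s => state (n := n) (Γ s) (t k) (t (k + 1)) (t (k + 1))) :=
        (hray.reflect_law k (by omega)).inner_eq_of_tangential
          (normalCoord_velocity_eq_zero hq (hnhds.mono fun s hs =>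
            hER ▸ Or.inr ((hΓ s hs).2 k (by omega))))
      rw [h5, ← intervalIntegral.integral_add_adjacent_intervals e1 h1]
      ring
  obtain ⟨h1, -, h3⟩ := key N le_rfl
  refine ⟨h1, h3, ?_⟩
  exact ((hvar N le_rfl).velocity_param hδ (right_mem_Icc.2 (hray.time_lt N le_rfl).le)
    (mem_extChartAt_source (I := 𝓡∂ n) _)).1

end VariationOfRays

/-! ### Travel times between fixed endpoints. -/

section Rescaling

open Set Filter

variable {n : ℕ} [NeZero n] {M : Type*} [TopologicalSpace M]
  [ChartedSpace (EuclideanHalfSpace n) M] [IsManifold (𝓡∂ n) ∞ M]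

variable {ε : ℝ} {g : ℝ → Metric n M} {E R : Set M} {x₀ : M} {v₀ : TangentSpace (𝓡∂ n) x₀}

/-! ### Broken rays with fixed endpoints -/

theorem IsBrokenRay.congr {g : Metric n M} {N : ℕ} {t : ℕ → ℝ} {γ γ' : ℝ → M}
    (h : IsBrokenRay g E R x₀ v₀ N t γ) (he : ∀ i ≤ N, EqOn γ' γ (Icc (t i) (t (i + 1)))) :
    IsBrokenRay g E R x₀ v₀ N t γ' := by
  have hst : ∀ i ≤ N, ∀ r ∈ Icc (t i) (t (i + 1)),
      state (n := n) γ' (t i) (t (i + 1)) r = state γ (t i) (t (i + 1)) r := fun i hi r hr =>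
    velocityOn_congr (he i hi) hr
  have hl := fun i hi => left_mem_Icc.2 (h.time_lt i hi).le
  have hr := fun i hi => right_mem_Icc.2 (h.time_lt i hi).le
  refine isBrokenRay_of_arcs h.time_zero (fun i hi => (h.isArc hi).congr (he i hi))
    (fun i hi => ?_) ?_ (fun i hi => ?_) (fun i hi => ?_) ?_
  · rw [hst i hi _ (hl i hi)]
    exact h.normSq_state hi (hl i hi)
  · exact (hst 0 (by omega) _ (hl 0 (by omega))).trans h.start_state
  · rw [he i hi.le (hr i hi.le)]
    exact h.reflect_mem i hi
  · rw [hst i hi.le _ (hr i hi.le), hst (i + 1) (by omega) _ (hl (i + 1) (by omega))]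
    exact h.reflects hi
  · rw [he N le_rfl (hr N le_rfl)]
    exact h.exit_mem

theorem IsBrokenRay.apply_zero {g : Metric n M} {N : ℕ} {t : ℕ → ℝ} {γ : ℝ → M}
    (h : IsBrokenRay g E R x₀ v₀ N t γ) : γ 0 = x₀ := congrArg Bundle.TotalSpace.proj h.start

/-- The speed of an affine reparametrization of a unit speed arc. -/
theorem IsArc.normSq_comp_affine {g : Metric n M} {γ : ℝ → M} {a b a' b' : ℝ} (h : IsArc g γ a b)
    (hu : ∀ r ∈ Icc a b, normSq g (state γ a b r) = 1) (hab : a' < b') {γ' : ℝ → M}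
    (he : ∀ θ ∈ Icc (0 : ℝ) 1, γ' (AffineMap.lineMap a' b' θ) = γ (AffineMap.lineMap a b θ))
    {r : ℝ} (hr : r ∈ Ioo a' b') :
    √(normSq g (state γ' a' b' r)) = (b - a) / (b' - a') := by
  set κ := (b - a) / (b' - a') with hκ
  have hba : 0 < b' - a' := sub_pos.2 hab
  have hκ0 : 0 < κ := div_pos (sub_pos.2 h.lt) hba
  set α : ℝ → ℝ := fun r => a + κ * (r - a') with hα
  have hκ' : κ * (b' - a') = b - a := div_mul_cancel₀ _ hba.ne'
  have hαmem : α r ∈ Ioo a b := by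
    constructor
    · have := mul_pos hκ0 (sub_pos.2 hr.1)
      simp only [hα]; linarith
    · have := mul_lt_mul_of_pos_left (sub_lt_sub_right hr.2 a') hκ0
      simp only [hα]; linarith
  have heq : EqOn γ' (γ ∘ α) (Icc a' b') := by
    intro ρ hρ
    have h1 := he ((ρ - a') / (b' - a'))
      ⟨div_nonneg (by linarith [hρ.1]) hba.le, (div_le_one hba).2 (by linarith [hρ.2])⟩
    have h2 : AffineMap.lineMap a' b' ((ρ - a') / (b' - a')) = ρ := by
      rw [AffineMap.lineMap_apply_ring']
      field_simp
      ring
    have h3 : AffineMap.lineMap a b ((ρ - a') / (b' - a')) = α ρ := by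
      rw [AffineMap.lineMap_apply_ring']
      simp only [hα, hκ]
      ring
    rw [h2, h3] at h1
    exact h1
  have hs : γ (α r) ∈ (extChartAt (𝓡∂ n) (γ (α r))).source := mem_extChartAt_source _
  have hm := h.mdifferentiableWithinAt (Ioo_subset_Icc_self hαmem)
  have hdα : HasDerivAt α κ r := by
    exact ((((hasDerivAt_id r).sub_const a').const_mul κ).const_add a).congr_deriv (mul_one κ)
  have hd := (h.hasDerivWithinAt_fst (Ioo_subset_Icc_self hαmem) hs).hasDerivAt
    (Icc_mem_nhds hαmem.1 hαmem.2)
  have hcd : HasDerivAt (fun ρ => extChartAt (𝓡∂ n) (γ (α r)) ((γ ∘ α) ρ))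
      (κ • (chartState (γ (α r)) (state (n := n) γ a b (α r))).2) r :=
    HasDerivAt.scomp (h := α) r hd hdα
  have hcont : ContinuousAt (γ ∘ α) r :=
    ContinuousAt.comp (hm.continuousWithinAt.continuousAt (Icc_mem_nhds hαmem.1 hαmem.2))
      hdα.continuousAt
  have hvel := (hat_mfderivWithin (γ := γ ∘ α) (S := Icc a' b') (hcont.continuousWithinAt) hs
    hcd.hasDerivWithinAt (uniqueDiffOn_Icc hab r (Ioo_subset_Icc_self hr))).2
  have hstate : state (n := n) γ' a' b' r = state (γ ∘ α) a' b' r :=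
    velocityOn_congr heq (Ioo_subset_Icc_self hr)
  have hcs : chartState (γ (α r)) (state (n := n) (γ ∘ α) a' b' r) =
      (extChartAt (𝓡∂ n) (γ (α r)) (γ (α r)),
        κ • (chartState (γ (α r)) (state (n := n) γ a b (α r))).2) := Prod.ext rfl hvel
  have h1 := hu (α r) (Ioo_subset_Icc_self hαmem)
  rw [normSq_eq (x₀ := γ (α r)) g hs] at h1
  rw [hstate, normSq_eq (x₀ := γ (α r)) g hs, hcs]
  simp only [map_smul, smul_apply, smul_eq_mul]
  rw [show coordMetric g (γ (α r)) (extChartAt (𝓡∂ n) (γ (α r)) (γ (α r)))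
    (chartState (γ (α r)) (state (n := n) γ a b (α r))).2
    (chartState (γ (α r)) (state (n := n) γ a b (α r))).2 = 1 from h1, mul_one]
  exact Real.sqrt_mul_self hκ0.le

/-- An affine change of time gives each segment the constant speed "old duration over new duration",
so its length is its old duration, and these add up to the travel time. -/
theorem IsBrokenRay.curveLength_rescaled {g : Metric n M} {N : ℕ} {t t' : ℕ → ℝ} {γ γ' : ℝ → M}
    (h : IsBrokenRay g E R x₀ v₀ N t γ) (h0 : t' 0 = 0) (hlt : ∀ i ≤ N, t' i < t' (i + 1))
    (he : ∀ i ≤ N, ∀ θ ∈ Icc (0 : ℝ) 1, γ' (AffineMap.lineMap (t' i) (t' (i + 1)) θ) =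
      γ (AffineMap.lineMap (t i) (t (i + 1)) θ)) :
    curveLength g γ' (t' (N + 1)) = t (N + 1) := by
  set sp : ℝ → ℝ := fun r => √(g.inner (γ' r) (velocity γ' r) (velocity γ' r)) with hsp
  have hseg : ∀ i ≤ N, IntervalIntegrable sp MeasureTheory.volume (t' i) (t' (i + 1)) ∧
      ∫ r in t' i..t' (i + 1), sp r = t (i + 1) - t i := by
    intro i hi
    have hc : ∀ r ∈ Ioo (t' i) (t' (i + 1)), (t (i + 1) - t i) / (t' (i + 1) - t' i) = sp r := by
      intro r hr
      rw [← (h.isArc hi).normSq_comp_affine (fun r hr => h.normSq_state hi hr) (hlt i hi) (he i hi)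
        hr, hsp]
      simp only
      rw [← velocityOn_eq_velocity hr]
      rfl
    refine ⟨(intervalIntegrable_const (c := (t (i + 1) - t i) / (t' (i + 1) - t' i))).congr_uIoo
      (by rw [uIoo_of_le (hlt i hi).le]; exact hc), ?_⟩
    rw [← intervalIntegral.integral_congr_Ioo_of_le (hlt i hi).le hc,
      intervalIntegral.integral_const, smul_eq_mul, mul_div_cancel₀ _ (sub_pos.2 (hlt i hi)).ne']
  have key : ∀ k ≤ N, IntervalIntegrable sp MeasureTheory.volume 0 (t' (k + 1)) ∧
      ∫ r in (0 : ℝ)..t' (k + 1), sp r = t (k + 1) := by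
    intro k
    induction k with
    | zero =>
      intro _
      obtain ⟨h1, h2⟩ := hseg 0 (by omega)
      rw [h0] at h1 h2
      rw [h.time_zero, sub_zero] at h2
      exact ⟨h1, h2⟩
    | succ k ih =>
      intro hk
      obtain ⟨h1, h2⟩ := hseg (k + 1) hk
      obtain ⟨h3, h4⟩ := ih (by omega)
      refine ⟨h3.trans h1, ?_⟩
      rw [← intervalIntegral.integral_add_adjacent_intervals h3 h1, h2, h4]
      ring
  exact (key N le_rfl).2

/-- The derivative of the travel time between fixed endpoints. -/
theorem hasDerivAt_travelTime (hER : E ∪ R = (𝓡∂ n).boundary M) (hg : IsC1Family ε g)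
    (hε : 0 < ε) {N : ℕ} {t : ℝ → ℕ → ℝ} {δ : ℝ} {v : ℝ → TangentSpace (𝓡∂ n) x₀}
    {γ Γ : ℝ → ℝ → M} (hδ : 0 < δ)
    (h : ∀ s ∈ Ioo (-δ) δ, IsBrokenRay (g s) E R x₀ (v s) N (t s) (γ s) ∧
      γ s (t s (N + 1)) = γ 0 (t 0 (N + 1)) ∧
      ∀ i ≤ N, ∀ θ ∈ Icc (0 : ℝ) 1, Γ s (AffineMap.lineMap (t 0 i) (t 0 (i + 1)) θ) =
        γ s (AffineMap.lineMap (t s i) (t s (i + 1)) θ))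
    (hΓ : IsC1Variation n δ N (t 0) Γ) :
    HasDerivAt (fun s => t s (N + 1))
      (1 / 2 * rayTransform (metricDeriv g) (γ 0) (t 0 (N + 1))) 0 := by
  have h0δ : (0 : ℝ) ∈ Ioo (-δ) δ := ⟨by linarith, hδ⟩
  have hnhds : ∀ᶠ s in 𝓝 (0 : ℝ), s ∈ Ioo (-δ) δ := isOpen_Ioo.mem_nhds h0δ
  obtain ⟨hray, -, hΓ0⟩ := h 0 h0δ
  have hend : ∀ s ∈ Ioo (-δ) δ, ∀ i ≤ N, Γ s (t 0 i) = γ s (t s i) ∧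
      Γ s (t 0 (i + 1)) = γ s (t s (i + 1)) := by
    intro s hs i hi
    have h1 := (h s hs).2.2 i hi 0 ⟨le_rfl, zero_le_one⟩
    have h2 := (h s hs).2.2 i hi 1 ⟨zero_le_one, le_rfl⟩
    simp only [AffineMap.lineMap_apply_zero] at h1
    simp only [AffineMap.lineMap_apply_one] at h2
    exact ⟨h1, h2⟩
  have heq : ∀ i ≤ N, EqOn (Γ 0) (γ 0) (Icc (t 0 i) (t 0 (i + 1))) := by
    intro i hi r hr
    rw [← segment_eq_Icc (hray.time_lt i hi).le, segment_eq_image_lineMap] at hr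
    obtain ⟨θ, hθ, rfl⟩ := hr
    exact hΓ0 i hi θ hθ
  obtain ⟨-, h2, -⟩ := hasDerivAt_curveLength hER hg hε hδ (hray.congr heq) hΓ fun s hs => by
    obtain ⟨h1, -, -⟩ := h s hs
    refine ⟨?_, fun i hi => ?_⟩
    · have := (hend s hs 0 (by omega)).1
      rw [hray.time_zero, h1.time_zero, h1.apply_zero] at this
      exact this
    · rw [(hend s hs i hi.le).2]
      exact h1.reflect_mem i hi
  -- The exit point is the same for all `s`, so the boundary term of the first variation vanishes
  -- and only the ray transform remains.
  have hmom : momentum (g 0) (fun s => exitState n N (t 0) (Γ s)) = 0 := by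
    refine momentum_eq_zero (hnhds.mono fun s hs => ?_)
    change Γ s (t 0 (N + 1)) = Γ 0 (t 0 (N + 1))
    rw [(hend s hs N le_rfl).2, (hend 0 h0δ N le_rfl).2, (h s hs).2.1]
  have hf : rayTransform (metricDeriv g) (Γ 0) (t 0 (N + 1)) =
      rayTransform (metricDeriv g) (γ 0) (t 0 (N + 1)) :=
    rayTransform_congr _ hray.time_zero hray.time_lt fun i hi r hr => velocityOn_congr (heq i hi) hr
  rw [hmom, add_zero, hf] at h2
  refine h2.congr_of_eventuallyEq (hnhds.mono fun s hs => ?_)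
  obtain ⟨h1, -, h3⟩ := h s hs
  exact (h1.curveLength_rescaled hray.time_zero hray.time_lt h3).symm

end Rescaling

end BrokenRay

end

theorem theorem6p1 {n : ℕ} [NeZero n] {M : Type*} [TopologicalSpace M] [T2Space M]
    [ChartedSpace (EuclideanHalfSpace n) M] [IsManifold (𝓡∂ n) ∞ M]
    (E R : Set M) (hdisj : Disjoint E R) (hunion : E ∪ R = (𝓡∂ n).boundary M)
    (ε : ℝ) (hε : 0 < ε) (g : ℝ → BrokenRay.Metric n M) (hg : BrokenRay.IsC1Family ε g)
    (x₀ : M) (hx₀ : x₀ ∈ E) (v₀ : TangentSpace (𝓡∂ n) x₀)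
    (hinward : 0 < BrokenRay.normalCoord v₀) (hunit : (g 0).inner x₀ v₀ v₀ = 1) :
    -- If the broken ray of `g 0` is non-tangential, then for `s` near `0` the broken ray of `g s`
    -- exists, is unique, has the same number of reflections and is non-tangential.
    (∀ (N : ℕ) (t : ℕ → ℝ) (γ : ℝ → M),
      BrokenRay.IsBrokenRay (g 0) E R x₀ v₀ N t γ → BrokenRay.IsNontangential n E R N t γ →
      ∀ᶠ s in 𝓝 (0 : ℝ), ∃ (t' : ℕ → ℝ) (γ' : ℝ → M),
        BrokenRay.IsBrokenRay (g s) E R x₀ (BrokenRay.unitVector (g s) v₀) N t' γ' ∧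
        BrokenRay.IsNontangential n E R N t' γ' ∧
        ∀ (N₁ : ℕ) (t₁ : ℕ → ℝ) (γ₁ : ℝ → M),
          BrokenRay.IsBrokenRay (g s) E R x₀ (BrokenRay.unitVector (g s) v₀) N₁ t₁ γ₁ →
          N₁ = N ∧ (∀ i ≤ N + 1, t₁ i = t' i) ∧ Set.EqOn γ₁ γ' (Set.Icc 0 (t' (N + 1)))) ∧
    -- The travel time `τ s = t s (N s + 1)` and the scattering relation are differentiable in `s`
    -- at `0`, and the derivative formula holds.
    (∀ (N : ℝ → ℕ) (t : ℝ → ℕ → ℝ) (γ : ℝ → ℝ → M),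
      (∀ᶠ s in 𝓝 (0 : ℝ), BrokenRay.IsBrokenRay (g s) E R x₀ (BrokenRay.unitVector (g s) v₀)
        (N s) (t s) (γ s)) →
      BrokenRay.IsNontangential n E R (N 0) (t 0) (γ 0) →
      let τ : ℝ → ℝ := fun s => t s (N s + 1)
      let exit : ℝ → M := fun s => γ s (τ s)
      IntervalIntegrable (fun r => BrokenRay.metricDeriv g (γ 0 r)
        (BrokenRay.velocity (γ 0) r) (BrokenRay.velocity (γ 0) r)) MeasureTheory.volume 0 (τ 0) ∧
      DifferentiableAt ℝ τ 0 ∧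
      MDifferentiableAt 𝓘(ℝ, ℝ) (𝓡∂ n).tangent
        (fun s => BrokenRay.exitState n (N s) (t s) (γ s)) 0 ∧
      MDifferentiableAt 𝓘(ℝ, ℝ) (𝓡∂ n) exit 0 ∧
      1 / 2 * BrokenRay.rayTransform (BrokenRay.metricDeriv g) (γ 0) (τ 0) =
        deriv τ 0 - (g 0).inner (γ 0 (τ 0))
          (BrokenRay.velocityOn (γ 0) (t 0 (N 0)) (τ 0) (τ 0)) (BrokenRay.velocity exit 0)) ∧
    -- The derivatives at `s = 0` of the travel time and of the exit point (the base point of the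
    -- scattering relation) determine the broken ray transform of `d/ds g_s |_{s = 0}`.
    (∀ h : ℝ → BrokenRay.Metric n M, BrokenRay.IsC1Family ε h → h 0 = g 0 →
      ∀ (N N' : ℝ → ℕ) (t t' : ℝ → ℕ → ℝ) (γ γ' : ℝ → ℝ → M),
      (∀ᶠ s in 𝓝 (0 : ℝ), BrokenRay.IsBrokenRay (g s) E R x₀ (BrokenRay.unitVector (g s) v₀)
        (N s) (t s) (γ s)) →
      (∀ᶠ s in 𝓝 (0 : ℝ), BrokenRay.IsBrokenRay (h s) E R x₀ (BrokenRay.unitVector (h s) v₀)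
        (N' s) (t' s) (γ' s)) →
      BrokenRay.IsNontangential n E R (N 0) (t 0) (γ 0) →
      let exit : ℝ → M := fun s => (BrokenRay.exitState n (N s) (t s) (γ s)).proj
      let exit' : ℝ → M := fun s => (BrokenRay.exitState n (N' s) (t' s) (γ' s)).proj
      deriv (fun s => t s (N s + 1)) 0 = deriv (fun s => t' s (N' s + 1)) 0 →
      (⟨exit 0, BrokenRay.velocity exit 0⟩ : TangentBundle (𝓡∂ n) M) =
        ⟨exit' 0, BrokenRay.velocity exit' 0⟩ →
      BrokenRay.rayTransform (BrokenRay.metricDeriv g) (γ 0) (t 0 (N 0 + 1)) =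
        BrokenRay.rayTransform (BrokenRay.metricDeriv h) (γ 0) (t 0 (N 0 + 1))) ∧
    -- The formula holds for any `C¹` family of piecewise `C¹` curves `Γ s` which start at `x₀`, break
    -- on `R`, and for `s = 0` give a (possibly tangential) broken ray of `g 0`; `L s` is the length.
    (∀ (N : ℕ) (t : ℕ → ℝ) (δ : ℝ) (Γ : ℝ → ℝ → M), 0 < δ →
      BrokenRay.IsBrokenRay (g 0) E R x₀ v₀ N t (Γ 0) →
      BrokenRay.IsC1Variation n δ N t Γ →
      (∀ s ∈ Set.Ioo (-δ) δ, Γ s 0 = x₀ ∧ ∀ i < N, Γ s (t (i + 1)) ∈ R) →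
      let T : ℝ := t (N + 1)
      let L : ℝ → ℝ := fun s => BrokenRay.curveLength (g s) (Γ s) T
      let exit : ℝ → M := fun s => Γ s T
      IntervalIntegrable (fun r => BrokenRay.metricDeriv g (Γ 0 r)
        (BrokenRay.velocity (Γ 0) r) (BrokenRay.velocity (Γ 0) r)) MeasureTheory.volume 0 T ∧
      DifferentiableAt ℝ L 0 ∧
      MDifferentiableAt 𝓘(ℝ, ℝ) (𝓡∂ n) exit 0 ∧
      1 / 2 * BrokenRay.rayTransform (BrokenRay.metricDeriv g) (Γ 0) T =
        deriv L 0 - (g 0).inner (Γ 0 T)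
          (BrokenRay.velocityOn (Γ 0) (t N) T T) (BrokenRay.velocity exit 0)) ∧
    -- In particular, this applies to broken rays `γ s` of `g s` which connect the endpoints of `γ 0`
    -- with the same number of reflections; `C¹` dependence on `s` is understood after the segments
    -- of `γ s` are rescaled affinely to those of `γ 0`.
    (∀ (N : ℕ) (t : ℝ → ℕ → ℝ) (δ : ℝ) (v : ℝ → TangentSpace (𝓡∂ n) x₀) (γ Γ : ℝ → ℝ → M), 0 < δ →
      v 0 = v₀ →
      (∀ s ∈ Set.Ioo (-δ) δ, BrokenRay.IsBrokenRay (g s) E R x₀ (v s) N (t s) (γ s) ∧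
        γ s (t s (N + 1)) = γ 0 (t 0 (N + 1)) ∧
        ∀ i ≤ N, ∀ θ ∈ Set.Icc (0 : ℝ) 1,
          Γ s (AffineMap.lineMap (t 0 i) (t 0 (i + 1)) θ) =
            γ s (AffineMap.lineMap (t s i) (t s (i + 1)) θ)) →
      BrokenRay.IsC1Variation n δ N (t 0) Γ →
      HasDerivAt (fun s => t s (N + 1))
        (1 / 2 * BrokenRay.rayTransform (BrokenRay.metricDeriv g) (γ 0) (t 0 (N + 1))) 0) := by
  refine ⟨fun N t γ h hn =>
    BrokenRay.eventually_exists_unique_brokenRay hdisj hunion hg hε hx₀ hinward hunit h hn,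
    fun N t γ h hn => ?_, fun h hh h0 N N' t t' γ γ' hγ hγ' hn hτ hexit =>
    BrokenRay.rayTransform_eq_of_scattering hdisj hunion hg hε hx₀ hinward hunit hh h0 hγ hγ' hn hτ
      hexit, fun N t δ Γ hδ hray hΓ hΓ' => ?_, fun N t δ v γ Γ hδ _ h hΓ =>
    BrokenRay.hasDerivAt_travelTime hunion hg hε hδ h hΓ⟩
  · obtain ⟨h1, h2, h3, h4⟩ :=
      BrokenRay.scattering_derivative hdisj hunion hg hε hx₀ hinward hunit h hn
    exact ⟨h1, h2, h3, BrokenRay.mdifferentiableAt_proj h3, h4⟩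
  · obtain ⟨h1, h2, h3⟩ := BrokenRay.hasDerivAt_curveLength hunion hg hε hδ hray hΓ hΓ'
    refine ⟨h1, h2.differentiableAt, h3, ?_⟩
    have h4 := h2.deriv
    exact (sub_eq_of_eq_add h4).symm
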